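/- Let $y^{(n)}+a_{n-1}(z)\,y^{(n-1)}+\dots+a_1(z)\,y'+a_0(z)\,y=0$, with $a_i\in\mathbb{C}(z)$, be a Fuchsian differential equation on $\mathbb{P}^1(\mathbb{C})$, let $P\in\mathbb{P}^1(\mathbb{C})$, and let $b\in\mathbb{C}$ be a nonsingular base point near $P$ (in the local parameter $t=z-P$, or $t=1/z$ if $P=\infty$, the closed punctured disc $0<|t|\le |t(b)|$ contains no singular point). Suppose that the monodromy group $G$ of the equation at $b$ is isomorphic to a finite dihedral group $D_m$ of order $2m$, $m\ge 1$, and that the local exponents $\lambda_1,\dots,\lambda_n$ at $P$ are pairwise distinct modulo $\mathbb{Z}$. If $n=2$ and $\lambda_1,\lambda_2\in\frac12\mathbb{Z}$, assume moreover that $m\in\{1,2,4\}$. A germ at $b$ of a solution is called *radical* if it equals $R^{1/N}$ with $R\in\mathbb{C}(z)$ and $N\ge 1$. For $g\in\mathbb{C}(z)$ it is called *dihedral with respect to $\sqrt g$* if it is a member of a pair of linearly independent solutions of the form $(p\pm q\sqrt g)^{1/N}$ with $p,q\in\mathbb{C}(z)$ and $N\ge 1$. A germ at $b$ has vanishing order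 $\mu$ at $P$ if it continues analytically to the universal cover of the punctured disc at $P$ and is asymptotic to $c\,t^{\mu}$, $c\neq 0$, as $z\to P$ radially from $b$. Then there are $g\in\mathbb{C}(z)$ and a basis $f_1,\dots,f_n$ of the space of solutions at $b$ such that every $f_i$ is radical or dihedral with respect to $\sqrt g$, and $f_i$ has vanishing order $\lambda_i$ at $P$. Moreover, for each $i$, every solution at $b$ that is radical or dihedral with respect to $\sqrt g$ and has vanishing order $\lambda_i$ at $P$ is a scalar multiple of $f_i$. -/

import Mathlib

open Filter Topology

namespace LinODE

noncomputable section

/-! A family `a : Fin n → RatFunc ℂ` stands for the linear differential equation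
`y⁽ⁿ⁾ + a_{n-1}(z) y⁽ⁿ⁻¹⁾ + ⋯ + a_1(z) y' + a_0(z) y = 0` on the Riemann sphere
`OnePoint ℂ = ℂ ∪ {∞}`. -/

/-- The value at `z ∈ ℂ` of a rational function (used away from its poles). -/
def ratVal (f : RatFunc ℂ) (z : ℂ) : ℂ := RatFunc.eval (RingHom.id ℂ) z f

/-- The rational function `f` has no pole at the point `P` of the sphere. -/
def RegularAt (f : RatFunc ℂ) : OnePoint ℂ → Prop
  | OnePoint.infty => f.num.natDegree ≤ f.denom.natDegree
  | OnePoint.some p => f.denom.eval p ≠ 0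

/-- The value at `P` of a rational function that has no pole there (`f.denom` is monic). -/
def valueAt (f : RatFunc ℂ) : OnePoint ℂ → ℂ
  | OnePoint.infty => f.num.coeff f.denom.natDegree
  | OnePoint.some p => ratVal f p

/-- The factor `z - p` for a finite point `p`, and `z` for the point `∞`. -/
def scale : OnePoint ℂ → RatFunc ℂ
  | OnePoint.infty => RatFunc.X
  | OnePoint.some p => RatFunc.X - RatFunc.C p

/-- The equation is Fuchsian: every point of the sphere is regular or a regular singularity.
At a finite point `p`, `a_i` has a pole of order at most `n - i`;
at `∞`, `a_i(z) = O(z^{-(n-i)})`. -/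
def IsFuchsian {n : ℕ} (a : Fin n → RatFunc ℂ) : Prop :=
  ∀ (P : OnePoint ℂ) (i : Fin n), RegularAt (scale P ^ (n - (i : ℕ)) * a i) P

/-- The indicial polynomial at `P`. With `c_i` the value at `P` of `(z-p)^{n-i} a_i(z)`
(respectively of `z^{n-i} a_i(z)` at `∞`), it is
`[X]_n + ∑_{i<n} c_i [X]_i` where `[X]_i = X (X-1) ⋯ (X-i+1)`, and at `∞`, where the local
parameter is `1/z`, the variable `X` is replaced by `-X`. -/
def indicialPolynomial {n : ℕ} (a : Fin n → RatFunc ℂ) (P : OnePoint ℂ) : Polynomial ℂ :=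
  let I : Polynomial ℂ := descPochhammer ℂ n +
    ∑ i : Fin n, Polynomial.C (valueAt (scale P ^ (n - (i : ℕ)) * a i) P) * descPochhammer ℂ i
  match P with
  | OnePoint.infty => I.comp (-Polynomial.X)
  | OnePoint.some _ => I

/-- `lam` lists the local exponents at `P`, with multiplicity. -/
def IsLocalExponents {n : ℕ} (a : Fin n → RatFunc ℂ) (P : OnePoint ℂ) (lam : Fin n → ℂ) : Prop :=
  (indicialPolynomial a P).roots = Finset.univ.val.map lam

/-- The finite singular points: the poles in `ℂ` of the coefficients. -/
def singularSet {n : ℕ} (a : Fin n → RatFunc ℂ) : Set ℂ :=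
  {z | ∃ i, (a i).denom.eval z = 0}

/-- The function `F` is a holomorphic solution in a neighbourhood of `b`. -/
def IsSolutionAt {n : ℕ} (a : Fin n → RatFunc ℂ) (b : ℂ) (F : ℂ → ℂ) : Prop :=
  AnalyticAt ℂ F b ∧
    ∀ᶠ z in 𝓝 b, iteratedDeriv n F z + ∑ i : Fin n, ratVal (a i) z * iteratedDeriv i F z = 0

theorem IsSolutionAt.add {n : ℕ} {a : Fin n → RatFunc ℂ} {b : ℂ} {F G : ℂ → ℂ}
    (hF : IsSolutionAt a b F) (hG : IsSolutionAt a b G) : IsSolutionAt a b (F + G) := by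
  refine ⟨hF.1.add hG.1, ?_⟩
  filter_upwards [hF.2, hG.2, hF.1.eventually_analyticAt, hG.1.eventually_analyticAt]
    with z h1 h2 h3 h4
  have key : ∀ k : ℕ, iteratedDeriv k (F + G) z = iteratedDeriv k F z + iteratedDeriv k G z :=
    fun k => iteratedDeriv_add h3.contDiffAt h4.contDiffAt
  simp only [key, mul_add, Finset.sum_add_distrib]
  linear_combination h1 + h2

theorem IsSolutionAt.smul {n : ℕ} {a : Fin n → RatFunc ℂ} {b : ℂ} {F : ℂ → ℂ} (c : ℂ)
    (hF : IsSolutionAt a b F) : IsSolutionAt a b (c • F) := by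
  refine ⟨hF.1.const_smul, ?_⟩
  filter_upwards [hF.2, hF.1.eventually_analyticAt] with z h1 h3
  have key : ∀ k : ℕ, iteratedDeriv k (c • F) z = c * iteratedDeriv k F z := fun k => by
    rw [iteratedDeriv_const_smul h3.contDiffAt c, smul_eq_mul]
  simp only [key, mul_left_comm _ c, ← Finset.mul_sum]
  linear_combination c * h1

/-- The space of germs at `b` of holomorphic solutions. -/
def solutionSpace {n : ℕ} (a : Fin n → RatFunc ℂ) (b : ℂ) : Submodule ℂ (Germ (𝓝 b) ℂ) where
  carrier := {φ | ∃ F : ℂ → ℂ, IsSolutionAt a b F ∧ φ = (F : Germ (𝓝 b) ℂ)}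
  zero_mem' := by
    refine ⟨0, ⟨analyticAt_const, Eventually.of_forall fun z => ?_⟩, rfl⟩
    simp
  add_mem' := by
    rintro _ _ ⟨F, hF, rfl⟩ ⟨G, hG, rfl⟩
    exact ⟨F + G, hF.add hG, rfl⟩
  smul_mem' := by
    rintro c _ ⟨F, hF, rfl⟩
    exact ⟨c • F, hF.smul c, rfl⟩

/-- The germ `ψ` is obtained from the germ `φ` by analytic continuation along the loop `γ`. -/
def ContinuesTo {b : ℂ} (γ : Path b b) (φ ψ : Germ (𝓝 b) ℂ) : Prop :=
  ∃ F : unitInterval → ℂ → ℂ,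
    (∀ t, AnalyticAt ℂ (F t) (γ t)) ∧
    (∀ t, ∀ᶠ s in 𝓝 t, F s =ᶠ[𝓝 (γ s)] F t) ∧
    φ = (F 0 : Germ (𝓝 b) ℂ) ∧ ψ = (F 1 : Germ (𝓝 b) ℂ)

/-- The monodromy group with base point `b`: it is generated by (in fact it consists of) the
linear automorphisms of the solution space given by analytic continuation along loops at `b`
that avoid the singular points. -/
def monodromyGroup {n : ℕ} (a : Fin n → RatFunc ℂ) (b : ℂ) :
    Subgroup (solutionSpace a b ≃ₗ[ℂ] solutionSpace a b) :=
  Subgroup.closure {T | ∃ γ : Path b b, (∀ t, γ t ∉ singularSet a) ∧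
    ∀ φ : solutionSpace a b, ContinuesTo γ (φ : Germ (𝓝 b) ℂ) (T φ : Germ (𝓝 b) ℂ)}

/-- The local parameter at `P`: `z - p` at a finite point `p`, and `1/z` at `∞`. -/
def localParam : OnePoint ℂ → ℂ → ℂ
  | OnePoint.infty => fun z => z⁻¹
  | OnePoint.some p => fun z => z - p

/-- `b` is a base point near `P`: it differs from `P`, and the closed disc around `P` (in the
local parameter) whose boundary passes through `b` contains no singular point except possibly
`P` itself. -/
def IsNear {n : ℕ} (a : Fin n → RatFunc ℂ) (b : ℂ) : OnePoint ℂ → Prop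
  | OnePoint.infty => b ≠ 0 ∧ ∀ s ∈ singularSet a, ‖s‖ < ‖b‖
  | OnePoint.some p => b ≠ p ∧ ∀ s ∈ singularSet a, s ≠ p → ‖b - p‖ < ‖s - p‖

/-- The germ `φ` at a point `b` near `P` has vanishing order `μ` at `P`. In terms of the local
parameter `t` at `P`, write `t(z) = t(b) e^s` with `s = 0` at `z = b`. Then `φ`, as a function
`u` of `s`, continues to the half-plane `Re s ≤ 0` (that is, to the universal cover of a
punctured disc around `P`), and `u(s) ~ c e^{μ s}` with `c ≠ 0`, i.e. `φ ~ c (t(z)/t(b))^μ`,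
as `z` tends to `P` from `b` radially. -/
def HasVanishingOrder {b : ℂ} (P : OnePoint ℂ) (φ : Germ (𝓝 b) ℂ) (μ : ℂ) : Prop :=
  ∃ u : ℂ → ℂ, AnalyticOnNhd ℂ u {s | s.re ≤ 0} ∧
    φ = ((fun z => u (Complex.log (localParam P z / localParam P b)) : ℂ → ℂ) :
      Germ (𝓝 b) ℂ) ∧
    ∃ c : ℂ, c ≠ 0 ∧
      Tendsto (fun x : ℝ => Complex.exp (-(μ * (x : ℂ))) * u (x : ℂ)) atBot (𝓝 c)

/-- A radical function: `φ = R^{1/N}` with `R` a rational function and `N ≥ 1`. -/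
def IsRadical {b : ℂ} (φ : Germ (𝓝 b) ℂ) : Prop :=
  ∃ (F : ℂ → ℂ) (N : ℕ) (R : RatFunc ℂ), φ = (F : Germ (𝓝 b) ℂ) ∧ N ≠ 0 ∧
    ∀ᶠ z in 𝓝[≠] b, F z ^ N = ratVal R z

/-- A dihedral solution with respect to `√g`: one member `φ = (p + q√g)^{1/N}` of a pair of
linearly independent solutions `(p ± q√g)^{1/N}`, with `p`, `q` rational functions and `N ≥ 1`.
Here `r` is a branch of `√g` near `b`. -/
def IsDihedralSolution {n : ℕ} (a : Fin n → RatFunc ℂ) {b : ℂ} (g : RatFunc ℂ)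
    (φ : solutionSpace a b) : Prop :=
  ∃ (φ' : solutionSpace a b) (F F' r : ℂ → ℂ) (N : ℕ) (p q : RatFunc ℂ),
    LinearIndependent ℂ ![φ, φ'] ∧
    (φ : Germ (𝓝 b) ℂ) = (F : Germ (𝓝 b) ℂ) ∧ (φ' : Germ (𝓝 b) ℂ) = (F' : Germ (𝓝 b) ℂ) ∧
    N ≠ 0 ∧ MeromorphicAt r b ∧
    ∀ᶠ z in 𝓝[≠] b, r z ^ 2 = ratVal g z ∧
      F z ^ N = ratVal p z + ratVal q z * r z ∧ F' z ^ N = ratVal p z - ratVal q z * r z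

/-- A solution that is radical, or dihedral with respect to `√g`. -/
def IsRadicalOrDihedral {n : ℕ} (a : Fin n → RatFunc ℂ) {b : ℂ} (g : RatFunc ℂ)
    (φ : solutionSpace a b) : Prop :=
  IsRadical (φ : Germ (𝓝 b) ℂ) ∨ IsDihedralSolution a g φ

end

end LinODE

/-!
Writing `t(z) = t(b) e ^ s` for the local parameter `t` at `P`, solutions near `P` become functions
of `s` on a left half-plane, and the local monodromy `M` is the translation by `2πi`. As the
exponents are distinct modulo `ℤ`, `M` has distinct eigenvalues `e ^ (2πi λᵢ)`, and its eigenvectors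
`fᵢ` are the solutions asymptotic to `c e ^ (λᵢ s)`.

The centralizer of `M` in the dihedral monodromy group has index at most two: this is clear if `M`
is a rotation, while a reflection satisfies `M ^ 2 = 1`, hence has at most the two eigenvalues `±1`,
and for `n = 2` one uses `m ∣ 4`. The elements of the centralizer preserve the line of each `fᵢ`. If
some `T₀` lies outside it, the group permutes the lines of `fᵢ` and `T₀ fᵢ`. So for a suitable `N`
the sum `fᵢ ^ N + (T₀ fᵢ) ^ N`, and the product of the differences `fᵢ ^ N - (T₀ fᵢ) ^ N` for any
two indices, are single valued, and they are rational because solutions of a Fuchsian equation grow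
moderately. Hence all these differences are rational multiples of a single `√g`.

Conversely this `√g` is unchanged by `M`, so `M` multiplies every radical or dihedral solution by a
constant; such a solution is an eigenvector of `M`, and its vanishing order tells which one.
-/

namespace LinODE

noncomputable section

section LinearSystem

open Metric Set

variable {E : Type*} [NormedAddCommGroup E] [NormedSpace ℂ E]

theorem hasDerivAt_comp_add_ofReal_mul {f : ℂ → E} {f' : E} {s₀ v : ℂ} {t : ℝ}
    (h : HasDerivAt f f' (s₀ + t * v)) :
    HasDerivAt (fun τ : ℝ => f (s₀ + τ * v)) (v • f') t := by
  have hline : HasDerivAt (fun τ : ℝ => s₀ + τ * v) v t := by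
    simpa using ((Complex.ofRealCLM.hasDerivAt (x := t)).mul_const v).const_add s₀
  exact HasDerivAt.scomp t h hline

theorem add_ofReal_mul_sub_mem {K : Set ℂ} {s₀ s : ℂ} (hK : StarConvex ℝ s₀ K) (hs : s ∈ K)
    {t : ℝ} (ht : t ∈ Icc (0 : ℝ) 1) : s₀ + t * (s - s₀) ∈ K := by
  simpa using hK.add_smul_sub_mem hs ht.1 ht.2

theorem norm_le_of_norm_deriv_le_radial {K : Set ℂ} {s₀ : ℂ} (hK : StarConvex ℝ s₀ K)
    {f f' : ℂ → E} {B B' : ℝ → ℝ} (hf : ∀ s ∈ K, HasDerivAt f (f' s) s)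
    (hB : ∀ x, HasDerivAt B (B' x) x) (h₀ : ‖f s₀‖ ≤ B 0)
    (bound : ∀ s ∈ K, ‖f' s‖ ≤ B' ‖s - s₀‖) {s : ℂ} (hs : s ∈ K) : ‖f s‖ ≤ B ‖s - s₀‖ := by
  have hmem {t : ℝ} (ht : t ∈ Icc (0 : ℝ) 1) := add_ofReal_mul_sub_mem hK hs ht
  have hder {t : ℝ} (ht : t ∈ Icc (0 : ℝ) 1) :=
    hasDerivAt_comp_add_ofReal_mul (hf _ (hmem ht))
  have hnorm {t : ℝ} (ht : t ∈ Icc (0 : ℝ) 1) : ‖s₀ + t * (s - s₀) - s₀‖ = t * ‖s - s₀‖ := by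
    rw [add_sub_cancel_left, norm_mul, Complex.norm_real, Real.norm_of_nonneg ht.1]
  have key := image_norm_le_of_norm_deriv_right_le_deriv_boundary
    (f := fun τ : ℝ => f (s₀ + τ * (s - s₀))) (a := 0) (b := 1)
    (B := fun τ => B (τ * ‖s - s₀‖)) (B' := fun τ => B' (τ * ‖s - s₀‖) * ‖s - s₀‖)
    (fun t ht => (hder ht).continuousAt.continuousWithinAt)
    (fun t ht => (hder (Ico_subset_Icc_self ht)).hasDerivWithinAt)
    (by simpa using h₀)
    (fun t => (hB _).comp t (hasDerivAt_mul_const _))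
    (fun t ht => by
      rw [norm_smul, mul_comm, ← hnorm (Ico_subset_Icc_self ht)]
      gcongr
      exact bound _ (hmem (Ico_subset_Icc_self ht)))
    (right_mem_Icc.2 zero_le_one)
  simpa using key

theorem exists_picard_sequence [CompleteSpace E] {U : Set ℂ} (hU : IsOpen U) (hc : Convex ℝ U)
    {A : ℂ → E →L[ℂ] E} (hA : DifferentiableOn ℂ A U) (s₀ : ℂ) (c : E) :
    ∃ d : ℕ → ℂ → E, (∀ s, d 0 s = c) ∧ (∀ k, d (k + 1) s₀ = 0) ∧
      ∀ k, ∀ s ∈ U, HasDerivAt (d (k + 1)) (A s (d k s)) s := by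
  have exists_next (f : {f : ℂ → E // DifferentiableOn ℂ f U}) :
      ∃ g : {f : ℂ → E // DifferentiableOn ℂ f U},
        g.1 s₀ = 0 ∧ ∀ s ∈ U, HasDerivAt g.1 (A s (f.1 s)) s := by
    obtain ⟨g, hg⟩ := hc.exists_forall_hasDerivWithinAt (hA.clm_apply f.2)
    have hg' s (hs : s ∈ U) : HasDerivAt (fun s => g s - g s₀) (A s (f.1 s)) s :=
      ((hg s hs).hasDerivAt (hU.mem_nhds hs)).sub_const _
    exact ⟨⟨_, fun s hs => (hg' s hs).differentiableAt.differentiableWithinAt⟩, sub_self _, hg'⟩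
  choose next hnext₀ hnext using exists_next
  let d (k : ℕ) : {f : ℂ → E // DifferentiableOn ℂ f U} :=
    Nat.rec ⟨fun _ => c, differentiableOn_const c⟩ (fun _ f => next f) k
  exact ⟨fun k => (d k).1, fun _ => rfl, fun k => hnext₀ (d k), fun k => hnext (d k)⟩

/- The weight `exp (2 * M * ‖s - s₀‖)` makes every Picard step a contraction by `1 / 2`, whatever
the diameter of `K`. -/
theorem norm_picard_le {K : Set ℂ} {s₀ : ℂ} (hK : StarConvex ℝ s₀ K)
    {A : ℂ → E →L[ℂ] E} {c : E} {M : ℝ} (hM₀ : 0 ≤ M) (hM : ∀ s ∈ K, ‖A s‖ ≤ M)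
    {d : ℕ → ℂ → E} (hd₀ : ∀ s, d 0 s = c) (hd₁ : ∀ k, d (k + 1) s₀ = 0)
    (hd : ∀ k, ∀ s ∈ K, HasDerivAt (d (k + 1)) (A s (d k s)) s) (k : ℕ) :
    ∀ s ∈ K, ‖d k s‖ ≤ ‖c‖ * (1 / 2) ^ k * Real.exp (2 * M * ‖s - s₀‖) := by
  induction k with
  | zero =>
    intro s _
    rw [hd₀, pow_zero, mul_one]
    exact le_mul_of_one_le_right (norm_nonneg _) (Real.one_le_exp (by positivity))
  | succ k ih =>
    intro s hs
    set C : ℝ := ‖c‖ * (1 / 2) ^ k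
    have hB (x : ℝ) : HasDerivAt (fun x => C / 2 * Real.exp (2 * M * x))
        (M * (C * Real.exp (2 * M * x))) x := by
      convert! (hasDerivAt_const_mul (2 * M)).exp.const_mul (C / 2) using 1
      ring
    convert norm_le_of_norm_deriv_le_radial hK (hd k) hB ?_ (fun x hx => ?_) hs using 1
    · simp only [C]
      ring
    · rw [hd₁, norm_zero]
      positivity
    · exact (A x).le_of_opNorm_le_of_le (hM x hx) (ih x hx)

theorem exists_isCompact_convex_mem_nhds {U : Set ℂ} (hU : IsOpen U) (hc : Convex ℝ U)
    {s₀ s : ℂ} (h₀ : s₀ ∈ U) (hs : s ∈ U) :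
    ∃ K ⊆ U, IsCompact K ∧ Convex ℝ K ∧ s₀ ∈ K ∧ K ∈ 𝓝 s := by
  have hseg : IsCompact (segment ℝ s₀ s) := by
    rw [← convexHull_pair]
    exact (Set.toFinite {s₀, s}).isCompact_convexHull ℝ
  obtain ⟨u, hsu, huU⟩ :=
    (convex_segment s₀ s).exists_subset_interior_convexHull_finset_of_isCompact hseg
      (hU.mem_nhdsSet.2 (hc.segment_subset h₀ hs))
  exact ⟨_, huU, u.finite_toSet.isCompact_convexHull ℝ, convex_convexHull ℝ _,
    interior_subset (hsu (left_mem_segment ℝ s₀ s)),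
    mem_interior_iff_mem_nhds.1 (hsu (right_mem_segment ℝ s₀ s))⟩

theorem exists_solution_of_convex [CompleteSpace E] {U : Set ℂ} (hU : IsOpen U) (hc : Convex ℝ U)
    {A : ℂ → E →L[ℂ] E} (hA : DifferentiableOn ℂ A U) {s₀ : ℂ} (h₀ : s₀ ∈ U) (c : E) :
    ∃ w : ℂ → E, w s₀ = c ∧ ∀ s ∈ U, HasDerivAt w (A s (w s)) s := by
  obtain ⟨d, hd₀, hd₁, hd⟩ := exists_picard_sequence hU hc hA s₀ c
  refine ⟨fun s => c + ∑' k, d (k + 1) s, by simp [hd₁], fun s hs => ?_⟩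
  obtain ⟨K, hKU, hKc, hK, hK₀, hKs⟩ := exists_isCompact_convex_mem_nhds hU hc h₀ hs
  obtain ⟨r, hr, hrK⟩ := Metric.mem_nhds_iff.1 hKs
  obtain ⟨M, hM⟩ := hKc.exists_bound_of_continuousOn (hA.continuousOn.mono hKU)
  obtain ⟨R, hR⟩ := hKc.exists_bound_of_continuousOn (f := fun x => x - s₀) (by fun_prop)
  have hM₀ : 0 ≤ M := (norm_nonneg _).trans (hM s (mem_of_mem_nhds hKs))
  let u (k : ℕ) : ℝ := ‖c‖ * (1 / 2) ^ k * Real.exp (2 * M * R)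
  have hu : Summable u := (summable_geometric_two.mul_left _).mul_right _
  have bound k x (hx : x ∈ K) : ‖d k x‖ ≤ u k := by
    refine (norm_picard_le (hK.starConvex hK₀) hM₀ hM hd₀ hd₁
      (fun k x hx => hd k x (hKU hx)) k x hx).trans ?_
    simp only [u]
    gcongr
    exact hR x hx
  have hsum : Summable fun k => d k s :=
    .of_norm_bounded hu fun k => bound k s (mem_of_mem_nhds hKs)
  have hderiv : HasDerivAt (fun x => ∑' k, d (k + 1) x) (∑' k, A s (d k s)) s :=
    hasDerivAt_tsum_of_isPreconnected (hu.mul_left M) isOpen_ball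
      (convex_ball s r).isPreconnected (fun k x hx => hd k x (hKU (hrK hx)))
      (fun k x hx => (A x).le_of_opNorm_le_of_le (hM x (hrK hx)) (bound k x (hrK hx)))
      (mem_ball_self hr) ((summable_nat_add_iff 1).2 hsum) (mem_ball_self hr)
  rw [← (A s).map_tsum hsum, hsum.tsum_eq_zero_add, hd₀] at hderiv
  exact hderiv.const_add c

theorem solution_unique_of_starConvex {K : Set ℂ} {s₀ : ℂ} (hK : StarConvex ℝ s₀ K)
    {A : ℂ → E →L[ℂ] E} (hA : ContinuousOn A K) {w₁ w₂ : ℂ → E}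
    (h₁ : ∀ s ∈ K, HasDerivAt w₁ (A s (w₁ s)) s) (h₂ : ∀ s ∈ K, HasDerivAt w₂ (A s (w₂ s)) s)
    (h : w₁ s₀ = w₂ s₀) : EqOn w₁ w₂ K := by
  intro s hs
  have hmem {t : ℝ} (ht : t ∈ Icc (0 : ℝ) 1) := add_ofReal_mul_sub_mem hK hs ht
  have hline : ContinuousOn (fun t : ℝ => A (s₀ + t * (s - s₀))) (Icc 0 1) :=
    hA.comp (by fun_prop) fun t ht => hmem ht
  obtain ⟨M, hM⟩ := isCompact_Icc.exists_bound_of_continuousOn hline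
  have hder {t : ℝ} (ht : t ∈ Icc (0 : ℝ) 1) :
      HasDerivAt (fun τ : ℝ => (w₁ - w₂) (s₀ + τ * (s - s₀)))
        ((s - s₀) • A (s₀ + t * (s - s₀)) ((w₁ - w₂) (s₀ + t * (s - s₀)))) t := by
    refine hasDerivAt_comp_add_ofReal_mul ?_
    simpa using! (h₁ _ (hmem ht)).sub (h₂ _ (hmem ht))
  have hzero := eq_zero_of_abs_deriv_le_mul_abs_self_of_eq_zero_right (K := ‖s - s₀‖ * M)
    (f := fun τ : ℝ => (w₁ - w₂) (s₀ + τ * (s - s₀))) (a := 0) (b := 1)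
    (fun t ht => (hder ht).continuousAt.continuousWithinAt)
    (fun t ht => (hder (Ico_subset_Icc_self ht)).hasDerivWithinAt)
    (by simp [h])
    (fun t ht => by
      rw [norm_smul, mul_assoc]
      gcongr
      exact (A _).le_of_opNorm_le (hM t (Ico_subset_Icc_self ht)) _)
    1 (right_mem_Icc.2 zero_le_one)
  simpa [sub_eq_zero] using hzero

end LinearSystem

section PolynomialGrowth

open Asymptotics Bornology

theorem isBounded_range_of_isBigO_one {f : ℂ → ℂ} (hf : Continuous f)
    (hO : f =O[cobounded ℂ] fun _ => (1 : ℂ)) : IsBounded (Set.range f) := by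
  obtain ⟨c, hc⟩ := isBigO_one_iff ℂ |>.1 hO
  obtain ⟨K, hK, hKc⟩ := mem_cocompact.1 (Metric.cobounded_eq_cocompact (α := ℂ) ▸ hc)
  obtain ⟨C, hC⟩ := hK.exists_bound_of_continuousOn hf.continuousOn
  refine isBounded_iff_forall_norm_le.2 ⟨max C c, ?_⟩
  rintro _ ⟨z, rfl⟩
  by_cases hz : z ∈ K
  · exact (hC z hz).trans (le_max_left _ _)
  · exact (show ‖f z‖ ≤ c from hKc hz).trans (le_max_right _ _)

theorem isBigO_const_pow_cobounded (c : ℂ) (N : ℕ) :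
    (fun _ => c) =O[cobounded ℂ] fun z : ℂ => z ^ N :=
  (isBigO_const_const c one_ne_zero _).trans
    (by simpa using isBigO_pow_pow_cobounded_of_le (R := ℂ) N.zero_le)

theorem exists_polynomial_of_isBigO_pow {f : ℂ → ℂ} (hf : Differentiable ℂ f) {N : ℕ}
    (hO : f =O[cobounded ℂ] fun z => z ^ N) : ∃ p : Polynomial ℂ, ∀ z, f z = p.eval z := by
  induction N generalizing f with
  | zero =>
    obtain ⟨c, hc⟩ := hf.exists_const_forall_eq_of_bounded
      (isBounded_range_of_isBigO_one hf.continuous (by simpa using hO))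
    exact ⟨Polynomial.C c, fun z => by rw [hc, Polynomial.eval_C]⟩
  | succ N ih =>
    have hslope : Differentiable ℂ (dslope f 0) := by
      rw [← differentiableOn_univ, Complex.differentiableOn_dslope univ_mem]
      exact hf.differentiableOn
    obtain ⟨p, hp⟩ := ih hslope <| by
      refine ((hO.sub (isBigO_const_pow_cobounded (f 0) (N + 1))).mul
        (isBigO_refl (fun z : ℂ => z⁻¹) _)).congr' ?_ ?_
      all_goals filter_upwards [eventually_ne_cobounded (0 : ℂ)] with z hz
      · rw [dslope_of_ne _ hz, slope_def_field, sub_zero, div_eq_mul_inv]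
      · rw [pow_succ, mul_inv_cancel_right₀ hz]
    refine ⟨Polynomial.C (f 0) + Polynomial.X * p, fun z => ?_⟩
    have hz := sub_smul_dslope f 0 z
    rw [hp, smul_eq_mul, sub_zero] at hz
    rw [Polynomial.eval_add, Polynomial.eval_C, Polynomial.eval_mul, Polynomial.eval_X, hz]
    ring

theorem tendsto_eval_div_pow_cobounded {p : Polynomial ℂ} {d : ℕ} (hp : p.natDegree ≤ d) :
    Tendsto (fun z : ℂ => p.eval z / z ^ d) (cobounded ℂ) (𝓝 (p.coeff d)) := by
  have hterm : Tendsto (fun z : ℂ => (p.reflect d).eval z⁻¹) (cobounded ℂ) (𝓝 (p.coeff d)) := by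
    have h := ((p.reflect d).continuous.tendsto 0).comp (tendsto_inv₀_cobounded (α := ℂ))
    rwa [← Polynomial.coeff_zero_eq_eval_zero, Polynomial.coeff_reflect,
      Polynomial.revAt_le d.zero_le, Nat.sub_zero] at h
  refine hterm.congr' ?_
  filter_upwards [eventually_ne_cobounded (0 : ℂ)] with z hz
  let _ := invertibleOfNonzero hz
  have hrec := Polynomial.eval₂_reflect_mul_pow (RingHom.id ℂ) z d p hp
  rw [invOf_eq_inv, Polynomial.eval₂_id, Polynomial.eval₂_id] at hrec
  exact eq_div_of_mul_eq (pow_ne_zero d hz) hrec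

end PolynomialGrowth

section RationalValues

theorem ratVal_eq (f : RatFunc ℂ) (z : ℂ) : ratVal f z = f.num.eval z / f.denom.eval z := by
  simp only [ratVal, RatFunc.eval, Polynomial.eval₂_id]

theorem ratVal_algebraMap (p : Polynomial ℂ) (z : ℂ) :
    ratVal (algebraMap (Polynomial ℂ) (RatFunc ℂ) p) z = p.eval z := by
  rw [ratVal_eq, RatFunc.num_algebraMap, RatFunc.denom_algebraMap, Polynomial.eval_one, div_one]

theorem ratVal_mul {f g : RatFunc ℂ} {z : ℂ} (hf : f.denom.eval z ≠ 0) (hg : g.denom.eval z ≠ 0) :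
    ratVal (f * g) z = ratVal f z * ratVal g z :=
  RatFunc.eval_mul _ _ (by rwa [Polynomial.eval₂_id]) (by rwa [Polynomial.eval₂_id])

theorem ratVal_div {p q : Polynomial ℂ} {z : ℂ} (hq : q.eval z ≠ 0) :
    ratVal (algebraMap (Polynomial ℂ) (RatFunc ℂ) p / algebraMap (Polynomial ℂ) (RatFunc ℂ) q) z =
      p.eval z / q.eval z := by
  have hq₀ : q ≠ 0 := by
    rintro rfl
    simp at hq
  set f := algebraMap (Polynomial ℂ) (RatFunc ℂ) p / algebraMap (Polynomial ℂ) (RatFunc ℂ) q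
  have hdenom : f.denom.eval z ≠ 0 := fun h =>
    hq (Polynomial.eval_eq_zero_of_dvd_of_eval_eq_zero (RatFunc.denom_div_dvd p q) h)
  rw [ratVal_eq, div_eq_div_iff hdenom hq, ← Polynomial.eval_mul, ← Polynomial.eval_mul,
    (RatFunc.num_mul_eq_mul_denom_iff hq₀).2 rfl]

theorem analyticAt_ratVal {f : RatFunc ℂ} {z : ℂ} (h : f.denom.eval z ≠ 0) :
    AnalyticAt ℂ (ratVal f) z := by
  rw [funext (ratVal_eq f)]
  exact (AnalyticOnNhd.eval_polynomial f.num z trivial).div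
    (AnalyticOnNhd.eval_polynomial f.denom z trivial) h

theorem eventually_denom_ne_zero (f : RatFunc ℂ) (z : ℂ) :
    ∀ᶠ x in 𝓝[≠] z, f.denom.eval x ≠ 0 :=
  nhdsNE_le_cofinite z (Polynomial.finite_setOfPred_isRoot f.denom_ne_zero).compl_mem_cofinite

open Bornology in
theorem tendsto_ratVal_cobounded {f : RatFunc ℂ} (h : f.num.natDegree ≤ f.denom.natDegree) :
    Tendsto (ratVal f) (cobounded ℂ) (𝓝 (f.num.coeff f.denom.natDegree)) := by
  have hlead : f.denom.coeff f.denom.natDegree = 1 := f.monic_denom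
  have hdiv := (tendsto_eval_div_pow_cobounded h).div
    (tendsto_eval_div_pow_cobounded le_rfl) (hlead ▸ one_ne_zero)
  rw [hlead, div_one] at hdiv
  refine hdiv.congr' ?_
  filter_upwards [eventually_ne_cobounded (0 : ℂ)] with z hz
  rw [Pi.div_apply, ratVal_eq, div_div_div_cancel_right₀ (pow_ne_zero _ hz)]

end RationalValues

section Companion

variable {n : ℕ} {a : Fin n → RatFunc ℂ} {z : ℂ}

theorem finite_singularSet (a : Fin n → RatFunc ℂ) : (singularSet a).Finite := by
  rw [singularSet, Set.ofPred_exists]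
  exact Set.finite_iUnion fun i => Polynomial.finite_setOfPred_isRoot (a i).denom_ne_zero

theorem isOpen_compl_singularSet (a : Fin n → RatFunc ℂ) : IsOpen (singularSet a)ᶜ :=
  (finite_singularSet a).isClosed.isOpen_compl

/-- The coefficient map of the first-order system `w' = companion a z w` on `ℂⁿ` satisfied by the
derivatives of order `< n` of a solution. -/
def companion (a : Fin n → RatFunc ℂ) (z : ℂ) : (Fin n → ℂ) →L[ℂ] (Fin n → ℂ) :=
  .pi fun k =>
    if h : (k : ℕ) + 1 < n then .proj ⟨k + 1, h⟩ else -∑ i, ratVal (a i) z • .proj i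

theorem companion_apply_of_lt (a : Fin n → RatFunc ℂ) (z : ℂ) (v : Fin n → ℂ) {k : Fin n}
    (h : (k : ℕ) + 1 < n) : companion a z v k = v ⟨k + 1, h⟩ := by
  simp [companion, h]

theorem companion_apply_of_eq (a : Fin n → RatFunc ℂ) (z : ℂ) (v : Fin n → ℂ) {k : Fin n}
    (h : (k : ℕ) + 1 = n) : companion a z v k = -∑ i, ratVal (a i) z * v i := by
  simp [companion, h]

theorem differentiableAt_companion (hz : z ∉ singularSet a) :
    DifferentiableAt ℂ (companion a) z := by
  refine (ContinuousLinearMap.piEquivL (𝕜 := ℂ) (E := Fin n → ℂ)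
    (F := fun _ : Fin n => ℂ)).differentiableAt.comp z
    (differentiableAt_pi.2 fun k => ?_)
  split_ifs
  · exact differentiableAt_const _
  · exact (DifferentiableAt.fun_sum fun i _ => (analyticAt_ratVal fun h => hz
      ⟨i, h⟩).differentiableAt.smul_const _).neg

/-- The values at `z` of the derivatives of order `< n` of `F`. -/
def jet (n : ℕ) (F : ℂ → ℂ) (z : ℂ) : Fin n → ℂ := fun k => iteratedDeriv k F z

theorem jet_congr {F G : ℂ → ℂ} (h : F =ᶠ[𝓝 z] G) : jet n F z = jet n G z :=
  funext fun k => (h.iteratedDeriv k).eq_of_nhds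

theorem jet_add {F G : ℂ → ℂ} (hF : AnalyticAt ℂ F z) (hG : AnalyticAt ℂ G z) :
    jet n (F + G) z = jet n F z + jet n G z :=
  funext fun _ => iteratedDeriv_add hF.contDiffAt hG.contDiffAt

theorem jet_smul {F : ℂ → ℂ} (c : ℂ) (hF : AnalyticAt ℂ F z) :
    jet n (c • F) z = c • jet n F z :=
  funext fun _ => iteratedDeriv_const_smul hF.contDiffAt c

theorem hasDerivAt_iteratedDeriv {F : ℂ → ℂ} (h : AnalyticAt ℂ F z) (k : ℕ) :
    HasDerivAt (iteratedDeriv k F) (iteratedDeriv (k + 1) F z) z := by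
  rw [iteratedDeriv_succ, iteratedDeriv_eq_iterate]
  exact (h.iterated_deriv k).differentiableAt.hasDerivAt

theorem IsSolutionAt.eventually {F : ℂ → ℂ} (h : IsSolutionAt a z F) :
    ∀ᶠ x in 𝓝 z, IsSolutionAt a x F :=
  h.1.eventually_analyticAt.and (eventually_eventually_nhds.2 h.2)

theorem IsSolutionAt.hasDerivAt_jet {F : ℂ → ℂ} (h : IsSolutionAt a z F) :
    HasDerivAt (jet n F) (companion a z (jet n F z)) z := by
  refine hasDerivAt_pi.2 fun k => ?_
  suffices hk : companion a z (jet n F z) k = iteratedDeriv (k + 1) F z by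
    rw [hk]
    exact hasDerivAt_iteratedDeriv h.1 k
  rcases (Nat.succ_le_of_lt k.2).lt_or_eq with hk | hk
  · exact companion_apply_of_lt _ _ _ hk
  · rw [companion_apply_of_eq _ _ _ hk, neg_eq_iff_add_eq_zero, add_comm, ← Nat.succ_eq_add_one, hk]
    exact h.2.self_of_nhds

variable [NeZero n] {U : Set ℂ} {w : ℂ → Fin n → ℂ}

theorem jet_of_hasDerivAt_companion (hU : IsOpen U)
    (hw : ∀ z ∈ U, HasDerivAt w (companion a z (w z)) z) (hz : z ∈ U) :
    jet n (fun x => w x 0) z = w z := by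
  suffices key : ∀ k (hk : k < n), ∀ z ∈ U, iteratedDeriv k (fun x => w x 0) z = w z ⟨k, hk⟩ from
    funext fun k => key k k.2 z hz
  intro k hk
  induction k with
  | zero => exact fun z _ => by rw [iteratedDeriv_zero]; rfl
  | succ k ih =>
    intro z hz
    have hk' : k < n := k.lt_succ_self.trans hk
    have hprev : iteratedDeriv k (fun x => w x 0) =ᶠ[𝓝 z] fun x => w x ⟨k, hk'⟩ :=
      mem_of_superset (hU.mem_nhds hz) (ih hk')
    rw [iteratedDeriv_succ, hprev.deriv_eq, (hasDerivAt_pi.1 (hw z hz) ⟨k, hk'⟩).deriv]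
    exact companion_apply_of_lt a z (w z) hk

theorem isSolutionAt_of_hasDerivAt_companion (hU : IsOpen U)
    (hw : ∀ z ∈ U, HasDerivAt w (companion a z (w z)) z) (hz : z ∈ U) :
    IsSolutionAt a z fun x => w x 0 := by
  have hderiv (k : Fin n) x (hx : x ∈ U) := hasDerivAt_pi.1 (hw x hx) k
  have hdiff : DifferentiableOn ℂ (fun x => w x 0) U := fun x hx =>
    (hderiv 0 x hx).differentiableAt.differentiableWithinAt
  refine ⟨hdiff.analyticAt (hU.mem_nhds hz), ?_⟩
  filter_upwards [hU.mem_nhds hz] with x hx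
  obtain ⟨k, hk⟩ : ∃ k : Fin n, (k : ℕ) + 1 = n :=
    ⟨⟨n - 1, Nat.sub_one_lt (NeZero.ne n)⟩, Nat.sub_one_add_one (NeZero.ne n)⟩
  have hjet {y} (hy : y ∈ U) (i : Fin n) : iteratedDeriv i (fun x => w x 0) y = w y i :=
    congrFun (jet_of_hasDerivAt_companion hU hw hy) i
  have htop : iteratedDeriv n (fun x => w x 0) x = -∑ i, ratVal (a i) x * w x i := by
    have hlast : iteratedDeriv k (fun x => w x 0) =ᶠ[𝓝 x] fun y => w y k :=
      mem_of_superset (hU.mem_nhds hx) fun _ hy => hjet hy k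
    rw [← companion_apply_of_eq a x (w x) hk, ← (hderiv k x hx).deriv, ← hlast.deriv_eq,
      ← iteratedDeriv_succ]
    exact congrArg (iteratedDeriv · _ x) hk.symm
  simp only [htop, hjet hx, neg_add_cancel]

theorem exists_solution_on_ball {z₀ z₁ : ℂ} {ρ : ℝ}
    (hball : Metric.ball z₀ ρ ⊆ (singularSet a)ᶜ) (hz₁ : z₁ ∈ Metric.ball z₀ ρ) (c : Fin n → ℂ) :
    ∃ F : ℂ → ℂ, jet n F z₁ = c ∧ ∀ z ∈ Metric.ball z₀ ρ, IsSolutionAt a z F := by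
  obtain ⟨w, hw₁, hw⟩ := exists_solution_of_convex Metric.isOpen_ball (convex_ball z₀ ρ)
    (fun z hz => (differentiableAt_companion (hball hz)).differentiableWithinAt) hz₁ c
  exact ⟨fun x => w x 0, by rw [jet_of_hasDerivAt_companion Metric.isOpen_ball hw hz₁, hw₁],
    fun z hz => isSolutionAt_of_hasDerivAt_companion Metric.isOpen_ball hw hz⟩

theorem IsSolutionAt.eventuallyEq (hz : z ∉ singularSet a)
    {F G : ℂ → ℂ} (hF : IsSolutionAt a z F) (hG : IsSolutionAt a z G)
    (h : jet n F z = jet n G z) : F =ᶠ[𝓝 z] G := by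
  obtain ⟨ρ, hρ, hball⟩ := Metric.eventually_nhds_iff_ball.1 <|
    hF.eventually.and (hG.eventually.and ((isOpen_compl_singularSet a).mem_nhds hz))
  have hEq := solution_unique_of_starConvex
    ((convex_ball z ρ).starConvex (Metric.mem_ball_self hρ))
    (fun x hx => (differentiableAt_companion (hball x hx).2.2).continuousAt.continuousWithinAt)
    (fun x hx => (hball x hx).1.hasDerivAt_jet) (fun x hx => (hball x hx).2.1.hasDerivAt_jet) h
  filter_upwards [Metric.ball_mem_nhds z hρ] with x hx
  simpa [jet] using congrFun (hEq hx) 0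

end Companion

section Horizontal

variable {n : ℕ} {X Y : Type*} [TopologicalSpace X] [TopologicalSpace Y]

/-- Along the map `c`, on the set `U`, the vectors `v x` are the jets at `c x` of solutions that
locally continue one another. -/
def HorizontalOn (a : Fin n → RatFunc ℂ) (U : Set X) (c : X → ℂ) (v : X → Fin n → ℂ) : Prop :=
  ∀ x ∈ U, ∃ F : ℂ → ℂ, IsSolutionAt a (c x) F ∧ ∀ᶠ y in 𝓝 x, v y = jet n F (c y)

variable {a : Fin n → RatFunc ℂ} {U : Set X} {c : X → ℂ} {v w : X → Fin n → ℂ}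

theorem HorizontalOn.comp (h : HorizontalOn a U c v) {f : Y → X} (hf : Continuous f) {V : Set Y}
    (hV : Set.MapsTo f V U) : HorizontalOn a V (c ∘ f) (v ∘ f) := by
  intro y hy
  obtain ⟨F, hF, hv⟩ := h (f y) (hV hy)
  exact ⟨F, hF, hf.continuousAt.eventually hv⟩

theorem HorizontalOn.add (hc : ∀ x ∈ U, ContinuousAt c x) (hv : HorizontalOn a U c v)
    (hw : HorizontalOn a U c w) : HorizontalOn a U c (v + w) := by
  intro x hx
  obtain ⟨F, hF, hFv⟩ := hv x hx
  obtain ⟨G, hG, hGw⟩ := hw x hx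
  refine ⟨F + G, hF.add hG, ?_⟩
  filter_upwards [hFv, hGw, (hc x hx).eventually hF.eventually, (hc x hx).eventually hG.eventually]
    with y hvy hwy hFy hGy
  rw [jet_add hFy.1 hGy.1, Pi.add_apply, hvy, hwy]

theorem HorizontalOn.smul (hc : ∀ x ∈ U, ContinuousAt c x) (k : ℂ) (hv : HorizontalOn a U c v) :
    HorizontalOn a U c (k • v) := by
  intro x hx
  obtain ⟨F, hF, hFv⟩ := hv x hx
  refine ⟨k • F, hF.smul k, ?_⟩
  filter_upwards [hFv, (hc x hx).eventually hF.eventually] with y hvy hFy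
  rw [jet_smul k hFy.1, Pi.smul_apply, hvy]

theorem horizontalOn_jet {F : ℂ → ℂ} (hF : ∀ x ∈ U, IsSolutionAt a (c x) F) :
    HorizontalOn a U c fun x => jet n F (c x) :=
  fun x hx => ⟨F, hF x hx, .of_forall fun _ => rfl⟩

variable [NeZero n]

theorem HorizontalOn.eqOn (hU : IsPreconnected U) (hc : ∀ x ∈ U, ContinuousAt c x)
    (hS : ∀ x ∈ U, c x ∉ singularSet a) (hv : HorizontalOn a U c v) (hw : HorizontalOn a U c w)
    {x₀ : X} (hx₀ : x₀ ∈ U) (h : v x₀ = w x₀) : Set.EqOn v w U := by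
  refine fun x hx => (hU.induction₂ (fun x y => v x = w x ↔ v y = w y) (fun x hx => ?_)
    (fun _ _ _ _ _ _ => Iff.trans) (fun _ _ _ _ => Iff.symm) hx₀ hx).1 h
  obtain ⟨F, hF, hFv⟩ := hv x hx
  obtain ⟨G, hG, hGw⟩ := hw x hx
  refine eventually_nhdsWithin_of_eventually_nhds ?_
  by_cases hFG : jet n F (c x) = jet n G (c x)
  · filter_upwards [hFv, hGw, (hc x hx).eventually
      (hF.eventuallyEq (hS x hx) hG hFG).eventuallyEq_nhds] with y hvy hwy hFGy
    simp only [hFv.self_of_nhds, hGw.self_of_nhds, hvy, hwy, jet_congr hFGy, hFG]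
  · filter_upwards [hFv, hGw, (hc x hx).eventually <|
      (hF.hasDerivAt_jet.continuousAt.ne_iff_eventually_ne hG.hasDerivAt_jet.continuousAt).1 hFG]
      with y hvy hwy hFGy
    rw [hFv.self_of_nhds, hGw.self_of_nhds, hvy, hwy]
    exact iff_of_false hFG hFGy

theorem exists_solution {z : ℂ} (hz : z ∉ singularSet a) (c : Fin n → ℂ) :
    ∃ F : ℂ → ℂ, IsSolutionAt a z F ∧ jet n F z = c := by
  obtain ⟨ρ, hρ, hball⟩ := Metric.isOpen_iff.1 (isOpen_compl_singularSet a) z hz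
  obtain ⟨F, hF, hsol⟩ := exists_solution_on_ball hball (Metric.mem_ball_self hρ) c
  exact ⟨F, hsol z (Metric.mem_ball_self hρ), hF⟩

theorem horizontalOn_of_hasDerivAt {U : Set ℂ} (hU : IsOpen U) {c c' : ℂ → ℂ}
    (hc : ∀ s ∈ U, HasDerivAt c (c' s) s) (hc' : ContinuousOn c' U)
    (hS : ∀ s ∈ U, c s ∉ singularSet a) {w : ℂ → Fin n → ℂ}
    (hw : ∀ s ∈ U, HasDerivAt w (c' s • companion a (c s) (w s)) s) :
    HorizontalOn a U c w := by
  intro s hs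
  obtain ⟨F, hF, hjet⟩ := exists_solution (hS s hs) (w s)
  obtain ⟨ρ, hρ, hball⟩ := Metric.eventually_nhds_iff_ball.1 <|
    (hU.eventually_mem hs).and ((hc s hs).continuousAt.eventually hF.eventually)
  have hcont : ContinuousOn (fun x => c' x • companion a (c x)) (Metric.ball s ρ) := fun x hx =>
    ((hc'.continuousAt (hU.mem_nhds (hball x hx).1)).smul <|
      (differentiableAt_companion (hS x (hball x hx).1)).continuousAt.comp
        (hc x (hball x hx).1).continuousAt).continuousWithinAt
  have hEq := solution_unique_of_starConvex
    ((convex_ball s ρ).starConvex (Metric.mem_ball_self hρ)) hcont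
    (fun x hx => hw x (hball x hx).1)
    (fun x hx => (hball x hx).2.hasDerivAt_jet.scomp x (hc x (hball x hx).1)) hjet.symm
  exact ⟨F, hF, hEq.eventuallyEq_of_mem (Metric.ball_mem_nhds s hρ)⟩

theorem exists_horizontalOn_of_convex {U : Set ℂ} (hU : IsOpen U) (hconv : Convex ℝ U)
    {c c' : ℂ → ℂ} (hc : ∀ s ∈ U, HasDerivAt c (c' s) s) (hc' : DifferentiableOn ℂ c' U)
    (hS : ∀ s ∈ U, c s ∉ singularSet a) {s₀ : ℂ} (h₀ : s₀ ∈ U) (v₀ : Fin n → ℂ) :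
    ∃ w : ℂ → Fin n → ℂ, w s₀ = v₀ ∧ HorizontalOn a U c w := by
  have hdiff : DifferentiableOn ℂ (fun s => c' s • companion a (c s)) U :=
    hc'.smul fun s hs => ((differentiableAt_companion (hS s hs)).comp s
      (hc s hs).differentiableAt).differentiableWithinAt
  obtain ⟨w, hw₀, hw⟩ := exists_solution_of_convex hU hconv hdiff h₀ v₀
  exact ⟨w, hw₀, horizontalOn_of_hasDerivAt hU hc hc'.continuousOn hS hw⟩

theorem HorizontalOn.exists_extend_Iic [LinearOrder X] [OrderTopology X] {s t : X}
    (hv : HorizontalOn a (Set.Iic s) c v) (hc : ContinuousAt c s) (hS : c s ∉ singularSet a)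
    {F : ℂ → ℂ} (hst : s ≤ t) (hF : ∀ r ∈ Set.Icc s t, IsSolutionAt a (c r) F)
    (h : jet n F (c s) = v s) :
    ∃ w, Set.EqOn w v (Set.Iic s) ∧ HorizontalOn a (Set.Iic t) c w := by
  classical
  refine ⟨fun r => if r ≤ s then v r else jet n F (c r), fun r hr => if_pos hr, fun r hr => ?_⟩
  rcases lt_trichotomy r s with hrs | rfl | hsr
  · obtain ⟨G, hG, hGv⟩ := hv r hrs.le
    refine ⟨G, hG, ?_⟩
    filter_upwards [hGv, Iic_mem_nhds hrs] with x hx hxs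
    rw [if_pos (Set.mem_Iic.1 hxs), hx]
  · obtain ⟨G, hG, hGv⟩ := hv r le_rfl
    have hGF : G =ᶠ[𝓝 (c r)] F := hG.eventuallyEq hS (hF r (Set.left_mem_Icc.2 hst))
      (by rw [h, hGv.self_of_nhds])
    refine ⟨G, hG, ?_⟩
    filter_upwards [hGv, hc.eventually hGF.eventuallyEq_nhds] with x hx hGFx
    split_ifs
    exacts [hx, (jet_congr hGFx).symm]
  · refine ⟨F, hF r ⟨hsr.le, hr⟩, ?_⟩
    filter_upwards [Ioi_mem_nhds hsr] with x hx
    rw [if_neg (Set.mem_Ioi.1 hx).not_ge]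

open unitInterval

theorem exists_horizontal_path {x y : ℂ} (γ : Path x y) (hγ : ∀ t, γ t ∉ singularSet a)
    (v₀ : Fin n → ℂ) : ∃ v : I → Fin n → ℂ, v 0 = v₀ ∧ HorizontalOn a Set.univ γ v := by
  choose ρ hρ hball using fun t =>
    Metric.isOpen_iff.1 (isOpen_compl_singularSet a) (γ t) (hγ t)
  obtain ⟨t, ht₀, hmono, ⟨m, hm⟩, hcov⟩ := exists_monotone_Icc_subset_open_cover_unitInterval
    (c := fun t : I => γ ⁻¹' Metric.ball (γ t) (ρ t))
    (fun t => Metric.isOpen_ball.preimage γ.continuous)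
    (fun s _ => Set.mem_iUnion.2 ⟨s, Metric.mem_ball_self (hρ s)⟩)
  have hsubdiv (k : ℕ) : ∃ v : I → Fin n → ℂ, v 0 = v₀ ∧ HorizontalOn a (Set.Iic (t k)) γ v := by
    induction k with
    | zero =>
      obtain ⟨F, hF, hjet⟩ := exists_solution (hγ 0) v₀
      refine ⟨fun s => jet n F (γ s), hjet, horizontalOn_jet fun s hs => ?_⟩
      rwa [show s = 0 from le_antisymm (ht₀ ▸ Set.mem_Iic.1 hs) s.2.1]
    | succ k ih =>
      obtain ⟨v, hv₀, hv⟩ := ih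
      obtain ⟨i, hi⟩ := hcov k
      have hk := hmono k.le_succ
      obtain ⟨F, hjet, hF⟩ := exists_solution_on_ball (hball i)
        (hi (Set.left_mem_Icc.2 hk)) (v (t k))
      obtain ⟨w, hwv, hw⟩ := hv.exists_extend_Iic γ.continuous.continuousAt (hγ _) hk
        (fun s hs => hF _ (hi hs)) hjet
      exact ⟨w, (hwv (t k).2.1).trans hv₀, hw⟩
  obtain ⟨v, hv₀, hv⟩ := hsubdiv m
  exact ⟨v, hv₀, fun s _ => hv s ((hm m le_rfl).symm ▸ s.2.2)⟩

theorem HorizontalOn.eq_of_path {x y : ℂ} {γ : Path x y} (hγ : ∀ t, γ t ∉ singularSet a)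
    {v w : I → Fin n → ℂ} (hv : HorizontalOn a Set.univ γ v)
    (hw : HorizontalOn a Set.univ γ w) {t₀ : I} (h : v t₀ = w t₀) : v = w :=
  funext fun _ => hv.eqOn isPreconnected_univ (fun _ _ => γ.continuous.continuousAt)
    (fun t _ => hγ t) hw (Set.mem_univ t₀) h (Set.mem_univ _)

end Horizontal

section Transport

open unitInterval

variable {n : ℕ} {a : Fin n → RatFunc ℂ} {x y z : ℂ} {c c' c'' : Fin n → ℂ}

/-- Continuation of solutions along `γ` takes the jet `c` at `x` to the jet `c'` at `y`. -/
def Transports (a : Fin n → RatFunc ℂ) (γ : Path x y) (c c' : Fin n → ℂ) : Prop :=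
  ∃ v : I → Fin n → ℂ, HorizontalOn a Set.univ γ v ∧ v 0 = c ∧ v 1 = c'

variable {γ : Path x y} {γ' : Path y z}

theorem Transports.symm (h : Transports a γ c c') : Transports a γ.symm c' c := by
  obtain ⟨v, hv, rfl, rfl⟩ := h
  exact ⟨v ∘ σ, hv.comp continuous_symm (Set.mapsTo_univ _ _), by simp, by simp⟩

theorem transports_jet (γ : Path x y) {F : ℂ → ℂ} (hF : ∀ t, IsSolutionAt a (γ t) F) :
    Transports a γ (jet n F x) (jet n F y) :=
  ⟨fun t => jet n F (γ t), horizontalOn_jet fun t _ => hF t, by simp, by simp⟩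

theorem transports_left_of_horizontalOn_trans {v : I → Fin n → ℂ}
    (hv : HorizontalOn a Set.univ (γ.trans γ') v) :
    Transports a γ (v 0) (v ⟨1 / 2, by norm_num, by norm_num⟩) := by
  have hmem (t : I) : (t : ℝ) / 2 ∈ I := div_mem t.2.1 zero_le_two (by linarith [t.2.2])
  have hleft : γ.trans γ' ∘ (fun t : I => (⟨t / 2, hmem t⟩ : I)) = γ := by
    ext t
    rw [Function.comp_apply, Path.trans_apply, dif_pos (by linarith [t.2.2])]
    congr 1
    ext
    exact mul_div_cancel₀ _ two_ne_zero
  refine ⟨v ∘ fun t : I => (⟨t / 2, hmem t⟩ : I), ?_, by simp, by simp⟩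
  simpa only [hleft] using hv.comp (f := fun t : I => (⟨t / 2, hmem t⟩ : I)) (V := Set.univ)
    (by fun_prop) (Set.mapsTo_univ _ _)

theorem forall_trans_notMem_singularSet (hγ : ∀ t, γ t ∉ singularSet a)
    (hγ' : ∀ t, γ' t ∉ singularSet a) (t : I) : (γ.trans γ') t ∉ singularSet a := by
  have ht : (γ.trans γ') t ∈ Set.range γ ∪ Set.range γ' := Path.trans_range γ γ' ▸ ⟨t, rfl⟩
  rcases ht with ⟨s, hs⟩ | ⟨s, hs⟩
  exacts [hs ▸ hγ s, hs ▸ hγ' s]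

variable [NeZero n]

theorem exists_transports (hγ : ∀ t, γ t ∉ singularSet a) (c : Fin n → ℂ) :
    ∃ c', Transports a γ c c' := by
  obtain ⟨v, h₀, hv⟩ := exists_horizontal_path γ hγ c
  exact ⟨v 1, v, hv, h₀, rfl⟩

theorem Transports.unique (hγ : ∀ t, γ t ∉ singularSet a) (h : Transports a γ c c')
    (h' : Transports a γ c c'') : c' = c'' := by
  obtain ⟨v, hv, hv₀, rfl⟩ := h
  obtain ⟨w, hw, hw₀, rfl⟩ := h'
  rw [hv.eq_of_path hγ hw (hv₀.trans hw₀.symm)]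

theorem Transports.trans (hγ : ∀ t, γ t ∉ singularSet a) (hγ' : ∀ t, γ' t ∉ singularSet a)
    (h : Transports a γ c c') (h' : Transports a γ' c' c'') :
    Transports a (γ.trans γ') c c'' := by
  obtain ⟨v, rfl, hv⟩ :=
    exists_horizontal_path (γ.trans γ') (forall_trans_notMem_singularSet hγ hγ') c
  have hhalf := (transports_left_of_horizontalOn_trans hv).unique hγ h
  have hv' : HorizontalOn a Set.univ (γ'.symm.trans γ.symm) (v ∘ σ) := by
    rw [← Path.trans_symm]
    exact hv.comp continuous_symm (Set.mapsTo_univ _ _)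
  have hright := (transports_left_of_horizontalOn_trans hv').symm
  rw [Path.symm_symm] at hright
  refine ⟨v, hv, rfl, ?_⟩
  refine Eq.trans (by simp) (hright.unique hγ' (?_ : Transports a γ' _ c''))
  convert! h'
  rw [← hhalf, Function.comp_apply]
  congr 1
  ext
  norm_num

theorem exists_linearEquiv_transports (hγ : ∀ t, γ t ∉ singularSet a) :
    ∃ L : (Fin n → ℂ) ≃ₗ[ℂ] (Fin n → ℂ), ∀ c, Transports a γ c (L c) := by
  have hc : ∀ t ∈ (Set.univ : Set I), ContinuousAt γ t := fun t _ => γ.continuous.continuousAt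
  choose L hL using fun c => exists_transports hγ c
  let H : (Fin n → ℂ) →ₗ[ℂ] (Fin n → ℂ) :=
    { toFun := L
      map_add' := fun c c' => by
        obtain ⟨v, hv, hv₀, hv₁⟩ := hL c
        obtain ⟨w, hw, hw₀, hw₁⟩ := hL c'
        exact (hL (c + c')).unique hγ
          ⟨v + w, hv.add hc hw, by simp [hv₀, hw₀], by simp [hv₁, hw₁]⟩
      map_smul' := fun k c => by
        obtain ⟨v, hv, hv₀, hv₁⟩ := hL c
        exact (hL (k • c)).unique hγ ⟨k • v, hv.smul hc k, by simp [hv₀], by simp [hv₁]⟩ }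
  have hinj : Function.Injective H := fun c c' (h : L c = L c') =>
    Transports.unique (γ := γ.symm) (fun _ => hγ _) (hL c).symm (h ▸ (hL c').symm)
  exact ⟨LinearEquiv.ofInjectiveEndo H hinj, hL⟩

end Transport

section Monodromy

variable {n : ℕ} {a : Fin n → RatFunc ℂ} {b : ℂ}

/-- A function representing a germ in the solution space. -/
def rep (φ : solutionSpace a b) : ℂ → ℂ := Classical.choose φ.2

theorem isSolutionAt_rep (φ : solutionSpace a b) : IsSolutionAt a b (rep φ) :=
  (Classical.choose_spec φ.2).1

theorem coe_rep (φ : solutionSpace a b) :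
    (φ : Germ (𝓝 b) ℂ) = ((rep φ : ℂ → ℂ) : Germ (𝓝 b) ℂ) :=
  (Classical.choose_spec φ.2).2

theorem rep_eventuallyEq {φ : solutionSpace a b} {F : ℂ → ℂ}
    (h : (φ : Germ (𝓝 b) ℂ) = (F : Germ (𝓝 b) ℂ)) : rep φ =ᶠ[𝓝 b] F :=
  Germ.coe_eq.1 (coe_rep φ ▸ h)

theorem rep_add (φ ψ : solutionSpace a b) : rep (φ + ψ) =ᶠ[𝓝 b] rep φ + rep ψ :=
  rep_eventuallyEq (by rw [Submodule.coe_add, coe_rep φ, coe_rep ψ, Germ.coe_add])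

theorem rep_smul (c : ℂ) (φ : solutionSpace a b) : rep (c • φ) =ᶠ[𝓝 b] c • rep φ :=
  rep_eventuallyEq (by rw [Submodule.coe_smul, coe_rep φ, Germ.coe_smul])

theorem ext_of_rep {φ ψ : solutionSpace a b} (h : rep φ =ᶠ[𝓝 b] rep ψ) : φ = ψ :=
  Subtype.ext (by rw [coe_rep, coe_rep, Germ.coe_eq.2 h])

variable [NeZero n]

/-- The identification of the solution space at a nonsingular point with the space of jets. -/
def jetEquiv (hb : b ∉ singularSet a) : solutionSpace a b ≃ₗ[ℂ] (Fin n → ℂ) :=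
  .ofBijective
    { toFun := fun φ => jet n (rep φ) b
      map_add' := fun φ ψ => by
        rw [jet_congr (rep_add φ ψ), jet_add (isSolutionAt_rep φ).1 (isSolutionAt_rep ψ).1]
      map_smul' := fun c φ => by
        rw [jet_congr (rep_smul c φ), jet_smul c (isSolutionAt_rep φ).1, RingHom.id_apply] }
    ⟨fun φ ψ h => ext_of_rep ((isSolutionAt_rep φ).eventuallyEq hb (isSolutionAt_rep ψ) h),
      fun v => by
        obtain ⟨F, hF, rfl⟩ := exists_solution hb v
        exact ⟨⟨F, F, hF, rfl⟩, jet_congr (rep_eventuallyEq rfl)⟩⟩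

theorem jetEquiv_apply (hb : b ∉ singularSet a) (φ : solutionSpace a b) :
    jetEquiv hb φ = jet n (rep φ) b := rfl

theorem coe_eq_of_jet_eq (hb : b ∉ singularSet a) {φ : solutionSpace a b} {F : ℂ → ℂ}
    (hF : IsSolutionAt a b F) (h : jet n (rep φ) b = jet n F b) :
    (φ : Germ (𝓝 b) ℂ) = (F : Germ (𝓝 b) ℂ) :=
  (coe_rep φ).trans (Germ.coe_eq.2 ((isSolutionAt_rep φ).eventuallyEq hb hF h))

theorem Transports.continuesTo {γ : Path b b} (hγ : ∀ t, γ t ∉ singularSet a)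
    {φ ψ : solutionSpace a b} (h : Transports a γ (jet n (rep φ) b) (jet n (rep ψ) b)) :
    ContinuesTo γ (φ : Germ (𝓝 b) ℂ) (ψ : Germ (𝓝 b) ℂ) := by
  obtain ⟨v, hv, h₀, h₁⟩ := h
  have hb : b ∉ singularSet a := γ.source ▸ hγ 0
  choose F hF hFv using fun t => hv t (Set.mem_univ t)
  refine ⟨F, fun t => (hF t).1, fun t => ?_, ?_, ?_⟩
  · filter_upwards [hFv t, γ.continuous.continuousAt.eventually (hF t).eventually] with s hvs hsol
    exact (hF s).eventuallyEq (hγ s) hsol (by rw [← hvs, ← (hFv s).self_of_nhds])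
  · have h := (hFv 0).self_of_nhds
    rw [γ.source, h₀] at h
    exact coe_eq_of_jet_eq hb (γ.source ▸ hF 0 :) h
  · have h := (hFv 1).self_of_nhds
    rw [γ.target, h₁] at h
    exact coe_eq_of_jet_eq hb (γ.target ▸ hF 1 :) h

theorem exists_monodromy (γ : Path b b) (hγ : ∀ t, γ t ∉ singularSet a) :
    ∃ T ∈ monodromyGroup a b, ∀ φ : solutionSpace a b,
      Transports a γ (jet n (rep φ) b) (jet n (rep (T φ)) b) := by
  have hb : b ∉ singularSet a := γ.source ▸ hγ 0
  obtain ⟨L, hL⟩ := exists_linearEquiv_transports hγ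
  let T : solutionSpace a b ≃ₗ[ℂ] solutionSpace a b := jetEquiv hb ≪≫ₗ L ≪≫ₗ (jetEquiv hb).symm
  have hT (φ : solutionSpace a b) : Transports a γ (jet n (rep φ) b) (jet n (rep (T φ)) b) := by
    simpa only [← jetEquiv_apply hb, T, LinearEquiv.trans_apply, LinearEquiv.apply_symm_apply]
      using hL (jetEquiv hb φ)
  exact ⟨T, Subgroup.subset_closure ⟨γ, hγ, fun φ => (hT φ).continuesTo hγ⟩, hT⟩

end Monodromy

section SingleValued

open unitInterval

theorem eventually_eventually_eq_zero_iff {𝕜 E : Type*} [NontriviallyNormedField 𝕜]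
    [NormedAddCommGroup E] [NormedSpace 𝕜 E] {f : 𝕜 → E} {z₀ : 𝕜} (hf : AnalyticAt 𝕜 f z₀) :
    ∀ᶠ z in 𝓝 z₀, (∀ᶠ x in 𝓝 z, f x = 0) ↔ ∀ᶠ x in 𝓝 z₀, f x = 0 := by
  rcases hf.eventually_eq_zero_or_eventually_ne_zero with h | h
  · filter_upwards [eventually_eventually_nhds.2 h] with z hz using iff_of_true hz h
  · filter_upwards [eventually_nhdsWithin_iff.1 h] with z hz
    by_cases hz₀ : z = z₀
    · rw [hz₀]
    · refine iff_of_false (fun hev => hz hz₀ hev.self_of_nhds) fun hev => ?_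
      obtain ⟨x, hx, hx'⟩ := ((hev.filter_mono nhdsWithin_le_nhds).and h).exists
      exact hx' hx

theorem analyticAt_comp_tuple {ι : Type*} [Finite ι] {Q : (ι → ℂ) → ℂ} (hQ : Differentiable ℂ Q)
    {F : ι → ℂ → ℂ} {z : ℂ} (hF : ∀ i, AnalyticAt ℂ (F i) z) :
    AnalyticAt ℂ (fun x => Q fun i => F i x) z := by
  have := Fintype.ofFinite ι
  rw [Complex.analyticAt_iff_eventually_differentiableAt]
  filter_upwards [eventually_all.2 fun i => (hF i).eventually_analyticAt] with x hx
  exact (hQ _).comp x (differentiableAt_pi.2 fun i => (hx i).differentiableAt)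

variable {n : ℕ} {a : Fin n → RatFunc ℂ} {ι : Type*} {b z₀ : ℂ} {f : ι → solutionSpace a b}

/-- `F` is obtained from the tuple `f` of solutions at `b` by continuation to `z`, along one path
for all members of the tuple. -/
def IsContinuation (f : ι → solutionSpace a b) (z : ℂ) (F : ι → ℂ → ℂ) : Prop :=
  (∀ i, IsSolutionAt a z (F i)) ∧ ∃ γ : Path b z, (∀ t, γ t ∉ singularSet a) ∧
    ∀ i, Transports a γ (jet n (rep (f i)) b) (jet n (F i) z)

theorem isContinuation_rep (hb : b ∉ singularSet a) (f : ι → solutionSpace a b) :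
    IsContinuation f b fun i => rep (f i) :=
  ⟨fun _ => isSolutionAt_rep _, .refl b, fun _ => hb,
    fun i => transports_jet _ fun _ => isSolutionAt_rep (f i)⟩

variable [NeZero n]

theorem HorizontalOn.eventually_comp_eq_zero [Finite ι] {Q : (ι → ℂ) → ℂ}
    (hQ : Differentiable ℂ Q) {x y : ℂ} {γ : Path x y} (hγ : ∀ t, γ t ∉ singularSet a)
    {v : ι → I → Fin n → ℂ} (hv : ∀ i, HorizontalOn a Set.univ γ (v i)) {s t : I}
    {F G : ι → ℂ → ℂ} (hF : ∀ i, IsSolutionAt a (γ s) (F i))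
    (hFv : ∀ i, jet n (F i) (γ s) = v i s) (hG : ∀ i, IsSolutionAt a (γ t) (G i))
    (hGv : ∀ i, jet n (G i) (γ t) = v i t) (h : ∀ᶠ z in 𝓝 (γ s), Q (fun i => F i z) = 0) :
    ∀ᶠ z in 𝓝 (γ t), Q (fun i => G i z) = 0 := by
  choose S hS hSjet using fun (r : I) i => exists_solution (hγ r) (v i r)
  have hunique {r : I} {A : ι → ℂ → ℂ} (hA : ∀ i, IsSolutionAt a (γ r) (A i))
      (hAv : ∀ i, jet n (A i) (γ r) = v i r) :
      (∀ᶠ z in 𝓝 (γ r), Q (fun i => S r i z) = 0) ↔ ∀ᶠ z in 𝓝 (γ r), Q (fun i => A i z) = 0 := by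
    refine eventually_congr ?_
    filter_upwards [eventually_all.2 fun i => (hS r i).eventuallyEq (hγ r) (hA i)
      ((hSjet r i).trans (hAv i).symm)] with z hz
    simp only [hz]
  refine (hunique hG hGv).1 <| (isPreconnected_univ.induction₂
    (fun r r' => (∀ᶠ z in 𝓝 (γ r), Q (fun i => S r i z) = 0) ↔
      ∀ᶠ z in 𝓝 (γ r'), Q (fun i => S r' i z) = 0) (fun r _ => ?_)
    (fun _ _ _ _ _ _ => Iff.trans) (fun _ _ _ _ => Iff.symm)
    (Set.mem_univ s) (Set.mem_univ t)).1 <| (hunique hF hFv).2 h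
  choose A hA hAv using fun i => hv i r (Set.mem_univ r)
  have hγr : ContinuousAt γ r := γ.continuous.continuousAt
  refine eventually_nhdsWithin_of_eventually_nhds ?_
  filter_upwards [eventually_all.2 hAv,
    hγr.eventually (eventually_all.2 fun i => (hA i).eventually),
    hγr.eventually <| eventually_eventually_eq_zero_iff <|
      analyticAt_comp_tuple hQ fun i => (hA i).1] with r' hvr' hAr' hiff
  rw [hunique hA fun i => (hAv i).self_of_nhds.symm, hunique hAr' fun i => (hvr' i).symm, hiff]

theorem Transports.eventually_eq_comp [Finite ι] {Q : (ι → ℂ) → ℂ}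
    (hQ : Differentiable ℂ Q) {x y : ℂ} {γ : Path x y} (hγ : ∀ t, γ t ∉ singularSet a)
    {F F' G G' : ι → ℂ → ℂ}
    (hF : ∀ i, IsSolutionAt a x (F i)) (hF' : ∀ i, IsSolutionAt a y (F' i))
    (hG : ∀ i, IsSolutionAt a x (G i)) (hG' : ∀ i, IsSolutionAt a y (G' i))
    (hFF' : ∀ i, Transports a γ (jet n (F i) x) (jet n (F' i) y))
    (hGG' : ∀ i, Transports a γ (jet n (G i) x) (jet n (G' i) y))
    (h : (fun z => Q fun i => F i z) =ᶠ[𝓝 x] fun z => Q fun i => G i z) :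
    (fun z => Q fun i => F' i z) =ᶠ[𝓝 y] fun z => Q fun i => G' i z := by
  have := Fintype.ofFinite ι
  choose v hv hv₀ hv₁ using hFF'
  choose w hw hw₀ hw₁ using hGG'
  let D (q : ι ⊕ ι → ℂ) : ℂ := Q (fun i => q (.inl i)) - Q fun i => q (.inr i)
  have hD : Differentiable ℂ D := (hQ.comp (by fun_prop)).sub (hQ.comp (by fun_prop))
  have hzero := HorizontalOn.eventually_comp_eq_zero hD hγ (v := Sum.elim v w)
    (Sum.forall.2 ⟨hv, hw⟩) (s := 0) (t := 1) (F := Sum.elim F G) (G := Sum.elim F' G')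
  simp only [γ.source, γ.target] at hzero
  refine (hzero (Sum.forall.2 ⟨hF, hG⟩)
    (Sum.forall.2 ⟨fun i => (hv₀ i).symm, fun i => (hw₀ i).symm⟩)
    (Sum.forall.2 ⟨hF', hG'⟩) (Sum.forall.2 ⟨fun i => (hv₁ i).symm, fun i => (hw₁ i).symm⟩)
    (h.mono fun z hz => sub_eq_zero.2 hz)).mono fun z hz => sub_eq_zero.1 hz

theorem exists_isContinuation (hb : b ∉ singularSet a) (f : ι → solutionSpace a b)
    (hz₀ : z₀ ∉ singularSet a) : ∃ F, IsContinuation f z₀ F := by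
  obtain ⟨γ, hγ⟩ := ((finite_singularSet a).countable.isPathConnected_compl_of_one_lt_rank
    (by rw [Complex.rank_real_complex]; norm_num)).joinedIn b hb z₀ hz₀
  choose c hc using fun i => exists_transports hγ (jet n (rep (f i)) b)
  choose F hF hFc using fun i => exists_solution hz₀ (c i)
  exact ⟨F, hF, γ, hγ, fun i => (hFc i).symm ▸ hc i⟩

theorem IsContinuation.of_mem_ball {z : ℂ} {F : ι → ℂ → ℂ} (h : IsContinuation f z₀ F) {ρ : ℝ}
    (hz : z ∈ Metric.ball z₀ ρ)
    (hρ : ∀ x ∈ Metric.ball z₀ ρ, x ∉ singularSet a ∧ ∀ i, IsSolutionAt a x (F i)) :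
    IsContinuation f z F := by
  obtain ⟨_, γ, hγ, hT⟩ := h
  have hseg (t : I) : Path.segment z₀ z t ∈ Metric.ball z₀ ρ := by
    rw [Path.segment_apply]
    exact (convex_ball z₀ ρ).lineMap_mem (Metric.mem_ball_self (dist_nonneg.trans_lt hz)) hz t.2
  have hsegS (t : I) := (hρ _ (hseg t)).1
  exact ⟨(hρ z hz).2, γ.trans (.segment z₀ z), forall_trans_notMem_singularSet hγ hsegS,
    fun i => (hT i).trans hγ hsegS (transports_jet _ fun t => (hρ _ (hseg t)).2 i)⟩

variable [Finite ι] {Q : (ι → ℂ) → ℂ}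

theorem IsContinuation.eventuallyEq_comp (hQ : Differentiable ℂ Q)
    (hinv : ∀ T ∈ monodromyGroup a b, (fun z => Q fun i => rep (T (f i)) z) =ᶠ[𝓝 b]
      fun z => Q fun i => rep (f i) z) {F G : ι → ℂ → ℂ}
    (hF : IsContinuation f z₀ F) (hG : IsContinuation f z₀ G) :
    (fun z => Q fun i => F i z) =ᶠ[𝓝 z₀] fun z => Q fun i => G i z := by
  obtain ⟨hF, γ, hγ, hγF⟩ := hF
  obtain ⟨hG, γ', hγ', hγG⟩ := hG
  have hsymm : ∀ t, γ'.symm t ∉ singularSet a := fun t => hγ' _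
  have hloop := forall_trans_notMem_singularSet hγ hsymm
  obtain ⟨T, hTG, hT⟩ := exists_monodromy (γ.trans γ'.symm) hloop
  refine Transports.eventually_eq_comp hQ hγ' (fun i => isSolutionAt_rep (T (f i))) hF
    (fun i => isSolutionAt_rep (f i)) hG (fun i => ?_) hγG (hinv T hTG)
  obtain ⟨c, hc⟩ := exists_transports hsymm (jet n (F i) z₀)
  rw [(hT (f i)).unique hloop ((hγF i).trans hγ hsymm hc)]
  simpa using hc.symm

/-- Away from the singular points, `Φ` is locally the function `Q` of a tuple of solutions. -/
def IsLocallyComp (a : Fin n → RatFunc ℂ) (Q : (ι → ℂ) → ℂ) (Φ : ℂ → ℂ) : Prop :=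
  ∀ z₀ ∉ singularSet a, ∃ F : ι → ℂ → ℂ, (∀ i, IsSolutionAt a z₀ (F i)) ∧
    Φ =ᶠ[𝓝 z₀] fun z => Q fun i => F i z

theorem exists_singleValued (hb : b ∉ singularSet a) (hQ : Differentiable ℂ Q)
    (hinv : ∀ T ∈ monodromyGroup a b, (fun z => Q fun i => rep (T (f i)) z) =ᶠ[𝓝 b]
      fun z => Q fun i => rep (f i) z) :
    ∃ Φ, (Φ =ᶠ[𝓝 b] fun z => Q fun i => rep (f i) z) ∧ IsLocallyComp a Q Φ := by
  choose! F hF using fun z (hz : z ∉ singularSet a) => exists_isContinuation hb f hz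
  have hcont {z₀ : ℂ} (hz₀ : z₀ ∉ singularSet a) {G : ι → ℂ → ℂ} (hG : IsContinuation f z₀ G) :
      (fun z => Q fun i => F z i z) =ᶠ[𝓝 z₀] fun z => Q fun i => G i z := by
    obtain ⟨ρ, hρ, hball⟩ := Metric.eventually_nhds_iff_ball.1 <|
      ((isOpen_compl_singularSet a).eventually_mem hz₀).and
        (eventually_all.2 fun i => (hG.1 i).eventually)
    filter_upwards [Metric.ball_mem_nhds z₀ hρ] with z hz
    exact ((hF z (hball z hz).1).eventuallyEq_comp hQ hinv (hG.of_mem_ball hz hball)).self_of_nhds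
  exact ⟨fun z => Q fun i => F z i z, hcont hb (isContinuation_rep hb f), fun z₀ hz₀ =>
    ⟨F z₀, (hF z₀ hz₀).1, hcont hz₀ (hF z₀ hz₀)⟩⟩

end SingleValued

section LeftEnd

open Asymptotics Real

/-- The filter of complex numbers whose real part tends to `-∞`. -/
abbrev farLeft : Filter ℂ := comap Complex.re atBot

/-- The part of `farLeft` in the strip `|Im s| ≤ π`, where the principal logarithm takes its
values. -/
abbrev farLeftStrip : Filter ℂ := farLeft ⊓ 𝓟 {s | |s.im| ≤ π}

theorem eventually_farLeft {p : ℂ → Prop} :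
    (∀ᶠ s in farLeft, p s) ↔ ∃ L : ℝ, ∀ s : ℂ, s.re < L → p s := by
  simpa using (atBot_basis_Iio.comap Complex.re).eventually_iff

theorem eventually_farLeft_re_lt (δ : ℝ) : ∀ᶠ s in farLeft, s.re < δ :=
  eventually_farLeft.2 ⟨δ, fun _ => id⟩

theorem eventually_eventually_farLeft {p : ℂ → Prop} (h : ∀ᶠ s in farLeft, p s) :
    ∀ᶠ s in farLeft, ∀ᶠ x in 𝓝 s, p x := by
  obtain ⟨L, hL⟩ := eventually_farLeft.1 h
  exact eventually_farLeft.2 ⟨L, fun s hs =>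
    ((isOpen_lt Complex.continuous_re continuous_const).eventually_mem hs).mono hL⟩

theorem tendsto_ofReal_farLeft : Tendsto (fun x : ℝ => (x : ℂ)) atBot farLeft :=
  tendsto_comap_iff.2 tendsto_id

instance : farLeft.NeBot := tendsto_ofReal_farLeft.neBot

theorem tendsto_add_two_pi_I_farLeft :
    Tendsto (fun s : ℂ => s + 2 * π * Complex.I) farLeft farLeft :=
  tendsto_comap_iff.2 <| tendsto_comap.congr fun s => by simp

/-- At most exponential growth, as the real part tends to `-∞` in the strip `|Im s| ≤ π`. -/
def ModerateGrowth {E : Type*} [Norm E] (u : ℂ → E) : Prop :=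
  ∃ N : ℕ, u =O[farLeftStrip] fun s => exp (-(N * s.re))

theorem isBigO_exp_neg_mul_re {K L : ℝ} (h : K ≤ L) :
    (fun s : ℂ => exp (-(K * s.re))) =O[farLeftStrip] fun s => exp (-(L * s.re)) := by
  refine .of_bound' ?_
  filter_upwards [(eventually_farLeft_re_lt 0).filter_mono inf_le_left] with s hs
  rw [norm_of_nonneg (exp_pos _).le, norm_of_nonneg (exp_pos _).le]
  exact exp_le_exp.2 (neg_le_neg (mul_le_mul_of_nonpos_right h hs.le))

theorem moderateGrowth_of_isBigO_exp {E : Type*} [Norm E] {u : ℂ → E} {K : ℝ}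
    (h : u =O[farLeftStrip] fun s => exp (-(K * s.re))) : ModerateGrowth u :=
  let ⟨N, hN⟩ := exists_nat_ge K
  ⟨N, h.trans (isBigO_exp_neg_mul_re hN)⟩

theorem moderateGrowth_const (c : ℂ) : ModerateGrowth fun _ => c :=
  ⟨0, by simpa using isBigO_const_const c (one_ne_zero' ℝ) _⟩

theorem moderateGrowth_cexp_mul (α : ℂ) : ModerateGrowth fun s => Complex.exp (α * s) := by
  refine moderateGrowth_of_isBigO_exp (K := -α.re) (.of_bound (exp (|α.im| * π)) ?_)
  filter_upwards [eventually_inf_principal.2 (.of_forall fun _ => id)] with s hs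
  rw [Complex.norm_exp, norm_of_nonneg (exp_pos _).le, ← exp_add, Complex.mul_re]
  refine exp_le_exp.2 ?_
  have him : |α.im * s.im| ≤ |α.im| * π :=
    (abs_mul _ _).trans_le (mul_le_mul_of_nonneg_left hs (abs_nonneg _))
  linarith [neg_abs_le (α.im * s.im)]

theorem ModerateGrowth.mul {u v : ℂ → ℂ} (hu : ModerateGrowth u) (hv : ModerateGrowth v) :
    ModerateGrowth fun s => u s * v s := by
  obtain ⟨N, hN⟩ := hu
  obtain ⟨M, hM⟩ := hv
  refine ⟨N + M, (hN.mul hM).congr_right fun s => ?_⟩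
  rw [← exp_add]
  push_cast
  ring_nf

theorem ModerateGrowth.add {u v : ℂ → ℂ} (hu : ModerateGrowth u) (hv : ModerateGrowth v) :
    ModerateGrowth fun s => u s + v s := by
  obtain ⟨N, hN⟩ := hu
  obtain ⟨M, hM⟩ := hv
  exact ⟨max N M, (hN.trans (isBigO_exp_neg_mul_re (Nat.cast_le.2 (le_max_left _ _)))).add
    (hM.trans (isBigO_exp_neg_mul_re (Nat.cast_le.2 (le_max_right _ _))))⟩

theorem ModerateGrowth.mvPolynomial_eval {ι : Type*} {u : ι → ℂ → ℂ}
    (hu : ∀ i, ModerateGrowth (u i)) (Q : MvPolynomial ι ℂ) :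
    ModerateGrowth fun s => Q.eval fun i => u i s := by
  induction Q using MvPolynomial.induction_on with
  | C c => simpa using moderateGrowth_const c
  | add p q hp hq => simpa using hp.add hq
  | mul_X p i hp => simpa using hp.mul (hu i)

theorem norm_le_mul_exp_of_norm_deriv_le {E : Type*} [NormedAddCommGroup E] [NormedSpace ℂ E]
    {W W' : ℂ → E} {C K L : ℝ} (hW : ∀ s : ℂ, s.re ≤ L → HasDerivAt W (W' s) s)
    (hC : ∀ s : ℂ, s.re ≤ L → ‖W' s‖ ≤ K * ‖W s‖) {s : ℂ} (hs : s.re ≤ L)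
    (h₀ : ‖W (L + s.im * Complex.I)‖ ≤ C) : ‖W s‖ ≤ C * exp (K * (L - s.re)) := by
  set s₀ : ℂ := L + s.im * Complex.I
  have hre (τ : ℝ) : (s₀ + τ * -1).re = L - τ := by simp [s₀, sub_eq_add_neg]
  have hder {τ : ℝ} (hτ : 0 ≤ τ) :
      HasDerivAt (fun τ : ℝ => W (s₀ + τ * -1)) ((-1 : ℂ) • W' (s₀ + τ * -1)) τ :=
    hasDerivAt_comp_add_ofReal_mul (hW _ (by rw [hre]; linarith))
  have key := norm_le_gronwallBound_of_norm_deriv_right_le (δ := C) (K := K) (ε := 0)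
    (f := fun τ : ℝ => W (s₀ + τ * -1)) (a := 0) (b := L - s.re)
    (fun τ hτ => (hder hτ.1).continuousAt.continuousWithinAt)
    (fun τ hτ => (hder hτ.1).hasDerivWithinAt) (by simpa using h₀)
    (fun τ hτ => by
      rw [norm_smul, norm_neg, norm_one, one_mul, add_zero]
      exact hC _ (by rw [hre]; linarith [hτ.1])) (L - s.re) ⟨by linarith, le_rfl⟩
  have hend : s₀ + ((L - s.re : ℝ) : ℂ) * -1 = s := by
    apply Complex.ext <;> simp [s₀]
  rwa [hend, gronwallBound_ε0, sub_zero] at key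

theorem moderateGrowth_of_deriv_isBigO {E : Type*} [NormedAddCommGroup E] [NormedSpace ℂ E]
    {W W' : ℂ → E} (hW : ∀ᶠ s in farLeft, HasDerivAt W (W' s) s) (hO : W' =O[farLeft] W) :
    ModerateGrowth W := by
  obtain ⟨K, hK⟩ := hO.bound
  obtain ⟨L, hL⟩ := eventually_farLeft.1 (hW.and hK)
  have hlt {s : ℂ} (hs : s.re ≤ L - 1) : s.re < L := by linarith
  have hseg : ContinuousOn (fun y : ℝ => W ((L - 1 : ℝ) + y * Complex.I)) (Set.Icc (-π) π) :=
    fun y _ => (ContinuousAt.comp (f := fun y : ℝ => ((L - 1 : ℝ) + y * Complex.I : ℂ))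
      (hL _ (hlt (by simp))).1.continuousAt (by fun_prop)).continuousWithinAt
  obtain ⟨C, hC⟩ := isCompact_Icc.exists_bound_of_continuousOn hseg
  refine moderateGrowth_of_isBigO_exp (K := K) (.of_bound (C * exp (K * (L - 1))) ?_)
  filter_upwards [(eventually_farLeft_re_lt (L - 1)).filter_mono inf_le_left,
    eventually_inf_principal.2 (.of_forall fun _ => id)] with s hs him
  rw [norm_of_nonneg (exp_pos _).le, mul_assoc, ← exp_add, ← sub_eq_add_neg, ← mul_sub]
  exact norm_le_mul_exp_of_norm_deriv_le (fun x hx => (hL x (hlt hx)).1)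
    (fun x hx => (hL x (hlt hx)).2) hs.le (hC s.im (abs_le.1 him))

end LeftEnd

section ExpExpansion

open Asymptotics Real

/-- Far to the left, `u s = e^{μ s} H(e^s)` with `H` holomorphic at `0` and `H 0 = c`. -/
def HasExpExpansion (u : ℂ → ℂ) (μ c : ℂ) : Prop :=
  ∃ H : ℂ → ℂ, AnalyticAt ℂ H 0 ∧ H 0 = c ∧
    ∀ᶠ s in farLeft, u s = Complex.exp (μ * s) * H (Complex.exp s)

variable {u u' v : ℂ → ℂ} {μ c d : ℂ}

theorem HasExpExpansion.tendsto (h : HasExpExpansion u μ c) :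
    Tendsto (fun s => Complex.exp (-(μ * s)) * u s) farLeft (𝓝 c) := by
  obtain ⟨H, hH, rfl, hu⟩ := h
  refine (hH.continuousAt.tendsto.comp Complex.tendsto_exp_comap_re_atBot).congr' ?_
  filter_upwards [hu] with s hs
  rw [hs, ← mul_assoc, ← Complex.exp_add, neg_add_cancel, Complex.exp_zero, one_mul,
    Function.comp_apply]

theorem HasExpExpansion.linearCombination (hu : HasExpExpansion u μ c)
    (hv : HasExpExpansion v μ d) (k l : ℂ) :
    HasExpExpansion (fun s => k * u s + l * v s) μ (k * c + l * d) := by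
  obtain ⟨H, hH, rfl, hu⟩ := hu
  obtain ⟨G, hG, rfl, hv⟩ := hv
  refine ⟨fun t => k * H t + l * G t,
    (analyticAt_const.mul hH).add (analyticAt_const.mul hG), rfl, ?_⟩
  filter_upwards [hu, hv] with s hus hvs
  rw [hus, hvs]
  ring

theorem HasExpExpansion.deriv (h : HasExpExpansion u μ c)
    (hu' : ∀ᶠ s in farLeft, HasDerivAt u (u' s) s) : HasExpExpansion u' μ (μ * c) := by
  obtain ⟨H, hH, rfl, hu⟩ := h
  refine ⟨fun t => μ * H t + t * _root_.deriv H t,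
    (analyticAt_const.mul hH).add (analyticAt_id.mul hH.deriv), by ring, ?_⟩
  filter_upwards [eventually_eventually_farLeft hu, hu',
    Complex.tendsto_exp_comap_re_atBot.eventually hH.eventually_analyticAt] with s hus hu's hHs
  have hmul := (((hasDerivAt_id s).const_mul μ).cexp).mul
    (hHs.differentiableAt.hasDerivAt.comp s (Complex.hasDerivAt_exp s))
  rw [hu's.unique (hmul.congr_of_eventuallyEq hus)]
  simp only [id_eq, Function.comp_apply]
  ring

theorem HasExpExpansion.eventually_add_two_pi_I (h : HasExpExpansion u μ c) :
    ∀ᶠ s in farLeft, u (s + 2 * π * Complex.I) = Complex.exp (2 * π * Complex.I * μ) * u s := by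
  obtain ⟨H, -, -, hu⟩ := h
  filter_upwards [hu, tendsto_add_two_pi_I_farLeft.eventually hu] with s hs hs'
  rw [hs', hs, Complex.exp_add s, Complex.exp_two_pi_mul_I, mul_one, mul_add, Complex.exp_add]
  ring_nf

theorem eq_zero_of_tendsto_exp_mul {δ : ℂ} (hc : c ≠ 0)
    (h : Tendsto (fun x : ℝ => Complex.exp (δ * x)) atBot (𝓝 c)) : δ = 0 := by
  have hexp (τ : ℝ) : Complex.exp (δ * τ) = 1 := by
    have hshift : Tendsto (fun x : ℝ => Complex.exp (δ * x) * Complex.exp (δ * τ)) atBot (𝓝 c) :=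
      (h.comp (tendsto_atBot_add_const_right _ τ tendsto_id)).congr fun x => by
        simp [mul_add, Complex.exp_add]
    exact (mul_eq_left₀ hc).1 (tendsto_nhds_unique (h.mul_const _) hshift)
  have hderiv : HasDerivAt (fun τ : ℝ => Complex.exp (δ * τ)) δ 0 := by
    simpa using ((Complex.ofRealCLM.hasDerivAt (x := 0)).const_mul δ).cexp
  rw [funext hexp] at hderiv
  exact hderiv.unique (hasDerivAt_const _ _)

theorem eq_of_tendsto_exp_neg_mul {ν : ℂ} {f : ℝ → ℂ} (hc : c ≠ 0) (hd : d ≠ 0)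
    (hμ : Tendsto (fun x : ℝ => Complex.exp (-(μ * x)) * f x) atBot (𝓝 c))
    (hν : Tendsto (fun x : ℝ => Complex.exp (-(ν * x)) * f x) atBot (𝓝 d)) : μ = ν := by
  refine (sub_eq_zero.1 (eq_zero_of_tendsto_exp_mul (div_ne_zero hc hd)
    ((hμ.div hν hd).congr' ?_))).symm
  filter_upwards [hμ.eventually_ne hc] with x hx
  rw [Pi.div_apply, mul_div_mul_right _ _ (right_ne_zero_of_mul hx), ← Complex.exp_sub]
  ring_nf

theorem isBigO_farLeft_of_periodic (hu : Function.Periodic u (2 * π * Complex.I))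
    (hO : u =O[farLeftStrip] fun _ => (1 : ℝ)) : u =O[farLeft] fun _ => (1 : ℝ) := by
  obtain ⟨C, hC⟩ := hO.bound
  obtain ⟨L, hL⟩ := eventually_farLeft.1 (eventually_inf_principal.1 hC)
  refine .of_bound C (eventually_farLeft.2 ⟨L, fun s hs => ?_⟩)
  set k : ℤ := round (s.im / (2 * π))
  have hmem : |(s - k * (2 * π * Complex.I)).im| ≤ π := by
    have him : (s - k * (2 * π * Complex.I)).im = 2 * π * (s.im / (2 * π) - k) := by
      have := Real.pi_ne_zero
      simp only [Complex.sub_im, Complex.mul_im, Complex.mul_re, Complex.intCast_re,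
        Complex.intCast_im, Complex.ofReal_re, Complex.ofReal_im, Complex.re_ofNat,
        Complex.im_ofNat, Complex.I_re, Complex.I_im]
      field_simp
      ring
    rw [him, abs_mul, abs_of_pos Real.two_pi_pos]
    nlinarith [abs_sub_round (s.im / (2 * π)), Real.pi_pos]
  rw [← hu.sub_int_mul_eq k]
  exact hL _ (by simpa using hs) hmem

theorem exists_analyticAt_comp_exp (hu : Function.Periodic u (2 * π * Complex.I))
    (hd : ∀ᶠ s in farLeft, DifferentiableAt ℂ u s) (hO : u =O[farLeftStrip] fun _ => (1 : ℝ)) :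
    ∃ H : ℂ → ℂ, AnalyticAt ℂ H 0 ∧ ∀ s, u s = H (Complex.exp s) := by
  let f : ℂ → ℂ := fun w => u (2 * π * Complex.I * w)
  have hf : Function.Periodic f (1 : ℝ) := fun w => by
    simpa [f, mul_add] using hu (2 * π * Complex.I * w)
  have hT : Tendsto (fun w : ℂ => 2 * π * Complex.I * w) (comap Complex.im atTop) farLeft := by
    refine tendsto_comap_iff.2 ?_
    have hre : Complex.re ∘ (fun w : ℂ => 2 * π * Complex.I * w) = fun w => -(2 * π) * w.im := by
      ext w
      simp
    exact hre ▸ tendsto_comap.const_mul_atTop_of_neg (neg_neg_of_pos Real.two_pi_pos)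
  have hfd : ∀ᶠ w in comap Complex.im atTop, DifferentiableAt ℂ f w :=
    (hT.eventually hd).mono fun w hw => DifferentiableAt.comp w hw (by fun_prop)
  have hfO : BoundedAtFilter (comap Complex.im atTop) f :=
    (isBigO_farLeft_of_periodic hu hO).comp_tendsto hT
  refine ⟨Function.Periodic.cuspFunction 1 f, ?_, fun s => ?_⟩
  · rw [Complex.analyticAt_iff_eventually_differentiableAt, ← nhdsNE_sup_pure, eventually_sup]
    exact ⟨Function.Periodic.eventually_differentiableAt_cuspFunction_nhds_ne_zero one_pos hf hfd,
      Function.Periodic.differentiableAt_cuspFunction_zero one_pos hf hfd hfO⟩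
  · have hs : 2 * π * Complex.I * (s / (2 * π * Complex.I)) = s :=
      mul_div_cancel₀ s Complex.two_pi_I_ne_zero
    have hq : Function.Periodic.qParam 1 (s / (2 * π * Complex.I)) = Complex.exp s := by
      rw [Function.Periodic.qParam, Complex.ofReal_one, div_one, hs]
    rw [← hq, Function.Periodic.eq_cuspFunction one_ne_zero hf]
    exact congrArg u hs.symm

theorem HasExpExpansion.congr (h : HasExpExpansion u μ c) (huv : ∀ᶠ s in farLeft, u s = v s) :
    HasExpExpansion v μ c := by
  obtain ⟨H, hH, hc, hu⟩ := h
  exact ⟨H, hH, hc, (hu.and huv).mono fun s hs => hs.2 ▸ hs.1⟩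

theorem exists_hasExpExpansion_comp_exp {H : ℂ → ℂ} (hH : AnalyticAt ℂ H 0)
    (hne : ¬ ∀ᶠ t in 𝓝 0, H t = 0) (α : ℂ) :
    ∃ μ c, c ≠ 0 ∧ HasExpExpansion (fun s => Complex.exp (α * s) * H (Complex.exp s)) μ c := by
  obtain ⟨k, G, hG, hG₀, hHG⟩ := hH.exists_eventuallyEq_pow_smul_nonzero_iff.2 hne
  refine ⟨α + k, G 0, hG₀, G, hG, rfl, ?_⟩
  filter_upwards [Complex.tendsto_exp_comap_re_atBot.eventually hHG] with s hs
  rw [hs, sub_zero, smul_eq_mul, ← Complex.exp_nat_mul, ← mul_assoc, ← Complex.exp_add, ← add_mul]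

theorem exists_analyticAt_comp_exp_of_halfPlane {δ : ℝ} (hd : DifferentiableOn ℂ u {s | s.re < δ})
    (hper : ∀ s : ℂ, s.re < δ → u (s + 2 * π * Complex.I) = u s)
    (hO : u =O[farLeftStrip] fun _ => (1 : ℝ)) :
    ∃ H : ℂ → ℂ, AnalyticAt ℂ H 0 ∧ ∀ᶠ s in farLeft, u s = H (Complex.exp s) := by
  classical
  let w : ℂ → ℂ := fun s => if s.re < δ then u s else 0
  have hw {s : ℂ} (hs : s.re < δ) : w s = u s := if_pos hs
  have hleft := eventually_farLeft_re_lt δ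
  have hwper : Function.Periodic w (2 * π * Complex.I) := fun s => by
    have hre : (s + 2 * π * Complex.I).re = s.re := by simp
    simp only [w, hre]
    exact ite_congr rfl (hper s) fun _ => rfl
  have hwd : ∀ᶠ s in farLeft, DifferentiableAt ℂ w s := by
    filter_upwards [eventually_eventually_farLeft hleft] with s hs
    have hmem : {s : ℂ | s.re < δ} ∈ 𝓝 s := hs
    exact (hd.differentiableAt hmem).congr_of_eventuallyEq (hs.mono fun x => hw)
  obtain ⟨H, hH, hwH⟩ := exists_analyticAt_comp_exp hwper hwd <|
    hO.congr' ((hleft.filter_mono inf_le_left).mono fun s hs => (hw hs).symm) .rfl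
  exact ⟨H, hH, hleft.mono fun s hs => hw hs ▸ hwH s⟩

theorem exists_hasExpExpansion {δ : ℝ} {χ : ℂ} (hd : DifferentiableOn ℂ u {s | s.re < δ})
    (hχ : χ ≠ 0) (hper : ∀ s : ℂ, s.re < δ → u (s + 2 * π * Complex.I) = χ * u s)
    (hO : ModerateGrowth u) (hne : ¬ ∀ᶠ s in farLeft, u s = 0) :
    ∃ μ c, c ≠ 0 ∧ HasExpExpansion u μ c := by
  obtain ⟨α, hα⟩ : ∃ α : ℂ, Complex.exp (2 * π * Complex.I * α) = χ :=
    ⟨Complex.log χ / (2 * π * Complex.I), by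
      rw [mul_div_cancel₀ _ Complex.two_pi_I_ne_zero, Complex.exp_log hχ]⟩
  obtain ⟨N, hN⟩ := (moderateGrowth_cexp_mul (-α)).mul hO
  have hperw (s : ℂ) (hs : s.re < δ) : Complex.exp ((N - α) * (s + 2 * π * Complex.I)) *
      u (s + 2 * π * Complex.I) = Complex.exp ((N - α) * s) * u s := by
    rw [hper s hs, ← hα, mul_add, Complex.exp_add, sub_mul _ _ (2 * π * Complex.I),
      Complex.exp_sub, Complex.exp_nat_mul_two_pi_mul_I, mul_comm α]
    field_simp [Complex.exp_ne_zero]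
  have hOw : (fun s => Complex.exp ((N - α) * s) * u s) =O[farLeftStrip] fun _ => (1 : ℝ) := by
    have hexp : (fun s : ℂ => Complex.exp (N * s)) =O[farLeftStrip] fun s => exp (N * s.re) :=
      .of_bound' (.of_forall fun s => by simp [Complex.norm_exp])
    refine (hexp.mul hN).congr (fun s => ?_) fun s => ?_
    · rw [← mul_assoc, ← Complex.exp_add, ← add_mul, sub_eq_add_neg]
    · rw [← exp_add, add_neg_cancel, exp_zero]
  obtain ⟨H, hH, huH⟩ := exists_analyticAt_comp_exp_of_halfPlane
    (.fun_mul (by fun_prop) hd) hperw hOw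
  replace huH : ∀ᶠ s in farLeft, Complex.exp ((α - N) * s) * H (Complex.exp s) = u s := by
    filter_upwards [huH] with s hs
    rw [← hs, ← mul_assoc, ← Complex.exp_add, ← add_mul, sub_add_sub_cancel, sub_self,
      zero_mul, Complex.exp_zero, one_mul]
  have hHne : ¬ ∀ᶠ t in 𝓝 0, H t = 0 := fun h => hne <| by
    filter_upwards [huH, Complex.tendsto_exp_comap_re_atBot.eventually h] with s hs h0
    rw [← hs, h0, mul_zero]
  obtain ⟨μ, c, hc, hμ⟩ := exists_hasExpExpansion_comp_exp hH hHne (α - N)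
  exact ⟨μ, c, hc, hμ.congr huH⟩

end ExpExpansion

section LocalParameter

open Complex (I exp)
open scoped Real

/-- The finite point from which `localParam P` measures: `P` itself, and `0` when `P = ∞`. -/
def center : OnePoint ℂ → ℂ
  | OnePoint.infty => 0
  | OnePoint.some p => p

/-- The exponent `±1` for which `localParam P z = (z - center P) ^ orient P`. -/
def orient : OnePoint ℂ → ℂ
  | OnePoint.infty => -1
  | OnePoint.some _ => 1

/-- The universal covering `s ↦ z`, `t(z) = t(b) e^s`, of a punctured disc around `P`, where `t` is
the local parameter at `P`. -/
def localExp (P : OnePoint ℂ) (b s : ℂ) : ℂ :=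
  center P + (b - center P) * exp (orient P * s)

/-- The branch at `b` of the inverse of the covering `localExp P b`. -/
def localLog (P : OnePoint ℂ) (b z : ℂ) : ℂ :=
  Complex.log (localParam P z / localParam P b)

variable {P : OnePoint ℂ} {b : ℂ}

theorem orient_mul_self (P : OnePoint ℂ) : orient P * orient P = 1 := by
  induction P using OnePoint.rec <;> simp [orient]

theorem localParam_injective (P : OnePoint ℂ) : Function.Injective (localParam P) := by
  induction P using OnePoint.rec with
  | infty => exact inv_injective
  | coe p => exact sub_left_injective

theorem localParam_center (P : OnePoint ℂ) : localParam P (center P) = 0 := by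
  induction P using OnePoint.rec <;> simp [localParam, center]

theorem localParam_ne_zero {z : ℂ} (hz : z ≠ center P) : localParam P z ≠ 0 :=
  localParam_center P ▸ (localParam_injective P).ne hz

theorem continuousAt_localParam {z : ℂ} (hz : z ≠ center P) : ContinuousAt (localParam P) z := by
  induction P using OnePoint.rec with
  | infty => exact continuousAt_inv₀ hz
  | coe p => exact (continuous_id.sub continuous_const).continuousAt

theorem localParam_localExp (P : OnePoint ℂ) (b s : ℂ) :
    localParam P (localExp P b s) = localParam P b * exp s := by
  induction P using OnePoint.rec <;>
    simp [localParam, localExp, center, orient, Complex.exp_neg, mul_comm]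

theorem localExp_sub_center (P : OnePoint ℂ) (b s : ℂ) :
    localExp P b s - center P = (b - center P) * exp (orient P * s) :=
  add_sub_cancel_left _ _

theorem localExp_ne_center (hb : b ≠ center P) (s : ℂ) : localExp P b s ≠ center P :=
  sub_ne_zero.1 <| localExp_sub_center P b s ▸
    mul_ne_zero (sub_ne_zero.2 hb) (Complex.exp_ne_zero _)

theorem localExp_zero (P : OnePoint ℂ) (b : ℂ) : localExp P b 0 = b := by
  simp [localExp]

theorem localExp_add_two_pi_I (P : OnePoint ℂ) (b s : ℂ) :
    localExp P b (s + 2 * π * I) = localExp P b s :=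
  localParam_injective P <| by
    rw [localParam_localExp, localParam_localExp, Complex.exp_periodic s]

theorem hasDerivAt_localExp (P : OnePoint ℂ) (b s : ℂ) :
    HasDerivAt (localExp P b) (orient P * (localExp P b s - center P)) s := by
  have h := ((((hasDerivAt_id s).const_mul (orient P)).cexp).const_mul
    (b - center P)).const_add (center P)
  refine h.congr_deriv ?_
  rw [localExp_sub_center, id]
  ring

theorem differentiable_localExp (P : OnePoint ℂ) (b : ℂ) : Differentiable ℂ (localExp P b) :=
  fun s => (hasDerivAt_localExp P b s).differentiableAt

theorem tendsto_localExp_zero (P : OnePoint ℂ) (b : ℂ) : Tendsto (localExp P b) (𝓝 0) (𝓝 b) := by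
  simpa only [localExp_zero] using (differentiable_localExp P b).continuous.tendsto 0

theorem localLog_localExp (hb : b ≠ center P) {s : ℂ} (h₁ : -π < s.im) (h₂ : s.im ≤ π) :
    localLog P b (localExp P b s) = s := by
  rw [localLog, localParam_localExp, mul_div_cancel_left₀ _ (localParam_ne_zero hb),
    Complex.log_exp h₁ h₂]

theorem eventually_localLog_localExp (hb : b ≠ center P) :
    ∀ᶠ s in 𝓝 0, localLog P b (localExp P b s) = s := by
  have him : ∀ᶠ s : ℂ in 𝓝 0, s.im ∈ Set.Ioo (-π) π :=
    Complex.continuous_im.continuousAt.eventually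
      (Ioo_mem_nhds (by simp [Real.pi_pos]) (by simp [Real.pi_pos]))
  exact him.mono fun s hs => localLog_localExp hb hs.1 hs.2.le

theorem localExp_localLog (hb : b ≠ center P) {z : ℂ} (hz : z ≠ center P) :
    localExp P b (localLog P b z) = z := by
  refine localParam_injective P ?_
  rw [localParam_localExp, localLog, Complex.exp_log
    (div_ne_zero (localParam_ne_zero hz) (localParam_ne_zero hb)),
    mul_div_cancel₀ _ (localParam_ne_zero hb)]

theorem localLog_self (hb : b ≠ center P) : localLog P b b = 0 := by
  rw [localLog, div_self (localParam_ne_zero hb), Complex.log_one]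

theorem tendsto_localLog (hb : b ≠ center P) : Tendsto (localLog P b) (𝓝 b) (𝓝 0) := by
  have hcont : ContinuousAt (localLog P b) b :=
    ((continuousAt_localParam hb).div_const _).clog
      (by simp [div_self (localParam_ne_zero hb)])
  simpa only [localLog_self hb] using hcont.tendsto

variable {n : ℕ} {a : Fin n → RatFunc ℂ}

theorem IsNear.ne_center (h : IsNear a b P) : b ≠ center P := by
  induction P using OnePoint.rec <;> exact h.1

theorem IsNear.norm_localParam_lt (h : IsNear a b P) {σ : ℂ} (hσ : σ ∈ singularSet a)
    (hc : σ ≠ center P) : ‖localParam P b‖ < ‖localParam P σ‖ := by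
  induction P using OnePoint.rec with
  | infty =>
    simpa only [localParam, norm_inv] using
      inv_strictAnti₀ (norm_pos_iff.2 hc) (h.2 σ hσ)
  | coe p => exact h.2 σ hσ hc

theorem IsNear.exists_pos (h : IsNear a b P) :
    ∃ δ : ℝ, 0 < δ ∧ ∀ s : ℂ, s.re < δ → localExp P b s ∉ singularSet a := by
  have hall : ∀ᶠ δ : ℝ in 𝓝[>] 0, ∀ σ ∈ singularSet a, σ ≠ center P →
      ‖localParam P b‖ * Real.exp δ < ‖localParam P σ‖ := by
    refine (finite_singularSet a).eventually_all.2 fun σ hσ => eventually_imp_distrib_left.2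
      fun hc => mem_nhdsWithin_of_mem_nhds ?_
    have hcont : ContinuousAt (fun δ : ℝ => ‖localParam P b‖ * Real.exp δ) 0 := by fun_prop
    exact hcont.eventually (gt_mem_nhds (by simpa using h.norm_localParam_lt hσ hc))
  obtain ⟨δ, hδ, hpos⟩ := (hall.and self_mem_nhdsWithin).exists
  refine ⟨δ, hpos, fun s hs hmem => (hδ _ hmem (localExp_ne_center h.ne_center s)).not_ge ?_⟩
  rw [localParam_localExp, norm_mul, Complex.norm_exp]
  gcongr

/-- The logarithm of the ratio of the radii of a punctured disc at `P` without singular points and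
of the circle through `b`. -/
def IsNear.width (h : IsNear a b P) : ℝ := Classical.choose h.exists_pos

/-- A half-plane that covers a punctured disc at `P` containing `b` and no singular points. -/
def IsNear.halfPlane (h : IsNear a b P) : Set ℂ := {s | s.re < h.width}

theorem IsNear.localExp_notMem (h : IsNear a b P) {s : ℂ} (hs : s ∈ h.halfPlane) :
    localExp P b s ∉ singularSet a :=
  (Classical.choose_spec h.exists_pos).2 s hs

theorem IsNear.isOpen_halfPlane (h : IsNear a b P) : IsOpen h.halfPlane :=
  isOpen_lt Complex.continuous_re continuous_const

theorem IsNear.convex_halfPlane (h : IsNear a b P) : Convex ℝ h.halfPlane :=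
  convex_halfSpace_re_lt _

theorem IsNear.mem_halfPlane (h : IsNear a b P) {s : ℂ} (hs : s.re ≤ 0) : s ∈ h.halfPlane :=
  hs.trans_lt (Classical.choose_spec h.exists_pos).1

theorem IsNear.zero_mem (h : IsNear a b P) : (0 : ℂ) ∈ h.halfPlane :=
  h.mem_halfPlane le_rfl

theorem IsNear.eventually_mem_halfPlane (h : IsNear a b P) : ∀ᶠ s in farLeft, s ∈ h.halfPlane :=
  eventually_farLeft_re_lt _

theorem IsNear.add_two_pi_I_mem (h : IsNear a b P) {s : ℂ} (hs : s ∈ h.halfPlane) :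
    s + 2 * π * I ∈ h.halfPlane := by
  have hre : (s + 2 * π * I).re = s.re := by simp
  exact hre.trans_lt hs

theorem IsNear.notMem (h : IsNear a b P) : b ∉ singularSet a :=
  localExp_zero P b ▸ h.localExp_notMem h.zero_mem

end LocalParameter

section Lift

open Complex (I)
open scoped Real

variable {n : ℕ} [NeZero n] {a : Fin n → RatFunc ℂ} {b : ℂ} {P : OnePoint ℂ}

theorem IsNear.exists_branch (h : IsNear a b P) (φ : solutionSpace a b) :
    ∃ B : ℂ → ℂ → ℂ, B 0 =ᶠ[𝓝 b] rep φ ∧ ∀ s ∈ h.halfPlane,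
      IsSolutionAt a (localExp P b s) (B s) ∧ ∀ᶠ x in 𝓝 s, B x =ᶠ[𝓝 (localExp P b x)] B s := by
  obtain ⟨w, hw₀, hw⟩ := exists_horizontalOn_of_convex h.isOpen_halfPlane h.convex_halfPlane
    (fun s _ => hasDerivAt_localExp P b s)
    (((differentiable_localExp P b).sub_const _).const_mul _).differentiableOn
    (fun _ hs => h.localExp_notMem hs) h.zero_mem (jet n (rep φ) b)
  choose! B hB hwB using hw
  refine ⟨B, ?_, fun s hs => ⟨hB s hs, ?_⟩⟩
  · have hB₀ := hB 0 h.zero_mem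
    have hjet := (hwB 0 h.zero_mem).self_of_nhds
    rw [localExp_zero] at hB₀ hjet
    exact hB₀.eventuallyEq h.notMem (isSolutionAt_rep φ) (hjet.symm.trans hw₀)
  · filter_upwards [h.isOpen_halfPlane.mem_nhds hs, hwB s hs,
      (differentiable_localExp P b).continuous.continuousAt.eventually (hB s hs).eventually]
      with x hx hwx hBx
    exact (hB x hx).eventuallyEq (h.localExp_notMem hx) hBx
      ((hwB x hx).self_of_nhds.symm.trans hwx)

/-- The branch near `localExp P b s` of the continuation of a solution `φ` along the path covered
by the segment from `0` to `s`. -/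
def IsNear.branch (h : IsNear a b P) (φ : solutionSpace a b) : ℂ → ℂ → ℂ :=
  Classical.choose (h.exists_branch φ)

/-- The continuation of a solution to the universal covering of a punctured disc at `P`. -/
def IsNear.lift (h : IsNear a b P) (φ : solutionSpace a b) (s : ℂ) : ℂ :=
  h.branch φ s (localExp P b s)

variable (h : IsNear a b P) {φ : solutionSpace a b} {s : ℂ}

theorem IsNear.branch_zero (φ : solutionSpace a b) : h.branch φ 0 =ᶠ[𝓝 b] rep φ :=
  (Classical.choose_spec (h.exists_branch φ)).1

theorem IsNear.isSolutionAt_branch (φ : solutionSpace a b) (hs : s ∈ h.halfPlane) :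
    IsSolutionAt a (localExp P b s) (h.branch φ s) :=
  ((Classical.choose_spec (h.exists_branch φ)).2 s hs).1

theorem IsNear.eventually_branch_eventuallyEq (φ : solutionSpace a b) (hs : s ∈ h.halfPlane) :
    ∀ᶠ x in 𝓝 s, h.branch φ x =ᶠ[𝓝 (localExp P b x)] h.branch φ s :=
  ((Classical.choose_spec (h.exists_branch φ)).2 s hs).2

theorem IsNear.eventually_lift_eq_branch (φ : solutionSpace a b) (hs : s ∈ h.halfPlane) :
    ∀ᶠ x in 𝓝 s, h.lift φ x = h.branch φ s (localExp P b x) :=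
  (h.eventually_branch_eventuallyEq φ hs).mono fun _ => EventuallyEq.eq_of_nhds

theorem IsNear.eventually_lift_eq_rep (φ : solutionSpace a b) :
    ∀ᶠ s in 𝓝 0, h.lift φ s = rep φ (localExp P b s) := by
  filter_upwards [h.eventually_lift_eq_branch φ h.zero_mem,
    (tendsto_localExp_zero P b).eventually (h.branch_zero φ)] with s hs hrep
  rw [hs, hrep]

theorem IsNear.differentiableOn_lift (φ : solutionSpace a b) :
    DifferentiableOn ℂ (h.lift φ) h.halfPlane := fun s hs =>
  (((h.isSolutionAt_branch φ hs).1.differentiableAt.comp s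
    (differentiable_localExp P b s)).congr_of_eventuallyEq
      (h.eventually_lift_eq_branch φ hs)).differentiableWithinAt

theorem IsNear.analyticOnNhd_lift (φ : solutionSpace a b) :
    AnalyticOnNhd ℂ (h.lift φ) h.halfPlane :=
  (h.differentiableOn_lift φ).analyticOnNhd h.isOpen_halfPlane

theorem IsNear.eqOn_lift {u : ℂ → ℂ} {U : Set ℂ} (hu : AnalyticOnNhd ℂ u U)
    (hc : IsPreconnected U) (h₀ : 0 ∈ U) (hU : U ⊆ h.halfPlane)
    (hφ : ∀ᶠ s in 𝓝 0, u s = rep φ (localExp P b s)) : Set.EqOn u (h.lift φ) U := by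
  refine hu.eqOn_of_preconnected_of_eventuallyEq ((h.analyticOnNhd_lift φ).mono hU) hc h₀ ?_
  filter_upwards [hφ, h.eventually_lift_eq_rep φ] with s hs hs'
  rw [hs, hs']

theorem IsNear.lift_add (φ ψ : solutionSpace a b) :
    Set.EqOn (h.lift φ + h.lift ψ) (h.lift (φ + ψ)) h.halfPlane := by
  refine h.eqOn_lift ((h.analyticOnNhd_lift φ).add (h.analyticOnNhd_lift ψ))
    h.convex_halfPlane.isPreconnected h.zero_mem subset_rfl ?_
  filter_upwards [h.eventually_lift_eq_rep φ, h.eventually_lift_eq_rep ψ,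
    (tendsto_localExp_zero P b).eventually (rep_add φ ψ)] with s hφ hψ hadd
  rw [Pi.add_apply, hφ, hψ, hadd, Pi.add_apply]

theorem IsNear.lift_smul (c : ℂ) (φ : solutionSpace a b) :
    Set.EqOn (c • h.lift φ) (h.lift (c • φ)) h.halfPlane := by
  refine h.eqOn_lift (h.analyticOnNhd_lift φ).const_smul
    h.convex_halfPlane.isPreconnected h.zero_mem subset_rfl ?_
  filter_upwards [h.eventually_lift_eq_rep φ,
    (tendsto_localExp_zero P b).eventually (rep_smul c φ)] with s hφ hsmul
  rw [Pi.smul_apply, hφ, hsmul, Pi.smul_apply]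

theorem IsNear.rep_eventuallyEq_lift (φ : solutionSpace a b) :
    rep φ =ᶠ[𝓝 b] fun z => h.lift φ (localLog P b z) := by
  filter_upwards [isOpen_ne.mem_nhds h.ne_center,
    (tendsto_localLog h.ne_center).eventually (h.eventually_lift_eq_rep φ)] with z hz hlift
  rw [hlift, localExp_localLog h.ne_center hz]

theorem IsNear.eqOn_lift_of_coe_eq {u : ℂ → ℂ} (hu : AnalyticOnNhd ℂ u {s | s.re ≤ 0})
    (hφ : (φ : Germ (𝓝 b) ℂ) = ((fun z => u (localLog P b z) : ℂ → ℂ) : Germ (𝓝 b) ℂ)) :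
    Set.EqOn u (h.lift φ) {s | s.re ≤ 0} := by
  refine h.eqOn_lift hu (convex_halfSpace_re_le 0).isPreconnected
    (Set.mem_ofPred.2 le_rfl) (fun _ => h.mem_halfPlane) ?_
  filter_upwards [(tendsto_localExp_zero P b).eventually (rep_eventuallyEq hφ),
    eventually_localLog_localExp h.ne_center] with s hs hlog
  rw [hs, hlog]

theorem IsNear.horizontalOn_jet_branch {X : Type*} [TopologicalSpace X] {ℓ : X → ℂ}
    (hℓ : Continuous ℓ) (hmem : ∀ t, ℓ t ∈ h.halfPlane) (φ : solutionSpace a b) :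
    HorizontalOn a Set.univ (fun t => localExp P b (ℓ t))
      fun t => jet n (h.branch φ (ℓ t)) (localExp P b (ℓ t)) := fun t _ =>
  ⟨h.branch φ (ℓ t), h.isSolutionAt_branch φ (hmem t), hℓ.continuousAt.eventually
    ((h.eventually_branch_eventuallyEq φ (hmem t)).mono fun _ => jet_congr)⟩

theorem IsNear.exists_monodromy_eq_branch :
    ∃ M ∈ monodromyGroup a b, ∀ φ : solutionSpace a b,
      rep (M φ) =ᶠ[𝓝 b] h.branch φ (2 * π * I) := by
  let ℓ : unitInterval → ℂ := fun t => (t : ℝ) * (2 * π * I)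
  have hmem (t) : ℓ t ∈ h.halfPlane := h.mem_halfPlane (by simp [ℓ])
  have hend : localExp P b (2 * π * I) = b := by
    simpa [localExp_zero] using localExp_add_two_pi_I P b 0
  let γ : Path b b :=
    { toFun := fun t => localExp P b (ℓ t)
      continuous_toFun := (differentiable_localExp P b).continuous.comp (by fun_prop)
      source' := by simp [ℓ, localExp_zero]
      target' := by simpa [ℓ] using hend }
  have hγ (t) : γ t ∉ singularSet a := h.localExp_notMem (hmem t)
  obtain ⟨M, hMG, hM⟩ := exists_monodromy γ hγ
  refine ⟨M, hMG, fun φ => ?_⟩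
  have htransports : Transports a γ (jet n (rep φ) b) (jet n (h.branch φ (2 * π * I)) b) :=
    ⟨_, h.horizontalOn_jet_branch (by fun_prop) hmem φ,
      by simp [ℓ, localExp_zero, jet_congr (h.branch_zero φ)], by simp [ℓ, hend]⟩
  have hsol := h.isSolutionAt_branch φ (s := 2 * π * I) (h.mem_halfPlane (by simp))
  simp only [hend] at hsol
  exact (isSolutionAt_rep _).eventuallyEq h.notMem hsol ((hM φ).unique hγ htransports)

/-- The map `M` is the local monodromy at `P`: continuation once around `P`, which on the universal
cover is translation by `2πi`. -/
def IsNear.IsLocalMonodromy (M : solutionSpace a b → solutionSpace a b) : Prop :=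
  ∀ φ : solutionSpace a b, ∀ s ∈ h.halfPlane, h.lift (M φ) s = h.lift φ (s + 2 * π * I)

theorem IsNear.exists_isLocalMonodromy : ∃ M : monodromyGroup a b, h.IsLocalMonodromy M.1 := by
  obtain ⟨M, hMG, hM⟩ := h.exists_monodromy_eq_branch
  refine ⟨⟨M, hMG⟩, fun φ s hs => (h.eqOn_lift (u := fun s => h.lift φ (s + 2 * π * I))
    ((h.analyticOnNhd_lift φ).comp (analyticOnNhd_id.add analyticOnNhd_const) fun _ =>
      h.add_two_pi_I_mem) h.convex_halfPlane.isPreconnected h.zero_mem subset_rfl ?_ hs).symm⟩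
  have hshift : Tendsto (fun s : ℂ => s + 2 * π * I) (𝓝 0) (𝓝 (2 * π * I)) := by
    simpa using (continuous_add_const (2 * π * I : ℂ)).tendsto 0
  filter_upwards [hshift.eventually (h.eventually_lift_eq_branch φ (h.mem_halfPlane (by simp))),
    (tendsto_localExp_zero P b).eventually (hM φ)] with s hs hs'
  rw [hs, hs', localExp_add_two_pi_I]

end Lift

section Growth

variable {n : ℕ} {a : Fin n → RatFunc ℂ} {b : ℂ} {P : OnePoint ℂ}

theorem tendsto_ratVal_localExp (hb : b ≠ center P) {f : RatFunc ℂ} (hf : RegularAt f P) :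
    Tendsto (fun s => ratVal f (localExp P b s)) farLeft (𝓝 (valueAt f P)) := by
  induction P using OnePoint.rec with
  | infty =>
    refine (tendsto_ratVal_cobounded hf).comp (tendsto_norm_atTop_iff_cobounded.1 ?_)
    have hnorm (s : ℂ) : ‖localExp OnePoint.infty b s‖ = ‖b‖ * Real.exp (-s.re) := by
      simp [localExp, center, orient, Complex.norm_exp]
    simp only [hnorm]
    exact (Real.tendsto_exp_atTop.comp (tendsto_neg_atBot_atTop.comp tendsto_comap)).const_mul_atTop
      (norm_pos_iff.2 hb)
  | coe p =>
    refine (analyticAt_ratVal hf).continuousAt.tendsto.comp ?_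
    have hexp : Tendsto (fun s => p + (b - p) * Complex.exp s) farLeft (𝓝 p) := by
      simpa using (Complex.tendsto_exp_comap_re_atBot.const_mul (b - p)).const_add p
    exact hexp.congr fun s => by simp [localExp, center, orient]

theorem scale_eq (P : OnePoint ℂ) :
    scale P = algebraMap (Polynomial ℂ) (RatFunc ℂ) (Polynomial.X - Polynomial.C (center P)) := by
  induction P using OnePoint.rec <;> simp [scale, center]

theorem ratVal_scale_pow_mul {z : ℂ} (hz : z ∉ singularSet a) (P : OnePoint ℂ) (k : ℕ)
    (i : Fin n) : ratVal (scale P ^ k * a i) z = (z - center P) ^ k * ratVal (a i) z := by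
  rw [scale_eq, ← map_pow, ratVal_mul ?_ fun h => hz ⟨i, h⟩, ratVal_algebraMap]
  · simp
  · simp [RatFunc.denom_algebraMap, -map_pow]

/-- The coefficients of the equation in the form that expresses `(z - center P)ⁿ y⁽ⁿ⁾` through
the `(z - center P)ⁱ y⁽ⁱ⁾` with `i < n`, as functions of `s` where `z = localExp P b s`. -/
def eulerCoeff (a : Fin n → RatFunc ℂ) (P : OnePoint ℂ) (b : ℂ) (i : Fin n) (s : ℂ) : ℂ :=
  (localExp P b s - center P) ^ (n - (i : ℕ)) * ratVal (a i) (localExp P b s)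

theorem IsNear.tendsto_eulerCoeff (h : IsNear a b P) (hF : IsFuchsian a) (i : Fin n) :
    Tendsto (eulerCoeff a P b i) farLeft (𝓝 (valueAt (scale P ^ (n - (i : ℕ)) * a i) P)) :=
  (tendsto_ratVal_localExp h.ne_center (hF P i)).congr' <|
    h.eventually_mem_halfPlane.mono fun _ hs => ratVal_scale_pow_mul (h.localExp_notMem hs) P _ i

theorem eval_indicialPolynomial (a : Fin n → RatFunc ℂ) (P : OnePoint ℂ) (μ : ℂ) :
    (indicialPolynomial a P).eval μ = (descPochhammer ℂ n).eval (orient P * μ) +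
      ∑ i : Fin n, valueAt (scale P ^ (n - (i : ℕ)) * a i) P *
        (descPochhammer ℂ i).eval (orient P * μ) := by
  induction P using OnePoint.rec <;>
    simp [indicialPolynomial, orient, Polynomial.eval_comp, Polynomial.eval_finsetSum]

variable [NeZero n] (h : IsNear a b P) (φ : solutionSpace a b) {s : ℂ}

/-- The scaled derivative `(z - center P)ᵏ φ⁽ᵏ⁾(z)` of the continuation of `φ`, at
`z = localExp P b s`. -/
def IsNear.scaledDeriv (h : IsNear a b P) (φ : solutionSpace a b) (k : ℕ) (s : ℂ) : ℂ :=
  (localExp P b s - center P) ^ k * iteratedDeriv k (h.branch φ s) (localExp P b s)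

theorem IsNear.scaledDeriv_zero : h.scaledDeriv φ 0 = h.lift φ := by
  ext s
  rw [IsNear.scaledDeriv, pow_zero, one_mul, iteratedDeriv_zero, IsNear.lift]

theorem IsNear.scaledDeriv_self (hs : s ∈ h.halfPlane) :
    h.scaledDeriv φ n s = -∑ i : Fin n, eulerCoeff a P b i s * h.scaledDeriv φ i s := by
  rw [IsNear.scaledDeriv,
    eq_neg_of_add_eq_zero_left (h.isSolutionAt_branch φ hs).2.self_of_nhds, mul_neg, Finset.mul_sum]
  congr! 2 with i
  rw [eulerCoeff, IsNear.scaledDeriv, ← pow_sub_mul_pow _ i.2.le]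
  ring

theorem IsNear.hasDerivAt_scaledDeriv (k : ℕ) (hs : s ∈ h.halfPlane) :
    HasDerivAt (h.scaledDeriv φ k)
      (orient P * (k * h.scaledDeriv φ k s + h.scaledDeriv φ (k + 1) s)) s := by
  have hbranch : h.scaledDeriv φ k =ᶠ[𝓝 s] fun x =>
      (localExp P b x - center P) ^ k * iteratedDeriv k (h.branch φ s) (localExp P b x) := by
    filter_upwards [h.eventually_branch_eventuallyEq φ hs] with x hx
    rw [IsNear.scaledDeriv, hx.iteratedDeriv_eq]
  have hexp := hasDerivAt_localExp P b s
  have hmul := ((hexp.sub_const (center P)).pow k).mul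
    ((hasDerivAt_iteratedDeriv (h.isSolutionAt_branch φ hs).1 k).comp s hexp)
  refine (hmul.congr_of_eventuallyEq hbranch).congr_deriv ?_
  cases k <;> simp [IsNear.scaledDeriv] <;> ring

theorem IsNear.moderateGrowth_lift (hF : IsFuchsian a) : ModerateGrowth (h.lift φ) := by
  let W : ℂ → Fin n → ℂ := fun s k => h.scaledDeriv φ k s
  have hlt (k : Fin n) : h.scaledDeriv φ k =O[farLeft] W :=
    .of_bound' (.of_forall fun s => norm_le_pi_norm (W s) k)
  have hself : h.scaledDeriv φ n =O[farLeft] W := by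
    have hsum : (fun s => ∑ i : Fin n, eulerCoeff a P b i s * h.scaledDeriv φ i s) =O[farLeft] W :=
      .fun_sum fun i _ => by
        simpa only [one_mul] using
          (((h.tendsto_eulerCoeff hF i).isBigO_one ℂ).mul
            (Asymptotics.isBigO_refl _ _)).trans ((hlt i).const_mul_left 1)
    exact hsum.neg_left.congr'
      (h.eventually_mem_halfPlane.mono fun s hs => (h.scaledDeriv_self φ hs).symm) .rfl
  have hsucc (k : Fin n) : h.scaledDeriv φ (k + 1) =O[farLeft] W := by
    obtain hk | hk := Nat.lt_or_eq_of_le (Nat.succ_le_of_lt k.2)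
    · exact hlt ⟨k + 1, hk⟩
    · simpa only [← hk] using hself
  obtain ⟨N, hN⟩ := moderateGrowth_of_deriv_isBigO
    (h.eventually_mem_halfPlane.mono fun s hs =>
      hasDerivAt_pi.2 fun k : Fin n => h.hasDerivAt_scaledDeriv φ k hs)
    (Asymptotics.isBigO_pi.2 fun k =>
      (((hlt k).const_mul_left _).add (hsucc k)).const_mul_left _)
  exact ⟨N, h.scaledDeriv_zero φ ▸ ((hlt 0).mono inf_le_left).trans hN⟩

end Growth

section Exponents

open Complex (I)
open scoped Real

variable {n : ℕ} [NeZero n] {a : Fin n → RatFunc ℂ} {b : ℂ} {P : OnePoint ℂ}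
  {h : IsNear a b P} {φ : solutionSpace a b} {μ : ℂ}

/-- The continuation of `φ` to the universal covering of a punctured disc at `P` is
`e^{μ s} H(e^s)` with `H` holomorphic at `0` and `H 0 ≠ 0`. -/
def IsNear.HasExponent (h : IsNear a b P) (φ : solutionSpace a b) (μ : ℂ) : Prop :=
  ∃ c ≠ 0, HasExpExpansion (h.lift φ) μ c

theorem IsNear.eq_zero_of_eventually_lift_eq_zero (h₀ : ∀ᶠ s in farLeft, h.lift φ s = 0) :
    φ = 0 := by
  obtain ⟨s, hs, hmem⟩ :=
    ((eventually_eventually_farLeft h₀).and h.eventually_mem_halfPlane).exists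
  have hlift : Set.EqOn (h.lift φ) 0 h.halfPlane :=
    (h.analyticOnNhd_lift φ).eqOn_of_preconnected_of_eventuallyEq analyticOnNhd_const
      h.convex_halfPlane.isPreconnected hmem hs
  refine ext_of_rep ((h.rep_eventuallyEq_lift φ).trans (.trans ?_ (rep_eventuallyEq rfl).symm))
  exact ((tendsto_localLog h.ne_center).eventually (h.isOpen_halfPlane.mem_nhds h.zero_mem)).mono
    fun _ hz => hlift hz

theorem IsNear.HasExponent.hasVanishingOrder (hφ : h.HasExponent φ μ) :
    HasVanishingOrder P (φ : Germ (𝓝 b) ℂ) μ := by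
  obtain ⟨c, hc, hexp⟩ := hφ
  refine ⟨h.lift φ, (h.analyticOnNhd_lift φ).mono fun s => h.mem_halfPlane, ?_, c, hc,
    hexp.tendsto.comp tendsto_ofReal_farLeft⟩
  rw [coe_rep]
  exact Germ.coe_eq.2 (h.rep_eventuallyEq_lift φ)

theorem IsNear.HasExponent.eq_of_hasVanishingOrder {ν : ℂ} (hφ : h.HasExponent φ μ)
    (hν : HasVanishingOrder P (φ : Germ (𝓝 b) ℂ) ν) : μ = ν := by
  obtain ⟨c, hc, hexp⟩ := hφ
  obtain ⟨u, hu, hφu, d, hd, hud⟩ := hν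
  refine eq_of_tendsto_exp_neg_mul hc hd (hexp.tendsto.comp tendsto_ofReal_farLeft)
    (hud.congr' ?_)
  filter_upwards [Iic_mem_atBot (0 : ℝ)] with x hx
  rw [h.eqOn_lift_of_coe_eq hu hφu (Set.mem_ofPred.2 (Complex.ofReal_re x ▸ Set.mem_Iic.1 hx))]

theorem IsNear.hasExpExpansion_scaledDeriv {c : ℂ} (hφ : HasExpExpansion (h.lift φ) μ c) (k : ℕ) :
    HasExpExpansion (h.scaledDeriv φ k) μ ((descPochhammer ℂ k).eval (orient P * μ) * c) := by
  induction k with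
  | zero => simpa [h.scaledDeriv_zero φ] using hφ
  | succ k ih =>
    have hderiv := ih.deriv (h.eventually_mem_halfPlane.mono fun s =>
      h.hasDerivAt_scaledDeriv φ k)
    convert! (hderiv.linearCombination ih (orient P) (-k)) using 1
    · ext s
      linear_combination -(k * h.scaledDeriv φ k s + h.scaledDeriv φ (k + 1) s) * orient_mul_self P
    · rw [descPochhammer_succ_right]
      simp only [Polynomial.eval_mul, Polynomial.eval_sub, Polynomial.eval_X,
        Polynomial.eval_natCast]
      ring

theorem IsNear.HasExponent.isRoot (hφ : h.HasExponent φ μ) (hF : IsFuchsian a) :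
    (indicialPolynomial a P).eval μ = 0 := by
  obtain ⟨c, hc, hexp⟩ := hφ
  have hlim (k : ℕ) := (h.hasExpExpansion_scaledDeriv hexp k).tendsto
  have hsum := tendsto_finsetSum Finset.univ fun (i : Fin n) _ =>
    (h.tendsto_eulerCoeff hF i).mul (hlim i)
  have hzero := tendsto_nhds_unique_of_eventuallyEq ((hlim n).add hsum) tendsto_const_nhds <| by
    filter_upwards [h.eventually_mem_halfPlane] with s hs
    rw [h.scaledDeriv_self φ hs, mul_neg, Finset.mul_sum, neg_add_eq_zero]
    exact Finset.sum_congr rfl fun i _ => mul_left_comm _ _ _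
  refine (mul_eq_zero.1 ?_).resolve_right hc
  rw [eval_indicialPolynomial, add_mul, Finset.sum_mul, ← hzero]
  simp only [mul_assoc]

theorem IsNear.HasExponent.eigenvalue {M : solutionSpace a b → solutionSpace a b} {χ : ℂ}
    (hφ : h.HasExponent φ μ) (hχ : M φ = χ • φ)
    (hM : ∀ s ∈ h.halfPlane, h.lift (M φ) s = h.lift φ (s + 2 * π * I)) :
    χ = Complex.exp (2 * π * I * μ) := by
  obtain ⟨c, hc, hexp⟩ := hφ
  obtain ⟨s, hs, hmem, hne⟩ := (hexp.eventually_add_two_pi_I.and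
    (h.eventually_mem_halfPlane.and (hexp.tendsto.eventually_ne hc))).exists
  refine mul_right_cancel₀ (right_ne_zero_of_mul hne) ?_
  rw [← hs, ← hM s hmem, hχ, ← h.lift_smul χ φ hmem, Pi.smul_apply, smul_eq_mul]

theorem IsNear.exists_hasExponent (h : IsNear a b P) (hF : IsFuchsian a)
    {M : solutionSpace a b → solutionSpace a b} {χ : ℂ} (hφ : φ ≠ 0) (hχ₀ : χ ≠ 0)
    (hχ : M φ = χ • φ)
    (hM : ∀ s ∈ h.halfPlane, h.lift (M φ) s = h.lift φ (s + 2 * π * I)) :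
    ∃ μ, h.HasExponent φ μ :=
  exists_hasExpExpansion (h.differentiableOn_lift φ) hχ₀
    (fun s hs => by rw [← hM s hs, hχ, ← h.lift_smul χ φ hs, Pi.smul_apply, smul_eq_mul])
    (h.moderateGrowth_lift φ hF) (hφ ∘ h.eq_zero_of_eventually_lift_eq_zero)

end Exponents

section Rationality

open Bornology (cobounded)

theorem differentiableAt_of_isBigO_sub_sq {f : ℂ → ℂ} {p : ℂ}
    (hf : f =O[𝓝 p] fun z => (z - p) ^ 2) : DifferentiableAt ℂ f p := by
  have hnorm : f =O[𝓝 p] fun z => ‖z - p‖ ^ 2 := by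
    simpa only [norm_pow] using hf.norm_right
  exact (hnorm.hasFDerivAt one_lt_two).differentiableAt

theorem isBigO_sub_pow_mul {f : ℂ → ℂ} {p : ℂ} {N : ℕ}
    (hf : f =O[𝓝[≠] p] fun z => ((z - p) ^ N)⁻¹) :
    (fun z => (z - p) ^ (N + 2) * f z) =O[𝓝 p] fun z => (z - p) ^ 2 := by
  rw [← nhdsNE_sup_pure, Asymptotics.isBigO_sup]
  refine ⟨((Asymptotics.isBigO_refl _ _).mul hf).congr' .rfl ?_,
    Asymptotics.isBigO_pure.2 (by simp)⟩
  filter_upwards [self_mem_nhdsWithin] with z hz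
  have hzp : z - p ≠ 0 := sub_ne_zero.2 hz
  field_simp
  ring

theorem isBigO_sub_pow_mul_cobounded {f : ℂ → ℂ} {p : ℂ} {M N : ℕ}
    (hf : f =O[cobounded ℂ] fun z => z ^ M) :
    (fun z => (z - p) ^ N * f z) =O[cobounded ℂ] fun z => z ^ (N + M) := by
  have hsub : (fun z => z - p) =O[cobounded ℂ] fun z => z :=
    (Asymptotics.isBigO_refl _ _).sub (by simpa using isBigO_const_pow_cobounded p 1)
  simpa only [pow_add] using (hsub.pow N).mul hf

theorem exists_eq_polynomial_div_of_isBigO {S : Set ℂ} (hS : S.Finite) {Φ : ℂ → ℂ}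
    (hd : DifferentiableOn ℂ Φ Sᶜ)
    (hpole : ∀ p ∈ S, ∃ N : ℕ, Φ =O[𝓝[≠] p] fun z => ((z - p) ^ N)⁻¹)
    (hinfty : ∃ N : ℕ, Φ =O[cobounded ℂ] fun z => z ^ N) :
    ∃ p q : Polynomial ℂ, ∀ z ∉ S, q.eval z ≠ 0 ∧ Φ z = p.eval z / q.eval z := by
  induction S, hS using Set.Finite.induction_on generalizing Φ with
  | empty =>
    obtain ⟨N, hN⟩ := hinfty
    obtain ⟨p, hp⟩ := exists_polynomial_of_isBigO_pow
      (differentiableOn_univ.1 (by simpa using hd)) hN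
    exact ⟨p, 1, fun z _ => ⟨by simp, by simp [hp]⟩⟩
  | @insert s S hsS hS ih =>
    obtain ⟨N, hN⟩ := hpole s (Set.mem_insert s S)
    have hfactor : Continuous fun z : ℂ => (z - s) ^ (N + 2) := by fun_prop
    have hdiff : DifferentiableOn ℂ (fun z => (z - s) ^ (N + 2) * Φ z) Sᶜ := by
      refine fun z hz => DifferentiableAt.differentiableWithinAt ?_
      obtain rfl | hzs := eq_or_ne z s
      · exact differentiableAt_of_isBigO_sub_sq (isBigO_sub_pow_mul hN)
      · refine .mul (by fun_prop) (hd.differentiableAt ?_)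
        exact (hS.insert s).isClosed.isOpen_compl.mem_nhds fun h => h.elim hzs hz
    have hpole' (w) (hw : w ∈ S) :
        ∃ M : ℕ, (fun z => (z - s) ^ (N + 2) * Φ z) =O[𝓝[≠] w] fun z => ((z - w) ^ M)⁻¹ := by
      obtain ⟨M, hM⟩ := hpole w (Set.mem_insert_of_mem s hw)
      exact ⟨M, by simpa only [one_mul] using
        ((hfactor.tendsto w).mono_left nhdsWithin_le_nhds).isBigO_one ℂ |>.mul hM⟩
    have hinfty' :
        ∃ M : ℕ, (fun z => (z - s) ^ (N + 2) * Φ z) =O[cobounded ℂ] fun z => z ^ M := by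
      obtain ⟨M, hM⟩ := hinfty
      exact ⟨N + 2 + M, isBigO_sub_pow_mul_cobounded hM⟩
    obtain ⟨p, q, hpq⟩ := ih hdiff hpole' hinfty'
    refine ⟨p, q * (Polynomial.X - Polynomial.C s) ^ (N + 2), fun z hz => ?_⟩
    rw [Set.mem_insert_iff, not_or] at hz
    obtain ⟨hq, hΦ⟩ := hpq z hz.2
    have hzs : z - s ≠ 0 := sub_ne_zero.2 hz.1
    refine ⟨by simp [hq, hzs], ?_⟩
    simp only [Polynomial.eval_mul, Polynomial.eval_pow, Polynomial.eval_sub, Polynomial.eval_X,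
      Polynomial.eval_C]
    rw [← div_div, ← hΦ, mul_div_cancel_left₀ _ (pow_ne_zero _ hzs)]

/-- The filter of punctured neighbourhoods of a point of the sphere. -/
def puncturedNhds (P : OnePoint ℂ) : Filter ℂ := comap (localParam P) (𝓝[≠] 0)

theorem puncturedNhds_infty : puncturedNhds OnePoint.infty = cobounded ℂ := by
  rw [puncturedNhds, ← inv_cobounded₀, ← Filter.comap_inv, comap_comap]
  exact (congrArg (comap · _) (funext inv_inv)).trans comap_id

theorem puncturedNhds_coe (p : ℂ) : puncturedNhds (p : OnePoint ℂ) = 𝓝[≠] p := by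
  have hparam : localParam p = Homeomorph.subRight p := rfl
  rw [puncturedNhds, hparam, nhdsWithin, comap_inf, (Homeomorph.subRight p).comap_nhds_eq,
    comap_principal, nhdsWithin]
  congr 2
  · simp
  · ext z
    simp [sub_eq_zero]

section PuncturedNhds

variable {P : OnePoint ℂ} {b : ℂ}

theorem tendsto_localParam_puncturedNhds : Tendsto (localParam P) (puncturedNhds P) (𝓝[≠] 0) :=
  tendsto_comap

theorem eventually_puncturedNhds_ne_center : ∀ᶠ z in puncturedNhds P, z ≠ center P := by
  filter_upwards [tendsto_localParam_puncturedNhds.eventually self_mem_nhdsWithin] with z hz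
  rintro rfl
  exact hz (localParam_center P)

theorem exp_re_localLog (hb : b ≠ center P) {z : ℂ} (hz : z ≠ center P) :
    Real.exp (localLog P b z).re = ‖localParam P z‖ / ‖localParam P b‖ := by
  rw [localLog, Complex.log_re, norm_div, Real.exp_log
    (div_pos (norm_pos_iff.2 (localParam_ne_zero hz)) (norm_pos_iff.2 (localParam_ne_zero hb)))]

theorem tendsto_localLog_puncturedNhds (hb : b ≠ center P) :
    Tendsto (localLog P b) (puncturedNhds P) farLeftStrip := by
  refine tendsto_inf.2 ⟨tendsto_comap_iff.2 (Real.tendsto_exp_comp_nhds_zero.1 ?_),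
    tendsto_principal.2 <| .of_forall fun z => ?_⟩
  · have hnorm :
        Tendsto (fun z => ‖localParam P z‖ / ‖localParam P b‖) (puncturedNhds P) (𝓝 0) := by
      simpa using ((tendsto_localParam_puncturedNhds (P := P)).mono_right
        nhdsWithin_le_nhds).norm.div_const ‖localParam P b‖
    refine hnorm.congr' ?_
    filter_upwards [eventually_puncturedNhds_ne_center] with z hz
    exact (exp_re_localLog hb hz).symm
  · exact Set.mem_ofPred.2 (by simpa only [localLog, Complex.log_im] using Complex.abs_arg_le_pi _)

theorem exists_isBigO_puncturedNhds (hb : b ≠ center P) {Φ : ℂ → ℂ}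
    (hΦ : ModerateGrowth fun s => Φ (localExp P b s)) :
    ∃ N : ℕ, Φ =O[puncturedNhds P] fun z => (localParam P z ^ N)⁻¹ := by
  obtain ⟨N, hN⟩ := hΦ
  have hlog := hN.comp_tendsto (tendsto_localLog_puncturedNhds hb)
  refine ⟨N, (hlog.congr' ?_ .rfl).trans (.of_bound (‖localParam P b‖ ^ N) ?_)⟩
  all_goals filter_upwards [eventually_puncturedNhds_ne_center] with z hz
  · simp only [Function.comp_apply, localExp_localLog hb hz]
  · simp only [Function.comp_apply, Real.exp_neg, Real.exp_nat_mul, exp_re_localLog hb hz, div_pow,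
      inv_div, norm_div, norm_inv, norm_pow, norm_norm]
    rfl

end PuncturedNhds

variable {n : ℕ} {a : Fin n → RatFunc ℂ}

theorem exists_isNear (a : Fin n → RatFunc ℂ) (P : OnePoint ℂ) : ∃ b, IsNear a b P := by
  induction P using OnePoint.rec with
  | infty =>
    have hfar : ∀ᶠ z in cobounded ℂ, ∀ σ ∈ singularSet a, ‖σ‖ < ‖z‖ :=
      (finite_singularSet a).eventually_all.2 fun σ _ =>
        tendsto_norm_cobounded_atTop.eventually_gt_atTop ‖σ‖
    exact ((Bornology.eventually_ne_cobounded 0).and hfar).exists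
  | coe p =>
    have hclose : ∀ᶠ z in 𝓝[≠] p, ∀ σ ∈ singularSet a, σ ≠ p → ‖z - p‖ < ‖σ - p‖ := by
      refine (finite_singularSet a).eventually_all.2 fun σ _ => eventually_imp_distrib_left.2
        fun hσ => mem_nhdsWithin_of_mem_nhds ?_
      have hcont : ContinuousAt (fun z : ℂ => ‖z - p‖) p := by fun_prop
      exact hcont.eventually (gt_mem_nhds (by simpa [sub_eq_zero] using hσ))
    exact (eventually_mem_nhdsWithin.and hclose).exists

variable {ι : Type*} [Finite ι] {b : ℂ}

theorem differentiable_mvPolynomial_eval (Q : MvPolynomial ι ℂ) :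
    Differentiable ℂ fun x : ι → ℂ => Q.eval x := by
  have := Fintype.ofFinite ι
  exact fun x => (AnalyticOnNhd.eval_mvPolynomial Q x trivial).differentiableAt

theorem IsLocallyComp.differentiableOn {Q : (ι → ℂ) → ℂ} {Φ : ℂ → ℂ} (hQ : Differentiable ℂ Q)
    (hΦ : IsLocallyComp a Q Φ) : DifferentiableOn ℂ Φ (singularSet a)ᶜ := fun z hz => by
  obtain ⟨F, hF, hΦF⟩ := hΦ z hz
  exact ((analyticAt_comp_tuple hQ fun i => (hF i).1).congr
    hΦF.symm).differentiableAt.differentiableWithinAt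

variable [NeZero n]

theorem IsLocallyComp.moderateGrowth (hF : IsFuchsian a) {P : OnePoint ℂ} (h : IsNear a b P)
    {Q : MvPolynomial ι ℂ} {Φ : ℂ → ℂ} (hΦ : IsLocallyComp a (fun x => Q.eval x) Φ) :
    ModerateGrowth fun s => Φ (localExp P b s) := by
  obtain ⟨F, hsol, hΦF⟩ := hΦ b h.notMem
  let φ (i : ι) : solutionSpace a b := ⟨(F i : Germ (𝓝 b) ℂ), F i, hsol i, rfl⟩
  have hQ := differentiable_mvPolynomial_eval Q
  have heq : Set.EqOn (fun s => Φ (localExp P b s)) (fun s => Q.eval fun i => h.lift (φ i) s)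
      h.halfPlane := by
    refine AnalyticOnNhd.eqOn_of_preconnected_of_eventuallyEq
      (((hΦ.differentiableOn hQ).comp (differentiable_localExp P b).differentiableOn
        fun s => h.localExp_notMem).analyticOnNhd h.isOpen_halfPlane)
      (fun s hs => analyticAt_comp_tuple hQ fun i => h.analyticOnNhd_lift (φ i) s hs)
      h.convex_halfPlane.isPreconnected h.zero_mem ?_
    filter_upwards [(tendsto_localExp_zero P b).eventually hΦF,
      eventually_all.2 fun i => h.eventually_lift_eq_rep (φ i),
      (tendsto_localExp_zero P b).eventually (eventually_all.2 fun i => rep_eventuallyEq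
        (φ := φ i) rfl)] with s hs hlift hrep
    simp only [hs, hlift, hrep]
  obtain ⟨N, hN⟩ := ModerateGrowth.mvPolynomial_eval
    (fun i => h.moderateGrowth_lift (φ i) hF) Q
  refine ⟨N, hN.congr' ?_ .rfl⟩
  filter_upwards [h.eventually_mem_halfPlane.filter_mono inf_le_left] with s hs
  exact (heq hs).symm

theorem IsLocallyComp.exists_isBigO_puncturedNhds (hF : IsFuchsian a) {Q : MvPolynomial ι ℂ}
    {Φ : ℂ → ℂ} (hΦ : IsLocallyComp a (fun x => Q.eval x) Φ) (P : OnePoint ℂ) :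
    ∃ N : ℕ, Φ =O[puncturedNhds P] fun z => (localParam P z ^ N)⁻¹ :=
  let ⟨_, h⟩ := exists_isNear a P
  LinODE.exists_isBigO_puncturedNhds h.ne_center (hΦ.moderateGrowth hF h)

theorem exists_ratFunc_of_invariant (hF : IsFuchsian a) (hb : b ∉ singularSet a)
    {f : ι → solutionSpace a b} {Q : MvPolynomial ι ℂ}
    (hinv : ∀ T ∈ monodromyGroup a b, (fun z => Q.eval fun i => rep (T (f i)) z) =ᶠ[𝓝 b]
      fun z => Q.eval fun i => rep (f i) z) :
    ∃ R : RatFunc ℂ, ∀ᶠ z in 𝓝 b, Q.eval (fun i => rep (f i) z) = ratVal R z := by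
  have hQ := differentiable_mvPolynomial_eval Q
  obtain ⟨Φ, hΦb, hΦ⟩ := exists_singleValued hb hQ hinv
  have hgrowth := hΦ.exists_isBigO_puncturedNhds hF
  obtain ⟨p, q, hpq⟩ := exists_eq_polynomial_div_of_isBigO (finite_singularSet a)
    (hΦ.differentiableOn hQ) (fun σ _ => puncturedNhds_coe σ ▸ hgrowth σ)
    (by simpa [puncturedNhds_infty, localParam] using hgrowth OnePoint.infty)
  refine ⟨algebraMap (Polynomial ℂ) (RatFunc ℂ) p / algebraMap (Polynomial ℂ) (RatFunc ℂ) q, ?_⟩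
  filter_upwards [hΦb, (isOpen_compl_singularSet a).mem_nhds hb] with z hz hzS
  rw [← hz, ratVal_div (hpq z hzS).1, (hpq z hzS).2]

end Rationality

section HalfCentral

variable {G H : Type*} [Group G] [Group H]

/-- The centralizer of `x` has index at most two, expressed without quotients: the product of two
elements outside it lies inside. -/
def IsHalfCentral (x : G) : Prop :=
  ∀ y z : G, ¬Commute y x → ¬Commute z x → Commute (y * z) x

theorem IsHalfCentral.commute_conj {x : G} (hx : IsHalfCentral x) (y : G) :
    Commute (y⁻¹ * x * y) x := by
  by_cases hy : Commute y x
  · rw [mul_assoc, ← hy.eq, inv_mul_cancel_left]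
  · rw [mul_assoc]
    refine hx _ _ (mt Commute.inv_left_iff.1 hy) fun h => hy ?_
    simpa using (Commute.refl x).inv_left.mul_left h

theorem IsHalfCentral.exists_coset_representative {x : G} (hx : IsHalfCentral x) :
    ∃ t : G, ∀ y : G, ¬Commute y x → Commute (y * t⁻¹) x ∧ Commute (y * t) x := by
  by_cases! h : ∃ t : G, ¬Commute t x
  · obtain ⟨t, ht⟩ := h
    exact ⟨t, fun y hy => ⟨hx y t⁻¹ hy (mt Commute.inv_left_iff.1 ht), hx y t hy ht⟩⟩
  · exact ⟨1, fun y hy => absurd (h y) hy⟩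

theorem isHalfCentral_of_map (e : G ≃* H) {x : G} (hx : IsHalfCentral (e x)) :
    IsHalfCentral x := by
  have hcomm (y : G) : Commute (e y) (e x) ↔ Commute y x := commute_map_iff e.injective
  intro y z hy hz
  rw [← hcomm, map_mul]
  exact hx _ _ (mt (hcomm y).1 hy) (mt (hcomm z).1 hz)

theorem isHalfCentral_r {m : ℕ} (k : ZMod m) : IsHalfCentral (DihedralGroup.r k) := by
  rintro (i | i) (j | j) hi hj <;> simp_all [commute_iff_eq, add_comm]

theorem isHalfCentral_of_dvd_four {m : ℕ} (hm : m ∣ 4) (x : DihedralGroup m) :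
    IsHalfCentral x := by
  have hm4 : m ∈ Nat.divisors 4 := Nat.mem_divisors.2 ⟨hm, by norm_num⟩
  rw [show Nat.divisors 4 = {1, 2, 4} by decide] at hm4
  simp only [Finset.mem_insert, Finset.mem_singleton] at hm4
  unfold IsHalfCentral Commute SemiconjBy
  obtain rfl | rfl | rfl := hm4 <;> revert x <;> decide

end HalfCentral

section SimpleSpectrum

variable {K V ι : Type*} [Field K] [AddCommGroup V] [Module K V]

theorem exists_eigenbasis [IsAlgClosed K] [FiniteDimensional K V] [Fintype ι]
    (hV : Module.finrank K V = Fintype.card ι) {M : Module.End K V} {k : ℕ} (hk : (k : K) ≠ 0)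
    (hM : M ^ k = 1) {χ : ι → K} (hχ : ∀ (κ : K) (v : V), v ≠ 0 → M v = κ • v → ∃ j, κ = χ j)
    (hone : ∀ (κ : K) (v w : V), v ≠ 0 → M v = κ • v → M w = κ • w → ∃ c : K, w = c • v) :
    ∃ f : Module.Basis ι K V, ∀ j, M (f j) = χ j • f j := by
  have hss : M.IsSemisimple := Module.End.isSemisimple_of_squarefree_aeval_eq_zero
    (Polynomial.separable_X_pow_sub_C (1 : K) hk one_ne_zero).squarefree (by simp [hM])
  have hgen (j : ι) : ∃ v : V, M v = χ j • v ∧ ∀ w, M w = χ j • w → ∃ c : K, w = c • v := by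
    by_cases! h : ∃ v : V, v ≠ 0 ∧ M v = χ j • v
    · obtain ⟨v, hv₀, hv⟩ := h
      exact ⟨v, hv, fun w => hone (χ j) v w hv₀ hv⟩
    · refine ⟨0, by simp, fun w hw => ⟨0, ?_⟩⟩
      by_contra hw₀
      exact h w (by simpa using hw₀) hw
  choose f hf hfgen using hgen
  have hspan : ⊤ ≤ Submodule.span K (Set.range f) := by
    rw [← hss.iSup_eigenspace_eq_top]
    refine iSup_le fun κ v hv => ?_
    rw [Module.End.mem_eigenspace_iff] at hv
    obtain rfl | hv₀ := eq_or_ne v 0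
    · exact zero_mem _
    · obtain ⟨j, rfl⟩ := hχ κ v hv₀ hv
      obtain ⟨c, rfl⟩ := hfgen j v hv
      exact Submodule.smul_mem _ _ (Submodule.subset_span ⟨j, rfl⟩)
  refine ⟨basisOfTopLeSpanOfCardEqFinrank f hspan hV.symm, fun j => ?_⟩
  rw [coe_basisOfTopLeSpanOfCardEqFinrank, hf]

theorem toLinearMap_pow_eq_one {M : V ≃ₗ[K] V} {N : ℕ} (hM : M ^ N = 1) :
    ((M : V →ₗ[K] V) : Module.End K V) ^ N = 1 := by
  have hpow := congrArg LinearEquiv.automorphismGroup.toLinearMapMonoidHom hM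
  rwa [map_pow, map_one] at hpow

theorem pow_eq_one_of_smul {M : V ≃ₗ[K] V} {N : ℕ} (hM : M ^ N = 1) {v : V} (hv : v ≠ 0) {c : K}
    (hc : M v = c • v) : c ^ N = 1 := by
  have heig : Module.End.HasEigenvector (M : V →ₗ[K] V) c v :=
    ⟨Module.End.mem_eigenspace_iff.2 hc, hv⟩
  have hpow := heig.pow_apply N
  rw [toLinearMap_pow_eq_one hM] at hpow
  exact smul_left_injective K hv (hpow.symm.trans (one_smul K v).symm)

variable {f : Module.Basis ι K V} {χ : ι → K} {M : Module.End K V}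

theorem repr_apply_of_eigenbasis (hM : ∀ j, M (f j) = χ j • f j) (v : V) (i : ι) :
    f.repr (M v) i = χ i * f.repr v i := by
  have hcoord : f.coord i ∘ₗ M = χ i • f.coord i := f.ext fun j => by
    obtain rfl | hij := eq_or_ne j i <;> simp [*]
  exact LinearMap.congr_fun hcoord v

theorem eq_smul_of_eigenvector (hχ : Function.Injective χ) (hM : ∀ j, M (f j) = χ j • f j)
    {κ : K} {v : V} (hv₀ : v ≠ 0) (hv : M v = κ • v) : ∃ j, κ = χ j ∧ ∃ c : K, v = c • f j := by
  have hrepr (i : ι) : χ i * f.repr v i = κ * f.repr v i := by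
    rw [← repr_apply_of_eigenbasis hM, hv, map_smul, Finsupp.smul_apply, smul_eq_mul]
  obtain ⟨j, hj⟩ : ∃ j, f.repr v j ≠ 0 := by
    simpa using DFunLike.ne_iff.1 (f.repr.map_ne_zero_iff.2 hv₀)
  have hκ : κ = χ j := (mul_right_cancel₀ hj (hrepr j)).symm
  refine ⟨j, hκ, f.repr v j, f.ext_elem fun i => ?_⟩
  obtain rfl | hij := eq_or_ne i j
  · simp
  · have hi : f.repr v i = 0 := by
      by_contra h₀
      exact hij (hχ ((mul_right_cancel₀ h₀ (hrepr i)).trans hκ))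
    simp [hi, hij]

theorem linearIndependent_pair_smul (f : Module.Basis ι K V) {i j : ι} (hij : i ≠ j) {c : K}
    (hc : c ≠ 0) : LinearIndependent K ![f i, c • f j] := by
  have hpair : LinearIndependent K ![f i, f j] := by
    convert! f.linearIndependent.comp ![i, j] (by simpa using hij) using 1
    ext k
    fin_cases k <;> rfl
  simpa using (LinearIndependent.pair_smul_smul_iff isUnit_one hc.isUnit).2 hpair

end SimpleSpectrum

section EigenlinePermutation

variable {K V ι : Type*} [Field K] [AddCommGroup V] [Module K V]

/-- The vectors `v` and `w` differ by an `N`-th root of unity: solutions so related have the same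
`N`-th power. -/
def EqUpToRoot (K : Type*) {V : Type*} [Field K] [AddCommGroup V] [Module K V] (N : ℕ)
    (v w : V) : Prop :=
  ∃ c : K, c ^ N = 1 ∧ v = c • w

theorem EqUpToRoot.trans {N : ℕ} {u v w : V} (huv : EqUpToRoot K N u v)
    (hvw : EqUpToRoot K N v w) : EqUpToRoot K N u w := by
  obtain ⟨c, hc, rfl⟩ := huv
  obtain ⟨d, hd, rfl⟩ := hvw
  exact ⟨c * d, by rw [mul_pow, hc, hd, one_mul], smul_smul c d w⟩

/-- The map `T` fixes `v` and `w` up to `N`-th roots of unity. -/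
def FixesUpToRoot (K : Type*) {V : Type*} [Field K] [AddCommGroup V] [Module K V] (N : ℕ)
    (T : V → V) (v w : V) : Prop :=
  EqUpToRoot K N (T v) v ∧ EqUpToRoot K N (T w) w

/-- The map `T` exchanges `v` and `w` up to `N`-th roots of unity. -/
def SwapsUpToRoot (K : Type*) {V : Type*} [Field K] [AddCommGroup V] [Module K V] (N : ℕ)
    (T : V → V) (v w : V) : Prop :=
  EqUpToRoot K N (T v) w ∧ EqUpToRoot K N (T w) v

variable {f : Module.Basis ι K V} {χ : ι → K} {G : Subgroup (V ≃ₗ[K] V)} {M : G}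

theorem eqUpToRoot_of_smul {T : G} {v : V} (hv : v ≠ 0) {c : K} (h : T.1 v = c • v) :
    EqUpToRoot K (Nat.card G) (T.1 v) v :=
  ⟨c, pow_eq_one_of_smul (congrArg Subtype.val (pow_card_eq_one' (x := T))) hv h, h⟩

theorem eqUpToRoot_of_commute (hχ : Function.Injective χ) (hM : ∀ j, M.1 (f j) = χ j • f j)
    {T : G} (hT : Commute T M) (i : ι) : EqUpToRoot K (Nat.card G) (T.1 (f i)) (f i) := by
  have hTM : M.1 * T.1 = T.1 * M.1 := congrArg Subtype.val hT.eq.symm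
  have heig : M.1 (T.1 (f i)) = χ i • T.1 (f i) := by
    rw [← LinearEquiv.mul_apply, hTM, LinearEquiv.mul_apply, hM, map_smul]
  obtain ⟨j, hij, c, hc⟩ := eq_smul_of_eigenvector (M := (M.1 : V →ₗ[K] V)) hχ hM
    (T.1.map_ne_zero_iff.2 (f.ne_zero i)) heig
  rw [← hχ hij] at hc
  exact eqUpToRoot_of_smul (f.ne_zero i) hc

theorem IsHalfCentral.exists_smul (h : IsHalfCentral M) (hχ : Function.Injective χ)
    (hM : ∀ j, M.1 (f j) = χ j • f j) (T : G) (i : ι) :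
    ∃ j, ∃ c : K, T.1 (f i) = c • f j := by
  obtain ⟨c, -, hc⟩ := eqUpToRoot_of_commute hχ hM (h.commute_conj T) i
  have heig : M.1 (T.1 (f i)) = c • T.1 (f i) := by
    rw [← map_smul, ← hc, ← LinearEquiv.mul_apply, ← LinearEquiv.mul_apply, ← Subgroup.coe_mul,
      ← Subgroup.coe_mul, mul_assoc, mul_inv_cancel_left]
  obtain ⟨j, -, d, hd⟩ := eq_smul_of_eigenvector (M := (M.1 : V →ₗ[K] V)) hχ hM
    (T.1.map_ne_zero_iff.2 (f.ne_zero i)) heig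
  exact ⟨j, d, hd⟩

theorem IsHalfCentral.exists_fixesUpToRoot_and_swapsUpToRoot (h : IsHalfCentral M)
    (hχ : Function.Injective χ) (hM : ∀ j, M.1 (f j) = χ j • f j) :
    ∃ T₀ : G, ∀ (T : G) (i : ι),
      (Commute T M → FixesUpToRoot K (Nat.card G) T.1 (f i) (T₀.1 (f i))) ∧
      (¬Commute T M → SwapsUpToRoot K (Nat.card G) T.1 (f i) (T₀.1 (f i))) := by
  have hfix {T : G} (hT : Commute T M) (i : ι) : EqUpToRoot K (Nat.card G) (T.1 (f i)) (f i) :=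
    eqUpToRoot_of_commute hχ hM hT i
  obtain ⟨T₀, hT₀⟩ := h.exists_coset_representative
  have hfix₀ {T : G} (hT : Commute T M) (i : ι) :
      EqUpToRoot K (Nat.card G) (T.1 (T₀.1 (f i))) (T₀.1 (f i)) := by
    obtain ⟨j, c, hc⟩ := h.exists_smul hχ hM T₀ i
    obtain ⟨d, hd, hTj⟩ := hfix hT j
    exact ⟨d, hd, by rw [hc, map_smul, hTj, smul_comm]⟩
  refine ⟨T₀, fun T i => ⟨fun hT => ⟨hfix hT i, hfix₀ hT i⟩,
    fun hT => ⟨?_, hfix (hT₀ T hT).2 i⟩⟩⟩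
  have hswap := hfix₀ (hT₀ T hT).1 i
  rwa [← LinearEquiv.mul_apply, ← Subgroup.coe_mul, inv_mul_cancel_right] at hswap

theorem commute_of_subsingleton [Subsingleton ι] (hM : ∀ j, M.1 (f j) = χ j • f j) (T : G) :
    Commute T M := by
  have hsmul (v : V) (i : ι) : M.1 v = χ i • v := f.ext_elem fun j =>
    (repr_apply_of_eigenbasis (M := (M.1 : V →ₗ[K] V)) hM v j).trans <| by
      rw [map_smul, Subsingleton.elim i j, Finsupp.smul_apply, smul_eq_mul]
  refine Subtype.ext (LinearEquiv.toLinearMap_injective (f.ext fun i => ?_))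
  exact ((hsmul (T.1 (f i)) i).trans (by simp [hM])).symm

theorem card_le_two_of_sq_eq_one [Fintype ι] (hχ : Function.Injective χ) (h : ∀ i, χ i ^ 2 = 1) :
    Fintype.card ι ≤ 2 := by
  classical
  calc Fintype.card ι = (Finset.univ.image χ).card := (Finset.card_image_of_injective _ hχ).symm
    _ ≤ ({1, -1} : Finset K).card := Finset.card_le_card fun x hx => by
        obtain ⟨i, -, rfl⟩ := Finset.mem_image.1 hx
        simpa using h i
    _ ≤ 2 := Finset.card_le_two

theorem isHalfCentral_of_eigenbasis [Fintype ι] {m : ℕ} (e : G ≃* DihedralGroup m)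
    (hχ : Function.Injective χ) (hM : ∀ j, M.1 (f j) = χ j • f j)
    (hexc : Fintype.card ι = 2 → (∀ i, χ i ^ 2 = 1) → m ∣ 4) : IsHalfCentral M := by
  rcases hx : e M with k | k
  · exact isHalfCentral_of_map e (hx ▸ isHalfCentral_r k)
  · have hM₂ : M ^ 2 = 1 := e.injective (by rw [map_pow, hx, pow_two]; simp)
    have hχ₂ (i : ι) : χ i ^ 2 = 1 :=
      pow_eq_one_of_smul (congrArg Subtype.val hM₂) (f.ne_zero i) (hM i)
    obtain hlt | heq := (card_le_two_of_sq_eq_one hχ hχ₂).lt_or_eq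
    · have : Subsingleton ι := Fintype.card_le_one_iff_subsingleton.1 (Nat.le_of_lt_succ hlt)
      exact fun y z hy => absurd (commute_of_subsingleton hM y) hy
    · exact isHalfCentral_of_map e (isHalfCentral_of_dvd_four (hexc heq hχ₂) _)

end EigenlinePermutation

section LocalMonodromy

open Complex (I)
open scoped Real

theorem injective_exp_two_pi_I_mul {ι : Type*} {lam : ι → ℂ}
    (hdist : ∀ i j, i ≠ j → ∀ k : ℤ, lam i - lam j ≠ k) :
    Function.Injective fun i => Complex.exp (2 * π * I * lam i) := by
  intro i j h
  by_contra hij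
  obtain ⟨k, hk⟩ := Complex.exp_eq_exp_iff_exists_int.1 h
  refine hdist i j hij k (mul_left_cancel₀ Complex.two_pi_I_ne_zero ?_)
  linear_combination hk

theorem exists_intCast_eq_two_mul_of_exp_sq_eq_one {μ : ℂ}
    (h : Complex.exp (2 * π * I * μ) ^ 2 = 1) : ∃ k : ℤ, 2 * μ = k := by
  rw [← Complex.exp_nat_mul] at h
  obtain ⟨k, hk⟩ := Complex.exp_eq_one_iff.1 h
  refine ⟨k, mul_left_cancel₀ Complex.two_pi_I_ne_zero ?_⟩
  push_cast at hk
  linear_combination hk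

theorem IsLocalExponents.exists_eq {n : ℕ} [NeZero n] {a : Fin n → RatFunc ℂ} {P : OnePoint ℂ}
    {lam : Fin n → ℂ} (hlam : IsLocalExponents a P lam) {μ : ℂ}
    (hμ : (indicialPolynomial a P).eval μ = 0) : ∃ j, lam j = μ := by
  have hne : indicialPolynomial a P ≠ 0 := by
    intro h₀
    have hcard := congrArg Multiset.card hlam
    rw [h₀, Polynomial.roots_zero, Multiset.card_zero, Multiset.card_map, Finset.card_val,
      Finset.card_univ, Fintype.card_fin] at hcard
    exact NeZero.ne n hcard.symm
  have hroot : μ ∈ Finset.univ.val.map lam := hlam ▸ (Polynomial.mem_roots hne).2 hμ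
  simpa using hroot

variable {n : ℕ} [NeZero n] {a : Fin n → RatFunc ℂ} {b : ℂ} {P : OnePoint ℂ}
  {h : IsNear a b P} {lam : Fin n → ℂ} {M : solutionSpace a b ≃ₗ[ℂ] solutionSpace a b}
  {φ ψ : solutionSpace a b} {χ : ℂ}

theorem IsNear.IsLocalMonodromy.exists_hasExponent (hM : h.IsLocalMonodromy M) (hF : IsFuchsian a)
    (hlam : IsLocalExponents a P lam) (hφ : φ ≠ 0) (hχ : M φ = χ • φ) :
    ∃ j, h.HasExponent φ (lam j) ∧ χ = Complex.exp (2 * π * I * lam j) := by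
  have hχ₀ : χ ≠ 0 := by
    rintro rfl
    exact hφ (M.map_eq_zero_iff.1 (hχ.trans (zero_smul ℂ φ)))
  obtain ⟨μ, hμ⟩ := h.exists_hasExponent hF hφ hχ₀ hχ (hM φ)
  obtain ⟨j, rfl⟩ := hlam.exists_eq (hμ.isRoot hF)
  exact ⟨j, hμ, hμ.eigenvalue hχ (hM φ)⟩

theorem IsNear.IsLocalMonodromy.hasExponent (hM : h.IsLocalMonodromy M) (hF : IsFuchsian a)
    (hlam : IsLocalExponents a P lam)
    (hinj : Function.Injective fun i => Complex.exp (2 * π * I * lam i)) (hφ : φ ≠ 0) {i : Fin n}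
    (hi : M φ = Complex.exp (2 * π * I * lam i) • φ) : h.HasExponent φ (lam i) := by
  obtain ⟨j, hj, hij⟩ := hM.exists_hasExponent hF hlam hφ hi
  rwa [hinj hij]

theorem IsNear.hasExpExpansion_lift_linearCombination {μ c d : ℂ}
    (hφ : HasExpExpansion (h.lift φ) μ c) (hψ : HasExpExpansion (h.lift ψ) μ d) (k l : ℂ) :
    HasExpExpansion (h.lift (k • φ + l • ψ)) μ (k * c + l * d) := by
  refine (hφ.linearCombination hψ k l).congr ?_
  filter_upwards [h.eventually_mem_halfPlane] with s hs
  simp only [← h.lift_add (k • φ) (l • ψ) hs, Pi.add_apply, ← h.lift_smul k φ hs,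
    ← h.lift_smul l ψ hs, Pi.smul_apply, smul_eq_mul]

theorem IsNear.IsLocalMonodromy.eq_smul_of_hasExponent (hM : h.IsLocalMonodromy M)
    (hF : IsFuchsian a) (hlam : IsLocalExponents a P lam)
    (hinj : Function.Injective fun i => Complex.exp (2 * π * I * lam i)) {i : Fin n}
    (hφ : h.HasExponent φ (lam i)) (hψ : h.HasExponent ψ (lam i))
    (hMφ : M φ = Complex.exp (2 * π * I * lam i) • φ)
    (hMψ : M ψ = Complex.exp (2 * π * I * lam i) • ψ) : ∃ c : ℂ, ψ = c • φ := by
  obtain ⟨c, hc, hφc⟩ := hφ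
  obtain ⟨d, -, hψd⟩ := hψ
  -- The leading terms cancel in `θ`, which nevertheless has exponent `lam i` if it is not zero.
  set θ := c • ψ + -d • φ with hθ
  have hMθ : M θ = Complex.exp (2 * π * I * lam i) • θ := by
    simp only [hθ, map_add, map_smul, hMφ, hMψ, smul_add, smul_comm (Complex.exp _)]
  have hθ₀ : θ = 0 := by
    by_contra hne
    obtain ⟨e, he, hθe⟩ := hM.hasExponent hF hlam hinj hne hMθ
    have hlead : c * d + -d * c = e := tendsto_nhds_unique
      (IsNear.hasExpExpansion_lift_linearCombination hψd hφc c (-d)).tendsto hθe.tendsto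
    exact he (by rw [← hlead]; ring)
  have hcancel : c • ψ = d • φ := by linear_combination (norm := module) hθ₀
  exact ⟨c⁻¹ * d, by rw [mul_smul, ← hcancel, inv_smul_smul₀ hc]⟩

theorem IsNear.IsLocalMonodromy.eq_smul_of_eigenvector (hM : h.IsLocalMonodromy M)
    (hF : IsFuchsian a) (hlam : IsLocalExponents a P lam)
    (hinj : Function.Injective fun i => Complex.exp (2 * π * I * lam i))
    (hφ : φ ≠ 0) (hMφ : M φ = χ • φ) (hMψ : M ψ = χ • ψ) : ∃ c : ℂ, ψ = c • φ := by
  obtain rfl | hψ := eq_or_ne ψ 0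
  · exact ⟨0, (zero_smul ℂ φ).symm⟩
  obtain ⟨i, hi, rfl⟩ := hM.exists_hasExponent hF hlam hφ hMφ
  exact hM.eq_smul_of_hasExponent hF hlam hinj hi (hM.hasExponent hF hlam hinj hψ hMψ) hMφ hMψ

theorem IsNear.IsLocalMonodromy.exists_eigenbasis (hM : h.IsLocalMonodromy M) (hF : IsFuchsian a)
    (hlam : IsLocalExponents a P lam)
    (hinj : Function.Injective fun i => Complex.exp (2 * π * I * lam i)) {k : ℕ} (hk : k ≠ 0)
    (hMk : M ^ k = 1) :
    ∃ f : Module.Basis (Fin n) ℂ (solutionSpace a b),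
      ∀ j, M (f j) = Complex.exp (2 * π * I * lam j) • f j := by
  have : FiniteDimensional ℂ (solutionSpace a b) := (jetEquiv h.notMem).symm.finiteDimensional
  have hrank : Module.finrank ℂ (solutionSpace a b) = Fintype.card (Fin n) := by
    rw [(jetEquiv h.notMem).finrank_eq, Module.finrank_fin_fun, Fintype.card_fin]
  refine LinODE.exists_eigenbasis hrank (Nat.cast_ne_zero.2 hk) (toLinearMap_pow_eq_one hMk) ?_
    fun κ v w => hM.eq_smul_of_eigenvector hF hlam hinj
  intro κ v hv hκ
  obtain ⟨j, -, hj⟩ := hM.exists_hasExponent hF hlam hv hκ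
  exact ⟨j, hj⟩

theorem IsNear.IsLocalMonodromy.eq_smul_of_hasVanishingOrder (hM : h.IsLocalMonodromy M)
    (hF : IsFuchsian a) (hlam : IsLocalExponents a P lam)
    (hinj : Function.Injective fun i => Complex.exp (2 * π * I * lam i)) {i : Fin n}
    (hφ : φ ≠ 0) (hMφ : M φ = Complex.exp (2 * π * I * lam i) • φ) (hMψ : M ψ = χ • ψ)
    (hψ : HasVanishingOrder P (ψ : Germ (𝓝 b) ℂ) (lam i)) : ∃ c : ℂ, ψ = c • φ := by
  obtain rfl | hψ₀ := eq_or_ne ψ 0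
  · exact ⟨0, (zero_smul ℂ φ).symm⟩
  obtain ⟨j, hj, rfl⟩ := hM.exists_hasExponent hF hlam hψ₀ hMψ
  rw [hj.eq_of_hasVanishingOrder hψ] at hMψ
  exact hM.eq_smul_of_eigenvector hF hlam hinj hφ hMφ hMψ

end LocalMonodromy

section QuadraticRadicals

theorem exists_eventually_eq_const_mul_of_pow_eq {u v : ℂ → ℂ} {z : ℂ} (hu : MeromorphicAt u z)
    (hv : MeromorphicAt v z) {N : ℕ} (hN : N ≠ 0) (h : ∀ᶠ x in 𝓝[≠] z, u x ^ N = v x ^ N) :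
    ∃ ζ : ℂ, ∀ᶠ x in 𝓝[≠] z, u x = ζ * v x := by
  have hroot (x : ℂ) (hx : u x ^ N = v x ^ N) :
      ∃ ζ ∈ Polynomial.nthRootsFinset N (1 : ℂ), u x = ζ * v x := by
    obtain hvx | hvx := eq_or_ne (v x) 0
    · refine ⟨1, Polynomial.one_mem_nthRootsFinset (Nat.pos_of_ne_zero hN), ?_⟩
      rw [hvx, zero_pow hN] at hx
      rw [pow_eq_zero_iff hN |>.1 hx, hvx, mul_zero]
    · refine ⟨u x / v x, (Polynomial.mem_nthRootsFinset (Nat.pos_of_ne_zero hN) 1).2 ?_,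
        (div_mul_cancel₀ _ hvx).symm⟩
      rw [div_pow, hx, div_self (pow_ne_zero _ hvx)]
  by_contra hcon
  have hnone : ∀ᶠ x in 𝓝[≠] z, ∀ ζ ∈ Polynomial.nthRootsFinset N (1 : ℂ), u x ≠ ζ * v x :=
    (Filter.eventually_all_finset _).2 fun ζ _ => by
      by_contra hfreq
      have hζv : MeromorphicAt (fun x => ζ * v x) z := (MeromorphicAt.const ζ z).fun_mul hv
      exact hcon ⟨ζ, (hu.frequently_eq_iff_eventuallyEq hζv).1 (by simpa using hfreq)⟩
  obtain ⟨x, hx, hpow⟩ := (hnone.and h).exists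
  obtain ⟨ζ, hζ, heq⟩ := hroot x hpow
  exact hx ζ hζ heq

theorem exists_common_sqrt {ι : Type*} {d : ι → ℂ → ℂ} {b : ℂ} (hd : ∀ i, AnalyticAt ℂ (d i) b)
    (hR : ∀ i j, ∃ R : RatFunc ℂ, ∀ᶠ z in 𝓝 b, d i z * d j z = ratVal R z) :
    ∃ (g : RatFunc ℂ) (r : ℂ → ℂ), (r = 1 ∨ r ∈ Set.range d) ∧
      (∀ᶠ z in 𝓝 b, r z ^ 2 = ratVal g z) ∧
      ∀ i, ∃ q : RatFunc ℂ, ∀ᶠ z in 𝓝[≠] b, d i z = ratVal q z * r z := by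
  by_cases! hex : ∃ i, ¬d i =ᶠ[𝓝 b] 0
  · obtain ⟨i₀, hi₀⟩ := hex
    have hne : ∀ᶠ z in 𝓝[≠] b, d i₀ z ≠ 0 :=
      (hd i₀).eventually_eq_zero_or_eventually_ne_zero.resolve_left hi₀
    choose R hR using fun i => hR i i₀
    have hR₀ : R i₀ ≠ 0 := by
      intro h₀
      obtain ⟨z, hz, hRz⟩ := (hne.and ((hR i₀).filter_mono nhdsWithin_le_nhds)).exists
      rw [h₀, ← map_zero (algebraMap (Polynomial ℂ) (RatFunc ℂ)), ratVal_algebraMap,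
        Polynomial.eval_zero] at hRz
      exact mul_ne_zero hz hz hRz
    have hRne (i : ι) := (hR i).filter_mono (nhdsWithin_le_nhds (s := {b}ᶜ))
    refine ⟨R i₀, d i₀, .inr ⟨i₀, rfl⟩, by simpa only [pow_two] using hR i₀,
      fun i => ⟨R i / R i₀, ?_⟩⟩
    filter_upwards [hne, hRne i₀, hRne i, eventually_denom_ne_zero (R i / R i₀) b,
      eventually_denom_ne_zero (R i₀) b] with z hz hz₀ hzi hq hd₀
    refine mul_right_cancel₀ hz ?_
    rw [hzi, mul_assoc, hz₀, ← ratVal_mul hq hd₀, div_mul_cancel₀ _ hR₀]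
  · refine ⟨algebraMap (Polynomial ℂ) (RatFunc ℂ) 1, 1, .inl rfl, .of_forall fun z => ?_,
      fun i => ⟨algebraMap (Polynomial ℂ) (RatFunc ℂ) 0, ?_⟩⟩
    · rw [ratVal_algebraMap, Polynomial.eval_one, Pi.one_apply, one_pow]
    · filter_upwards [(hex i).filter_mono nhdsWithin_le_nhds] with z hz
      rw [ratVal_algebraMap, Polynomial.eval_zero, zero_mul]
      exact hz

end QuadraticRadicals

section Invariants

variable {n : ℕ} {a : Fin n → RatFunc ℂ} {b : ℂ} {N : ℕ}

theorem EqUpToRoot.rep_pow_eventuallyEq {φ ψ : solutionSpace a b} (h : EqUpToRoot ℂ N φ ψ) :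
    ∀ᶠ z in 𝓝 b, rep φ z ^ N = rep ψ z ^ N := by
  obtain ⟨c, hc, rfl⟩ := h
  filter_upwards [rep_smul c ψ] with z hz
  rw [hz, Pi.smul_apply, smul_eq_mul, mul_pow, hc, one_mul]

/-- Half the difference of the `N`-th powers of `φ` and `ψ`: the term `q√g` when these powers are
`p ± q√g`. -/
def halfPowSub (N : ℕ) (φ ψ : solutionSpace a b) (z : ℂ) : ℂ :=
  (rep φ z ^ N - rep ψ z ^ N) / 2

theorem analyticAt_halfPowSub (φ ψ : solutionSpace a b) : AnalyticAt ℂ (halfPowSub N φ ψ) b :=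
  (((isSolutionAt_rep φ).1.pow N).sub ((isSolutionAt_rep ψ).1.pow N)).div_const

variable [NeZero n]

theorem isRadical_of_eqUpToRoot (hF : IsFuchsian a) (hb : b ∉ singularSet a) (hN : N ≠ 0)
    {φ : solutionSpace a b} (hφ : ∀ T : monodromyGroup a b, EqUpToRoot ℂ N (T.1 φ) φ) :
    IsRadical (φ : Germ (𝓝 b) ℂ) := by
  obtain ⟨R, hR⟩ := exists_ratFunc_of_invariant hF hb (f := fun _ : Unit => φ)
    (Q := MvPolynomial.X () ^ N) fun T hT => by
      simp only [map_pow, MvPolynomial.eval_X]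
      exact (hφ ⟨T, hT⟩).rep_pow_eventuallyEq
  refine ⟨rep φ, N, R, coe_rep φ, hN, hR.filter_mono nhdsWithin_le_nhds |>.mono fun z hz => ?_⟩
  rwa [map_pow, MvPolynomial.eval_X] at hz

theorem exists_ratFunc_half_add (hF : IsFuchsian a) (hb : b ∉ singularSet a)
    {φ ψ : solutionSpace a b}
    (h : ∀ T : monodromyGroup a b, FixesUpToRoot ℂ N T.1 φ ψ ∨ SwapsUpToRoot ℂ N T.1 φ ψ) :
    ∃ R : RatFunc ℂ, ∀ᶠ z in 𝓝 b, (rep φ z ^ N + rep ψ z ^ N) / 2 = ratVal R z := by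
  have hQ (x : Fin 2 → ℂ) :
      ((.C 2⁻¹ * (.X 0 ^ N + .X 1 ^ N) : MvPolynomial (Fin 2) ℂ)).eval x =
        (x 0 ^ N + x 1 ^ N) / 2 := by
    simp [div_eq_inv_mul]
  obtain ⟨R, hR⟩ := exists_ratFunc_of_invariant hF hb (f := ![φ, ψ])
    (Q := .C 2⁻¹ * (.X 0 ^ N + .X 1 ^ N)) fun T hT => by
      simp only [hQ, Matrix.cons_val_zero, Matrix.cons_val_one]
      obtain ⟨hφ, hψ⟩ | ⟨hφ, hψ⟩ := h ⟨T, hT⟩ <;>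
        filter_upwards [hφ.rep_pow_eventuallyEq, hψ.rep_pow_eventuallyEq] with z hφz hψz
      · rw [hφz, hψz]
      · rw [hφz, hψz, add_comm]
  exact ⟨R, by simpa only [hQ, Matrix.cons_val_zero, Matrix.cons_val_one] using hR⟩

theorem exists_ratFunc_halfPowSub_mul (hF : IsFuchsian a) (hb : b ∉ singularSet a)
    {φ ψ φ' ψ' : solutionSpace a b}
    (h : ∀ T : monodromyGroup a b,
      (FixesUpToRoot ℂ N T.1 φ ψ ∧ FixesUpToRoot ℂ N T.1 φ' ψ') ∨
      (SwapsUpToRoot ℂ N T.1 φ ψ ∧ SwapsUpToRoot ℂ N T.1 φ' ψ')) :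
    ∃ R : RatFunc ℂ, ∀ᶠ z in 𝓝 b, halfPowSub N φ ψ z * halfPowSub N φ' ψ' z = ratVal R z := by
  have hQ (x : Fin 4 → ℂ) :
      ((.C 4⁻¹ * ((.X 0 ^ N - .X 1 ^ N) * (.X 2 ^ N - .X 3 ^ N)) :
        MvPolynomial (Fin 4) ℂ)).eval x = (x 0 ^ N - x 1 ^ N) / 2 * ((x 2 ^ N - x 3 ^ N) / 2) := by
    simp only [map_mul, map_sub, map_pow, MvPolynomial.eval_C, MvPolynomial.eval_X]
    ring
  obtain ⟨R, hR⟩ := exists_ratFunc_of_invariant hF hb (f := ![φ, ψ, φ', ψ'])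
    (Q := .C 4⁻¹ * ((.X 0 ^ N - .X 1 ^ N) * (.X 2 ^ N - .X 3 ^ N))) fun T hT => by
      simp only [hQ, Matrix.cons_val]
      obtain ⟨⟨h₀, h₁⟩, h₂, h₃⟩ | ⟨⟨h₀, h₁⟩, h₂, h₃⟩ := h ⟨T, hT⟩ <;>
        filter_upwards [h₀.rep_pow_eventuallyEq, h₁.rep_pow_eventuallyEq, h₂.rep_pow_eventuallyEq,
          h₃.rep_pow_eventuallyEq] with z hz₀ hz₁ hz₂ hz₃ <;>
        rw [hz₀, hz₁, hz₂, hz₃]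
      ring
  exact ⟨R, by simpa only [hQ, Matrix.cons_val, halfPowSub] using hR⟩

end Invariants

section Periodicity

open Complex (I)
open scoped Real

variable {n : ℕ} {a : Fin n → RatFunc ℂ} {b : ℂ} {P : OnePoint ℂ}

/-- The germ `r` at `b` continues to a single-valued function around `P`: in the logarithmic
coordinate it extends to a `2πi`-periodic analytic function. -/
def IsNear.IsSingleValued (h : IsNear a b P) (r : ℂ → ℂ) : Prop :=
  ∃ k : ℂ → ℂ, AnalyticOnNhd ℂ k h.halfPlane ∧ (∀ᶠ s in 𝓝 0, k s = r (localExp P b s)) ∧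
    ∀ s ∈ h.halfPlane, k (s + 2 * π * I) = k s

theorem IsNear.isSingleValued_one (h : IsNear a b P) : h.IsSingleValued 1 :=
  ⟨1, analyticOnNhd_const, .of_forall fun _ => rfl, fun _ _ => rfl⟩

theorem IsNear.tendsto_localExp_nhdsNE (h : IsNear a b P) :
    Tendsto (localExp P b) (𝓝[≠] 0) (𝓝[≠] b) := by
  have horient : orient P ≠ 0 := left_ne_zero_of_mul_eq_one (orient_mul_self P)
  have hderiv := hasDerivAt_localExp P b 0
  rw [localExp_zero] at hderiv
  simpa only [localExp_zero] using
    hderiv.tendsto_nhdsNE (mul_ne_zero horient (sub_ne_zero.2 h.ne_center))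

theorem IsRadicalOrDihedral.exists_polynomial_mul_pow_eq {g : RatFunc ℂ} {y : solutionSpace a b}
    (hy : IsRadicalOrDihedral a g y) {r : ℂ → ℂ} (hr : MeromorphicAt r b)
    (hg : ∀ᶠ z in 𝓝[≠] b, r z ^ 2 = ratVal g z) :
    ∃ (N : ℕ) (D A B : Polynomial ℂ), N ≠ 0 ∧ ∀ᶠ z in 𝓝[≠] b,
      D.eval z ≠ 0 ∧ D.eval z * rep y z ^ N = A.eval z + B.eval z * r z := by
  obtain ⟨F, N, R, hyF, hN, hR⟩ | ⟨_, F, _, r', N, p, q, _, hyF, _, hN, hr', hev⟩ := hy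
  · refine ⟨N, R.denom, R.num, 0, hN, ?_⟩
    filter_upwards [hR, (rep_eventuallyEq hyF).filter_mono nhdsWithin_le_nhds,
      eventually_denom_ne_zero R b] with z hRz hFz hdz
    rw [hFz, hRz, ratVal_eq, Polynomial.eval_zero, zero_mul, add_zero]
    exact ⟨hdz, mul_div_cancel₀ _ hdz⟩
  · obtain ⟨ζ, hζ⟩ := exists_eventually_eq_const_mul_of_pow_eq hr' hr two_ne_zero
      (hev.mp (hg.mono fun z hgz hz => hz.1.trans hgz.symm))
    refine ⟨N, p.denom * q.denom, p.num * q.denom, .C ζ * q.num * p.denom, hN, ?_⟩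
    filter_upwards [hζ, hev, (rep_eventuallyEq hyF).filter_mono nhdsWithin_le_nhds,
      eventually_denom_ne_zero p b, eventually_denom_ne_zero q b] with z hζz hz hFz hpz hqz
    rw [hFz, hz.2.1, hζz, ratVal_eq, ratVal_eq]
    simp only [Polynomial.eval_mul, Polynomial.eval_C]
    exact ⟨mul_ne_zero hpz hqz, by field_simp⟩

variable [NeZero n] {N : ℕ} {h : IsNear a b P} {M : solutionSpace a b → solutionSpace a b}

theorem IsNear.IsLocalMonodromy.lift_pow_periodic (hM : h.IsLocalMonodromy M)
    {φ : solutionSpace a b} (hφ : EqUpToRoot ℂ N (M φ) φ) {s : ℂ} (hs : s ∈ h.halfPlane) :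
    h.lift φ (s + 2 * π * I) ^ N = h.lift φ s ^ N := by
  obtain ⟨c, hc, hMφ⟩ := hφ
  rw [← hM φ s hs, hMφ, ← h.lift_smul c φ hs, Pi.smul_apply, smul_eq_mul, mul_pow, hc, one_mul]

theorem IsNear.IsLocalMonodromy.isSingleValued_halfPowSub (hM : h.IsLocalMonodromy M)
    {φ ψ : solutionSpace a b} (hfix : FixesUpToRoot ℂ N M φ ψ) :
    h.IsSingleValued (halfPowSub N φ ψ) := by
  refine ⟨fun s => (h.lift φ s ^ N - h.lift ψ s ^ N) / 2, fun s hs =>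
    (((h.analyticOnNhd_lift φ s hs).pow N).sub ((h.analyticOnNhd_lift ψ s hs).pow N)).div_const,
    ?_, fun s hs => by
      simp only [hM.lift_pow_periodic hfix.1 hs, hM.lift_pow_periodic hfix.2 hs]⟩
  filter_upwards [h.eventually_lift_eq_rep φ, h.eventually_lift_eq_rep ψ] with s hφs hψs
  rw [hφs, hψs, halfPowSub]

theorem IsNear.eqOn_eval_mul_lift_pow (h : IsNear a b P) {D A B : Polynomial ℂ} {r k : ℂ → ℂ}
    {y : solutionSpace a b}
    (hy : ∀ᶠ z in 𝓝[≠] b, D.eval z * rep y z ^ N = A.eval z + B.eval z * r z)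
    (hk : AnalyticOnNhd ℂ k h.halfPlane) (hkr : ∀ᶠ s in 𝓝 0, k s = r (localExp P b s)) :
    Set.EqOn (fun s => D.eval (localExp P b s) * h.lift y s ^ N)
      (fun s => A.eval (localExp P b s) + B.eval (localExp P b s) * k s) h.halfPlane := by
  have hpoly (Q : Polynomial ℂ) :
      AnalyticOnNhd ℂ (fun s => Q.eval (localExp P b s)) h.halfPlane := fun s _ =>
    (AnalyticOnNhd.eval_polynomial (𝕜 := ℂ) Q _ trivial).fun_comp
      ((differentiable_localExp P b).analyticAt s)
  refine ((hpoly D).mul ((h.analyticOnNhd_lift y).pow N)).eqOn_of_preconnected_of_frequently_eq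
    ((hpoly A).add ((hpoly B).mul hk)) h.convex_halfPlane.isPreconnected h.zero_mem
    (Eventually.frequently ?_)
  filter_upwards [h.tendsto_localExp_nhdsNE.eventually hy,
    (h.eventually_lift_eq_rep y).filter_mono nhdsWithin_le_nhds,
    hkr.filter_mono nhdsWithin_le_nhds] with s hys hlift hks
  rw [Pi.pow_apply, hlift, hks, hys]

theorem IsNear.exists_eq_smul_of_lift_pow_eq (h : IsNear a b P) (hN : N ≠ 0)
    {φ ψ : solutionSpace a b} (hpow : ∀ᶠ s in 𝓝[≠] 0, h.lift φ s ^ N = h.lift ψ s ^ N) :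
    ∃ ζ : ℂ, φ = ζ • ψ := by
  have hφ := h.analyticOnNhd_lift φ 0 h.zero_mem
  have hψ := h.analyticOnNhd_lift ψ 0 h.zero_mem
  obtain ⟨ζ, hζ⟩ :=
    exists_eventually_eq_const_mul_of_pow_eq hφ.meromorphicAt hψ.meromorphicAt hN hpow
  have hζ₀ : ∀ᶠ s in 𝓝 0, h.lift φ s = ζ * h.lift ψ s :=
    (hφ.continuousAt.eventuallyEq_nhds_iff_eventuallyEq_nhdsNE
      (continuousAt_const.mul hψ.continuousAt)).1 hζ
  refine ⟨ζ, ext_of_rep ?_⟩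
  filter_upwards [h.rep_eventuallyEq_lift φ, h.rep_eventuallyEq_lift ψ, rep_smul ζ ψ,
    (tendsto_localLog h.ne_center).eventually hζ₀] with z hφz hψz hsmul hz
  rw [hφz, hsmul, Pi.smul_apply, hψz, hz, smul_eq_mul]

theorem IsNear.IsLocalMonodromy.exists_eq_smul (hM : h.IsLocalMonodromy M) {r : ℂ → ℂ}
    (hr : MeromorphicAt r b) (hsv : h.IsSingleValued r) {g : RatFunc ℂ}
    (hg : ∀ᶠ z in 𝓝[≠] b, r z ^ 2 = ratVal g z) {y : solutionSpace a b}
    (hy : IsRadicalOrDihedral a g y) : ∃ ζ : ℂ, M y = ζ • y := by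
  obtain ⟨N, D, A, B, hN, hev⟩ := hy.exists_polynomial_mul_pow_eq hr hg
  obtain ⟨k, hk, hkr, hkper⟩ := hsv
  have hall := h.eqOn_eval_mul_lift_pow (hev.mono fun _ hz => hz.2) hk hkr
  refine h.exists_eq_smul_of_lift_pow_eq hN ?_
  filter_upwards [h.tendsto_localExp_nhdsNE.eventually hev,
    mem_nhdsWithin_of_mem_nhds (h.isOpen_halfPlane.mem_nhds h.zero_mem)] with s hD hs
  have hperiod := hall (h.add_two_pi_I_mem hs)
  simp only [localExp_add_two_pi_I, hkper s hs] at hperiod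
  rw [hM y s hs]
  exact mul_left_cancel₀ hD.1 (hperiod.trans (hall hs).symm)

end Periodicity

section Eigenbasis

variable {n : ℕ} {a : Fin n → RatFunc ℂ} {b : ℂ}

theorem subsingleton_solutionSpace_of_eq_zero (hn : n = 0) : Subsingleton (solutionSpace a b) := by
  subst hn
  have hzero (φ : solutionSpace a b) : rep φ =ᶠ[𝓝 b] 0 := by
    filter_upwards [(isSolutionAt_rep φ).2] with z hz
    simpa using hz
  exact ⟨fun φ ψ => ext_of_rep ((hzero φ).trans (hzero ψ).symm)⟩

theorem ne_zero_of_mulEquiv_dihedral {m : ℕ} (e : monodromyGroup a b ≃* DihedralGroup m) :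
    n ≠ 0 := by
  intro hn
  have := subsingleton_solutionSpace_of_eq_zero (a := a) (b := b) hn
  have : Subsingleton (monodromyGroup a b) :=
    ⟨fun S T => Subtype.ext (LinearEquiv.ext fun φ => Subsingleton.elim _ _)⟩
  exact not_subsingleton (DihedralGroup m) e.symm.subsingleton

variable [NeZero n] {P : OnePoint ℂ} {h : IsNear a b P} {N : ℕ}

theorem isDihedralSolution_of_halfPowSub (hF : IsFuchsian a) (hb : b ∉ singularSet a) (hN : N ≠ 0)
    {φ ψ : solutionSpace a b} (hφψ : LinearIndependent ℂ ![φ, ψ])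
    (hG : ∀ T : monodromyGroup a b, FixesUpToRoot ℂ N T.1 φ ψ ∨ SwapsUpToRoot ℂ N T.1 φ ψ)
    {g q : RatFunc ℂ} {r : ℂ → ℂ} (hr : MeromorphicAt r b)
    (hg : ∀ᶠ z in 𝓝[≠] b, r z ^ 2 = ratVal g z)
    (hq : ∀ᶠ z in 𝓝[≠] b, halfPowSub N φ ψ z = ratVal q z * r z) : IsDihedralSolution a g φ := by
  obtain ⟨p, hp⟩ := exists_ratFunc_half_add hF hb hG
  refine ⟨ψ, rep φ, rep ψ, r, N, p, q, hφψ, coe_rep φ, coe_rep ψ, hN, hr, ?_⟩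
  filter_upwards [hq, hp.filter_mono nhdsWithin_le_nhds, hg] with z hqz hpz hgz
  rw [← hqz, ← hpz, halfPowSub]
  exact ⟨hgz, by ring, by ring⟩

theorem IsNear.IsLocalMonodromy.exists_isSingleValued_sqrt
    {M : solutionSpace a b → solutionSpace a b} (hM : h.IsLocalMonodromy M) (hF : IsFuchsian a)
    {ι : Type*} {φ ψ : ι → solutionSpace a b} (hfix : ∀ i, FixesUpToRoot ℂ N M (φ i) (ψ i))
    (hG : ∀ T : monodromyGroup a b, (∀ i, FixesUpToRoot ℂ N T.1 (φ i) (ψ i)) ∨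
      ∀ i, SwapsUpToRoot ℂ N T.1 (φ i) (ψ i)) :
    ∃ (g : RatFunc ℂ) (r : ℂ → ℂ), MeromorphicAt r b ∧ h.IsSingleValued r ∧
      (∀ᶠ z in 𝓝[≠] b, r z ^ 2 = ratVal g z) ∧
      ∀ i, ∃ q : RatFunc ℂ, ∀ᶠ z in 𝓝[≠] b, halfPowSub N (φ i) (ψ i) z = ratVal q z * r z := by
  obtain ⟨g, r, hr, hg, hq⟩ := exists_common_sqrt (d := fun i => halfPowSub N (φ i) (ψ i))
    (fun i => analyticAt_halfPowSub _ _) fun i j =>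
      exists_ratFunc_halfPowSub_mul hF h.notMem fun T =>
        (hG T).imp (fun hT => ⟨hT i, hT j⟩) fun hT => ⟨hT i, hT j⟩
  refine ⟨g, r, ?_, ?_, hg.filter_mono nhdsWithin_le_nhds, hq⟩ <;>
    obtain rfl | ⟨i, rfl⟩ := hr
  · exact MeromorphicAt.const 1 b
  · exact (analyticAt_halfPowSub _ _).meromorphicAt
  · exact h.isSingleValued_one
  · exact hM.isSingleValued_halfPowSub (hfix i)

theorem isRadicalOrDihedral_of_smul (hF : IsFuchsian a) (hb : b ∉ singularSet a)
    [Finite (monodromyGroup a b)] {ι : Type*} {f : Module.Basis ι ℂ (solutionSpace a b)}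
    {T₀ : monodromyGroup a b} {i j : ι} {c : ℂ} (hc : T₀.1 (f i) = c • f j)
    (hG : ∀ T : monodromyGroup a b,
      FixesUpToRoot ℂ (Nat.card (monodromyGroup a b)) T.1 (f i) (T₀.1 (f i)) ∨
      SwapsUpToRoot ℂ (Nat.card (monodromyGroup a b)) T.1 (f i) (T₀.1 (f i)))
    {g q : RatFunc ℂ} {r : ℂ → ℂ} (hr : MeromorphicAt r b)
    (hg : ∀ᶠ z in 𝓝[≠] b, r z ^ 2 = ratVal g z)
    (hq : ∀ᶠ z in 𝓝[≠] b,
      halfPowSub (Nat.card (monodromyGroup a b)) (f i) (T₀.1 (f i)) z = ratVal q z * r z) :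
    IsRadicalOrDihedral a g (f i) := by
  have hN : Nat.card (monodromyGroup a b) ≠ 0 := Nat.card_pos.ne'
  obtain rfl | hij := eq_or_ne i j
  · refine .inl (isRadical_of_eqUpToRoot hF hb hN fun T => ?_)
    exact (hG T).elim (·.1) fun hswap => hswap.1.trans (eqUpToRoot_of_smul (f.ne_zero i) hc)
  · have hc₀ : c ≠ 0 := by
      rintro rfl
      rw [zero_smul, LinearEquiv.map_eq_zero_iff] at hc
      exact f.ne_zero i hc
    have hind : LinearIndependent ℂ ![f i, T₀.1 (f i)] :=
      hc ▸ linearIndependent_pair_smul f hij hc₀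
    exact .inr (isDihedralSolution_of_halfPowSub hF hb hN hind hG hr hg hq)

theorem IsNear.IsLocalMonodromy.exists_sqrt_of_eigenbasis {M : monodromyGroup a b}
    (hM : h.IsLocalMonodromy M.1) (hF : IsFuchsian a) [Finite (monodromyGroup a b)]
    (hhalf : IsHalfCentral M) {ι : Type*} {f : Module.Basis ι ℂ (solutionSpace a b)} {χ : ι → ℂ}
    (hχ : Function.Injective χ) (hf : ∀ i, M.1 (f i) = χ i • f i) :
    ∃ g : RatFunc ℂ, (∀ i, IsRadicalOrDihedral a g (f i)) ∧
      ∀ y, IsRadicalOrDihedral a g y → ∃ ζ : ℂ, M.1 y = ζ • y := by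
  obtain ⟨T₀, hT₀⟩ := hhalf.exists_fixesUpToRoot_and_swapsUpToRoot hχ hf
  have hG (T : monodromyGroup a b) :
      (∀ i, FixesUpToRoot ℂ (Nat.card (monodromyGroup a b)) T.1 (f i) (T₀.1 (f i))) ∨
      ∀ i, SwapsUpToRoot ℂ (Nat.card (monodromyGroup a b)) T.1 (f i) (T₀.1 (f i)) :=
    (em (Commute T M)).imp (fun hT i => (hT₀ T i).1 hT) fun hT i => (hT₀ T i).2 hT
  obtain ⟨g, r, hr, hsv, hg, hq⟩ :=
    hM.exists_isSingleValued_sqrt hF (fun i => (hT₀ M i).1 (.refl M)) hG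
  refine ⟨g, fun i => ?_, fun y hy => hM.exists_eq_smul hr hsv hg hy⟩
  obtain ⟨j, c, hc⟩ := hhalf.exists_smul hχ hf T₀ i
  obtain ⟨q, hq⟩ := hq i
  exact isRadicalOrDihedral_of_smul hF h.notMem hc (fun T => (hG T).imp (· i) (· i)) hr hg hq

end Eigenbasis

end

end LinODE

theorem mainTheorem7 {n : ℕ} (a : Fin n → RatFunc ℂ) (hFuchs : LinODE.IsFuchsian a)
    (P : OnePoint ℂ) (b : ℂ) (hb : LinODE.IsNear a b P)
    (m : ℕ) (hm : m ≠ 0)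
    (hmono : Nonempty (LinODE.monodromyGroup a b ≃* DihedralGroup m))
    (lam : Fin n → ℂ) (hlam : LinODE.IsLocalExponents a P lam)
    (hdist : ∀ i j : Fin n, i ≠ j → ∀ k : ℤ, lam i - lam j ≠ (k : ℂ))
    (hexc : n = 2 → (∀ i : Fin n, ∃ k : ℤ, 2 * lam i = (k : ℂ)) → m ∣ 4) :
    ∃ (g : RatFunc ℂ) (f : Module.Basis (Fin n) ℂ (LinODE.solutionSpace a b)),
      (∀ i : Fin n, LinODE.IsRadicalOrDihedral a g (f i) ∧
        LinODE.HasVanishingOrder P (f i : Germ (𝓝 b) ℂ) (lam i)) ∧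
      ∀ (i : Fin n) (y : LinODE.solutionSpace a b), LinODE.IsRadicalOrDihedral a g y →
        LinODE.HasVanishingOrder P (y : Germ (𝓝 b) ℂ) (lam i) → ∃ c : ℂ, y = c • f i := by
  obtain ⟨e⟩ := hmono
  have : NeZero n := ⟨LinODE.ne_zero_of_mulEquiv_dihedral e⟩
  have : NeZero m := ⟨hm⟩
  have : Finite (LinODE.monodromyGroup a b) := .of_equiv _ e.symm.toEquiv
  have hinj := LinODE.injective_exp_two_pi_I_mul hdist
  obtain ⟨M, hM⟩ := hb.exists_isLocalMonodromy
  obtain ⟨f, hf⟩ := hM.exists_eigenbasis hFuchs hlam hinj Nat.card_pos.ne'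
    (congrArg Subtype.val (pow_card_eq_one' (x := M)))
  have hhalf : LinODE.IsHalfCentral M := LinODE.isHalfCentral_of_eigenbasis e hinj hf
    fun hn hsq => hexc (by simpa using hn) fun i =>
      LinODE.exists_intCast_eq_two_mul_of_exp_sq_eq_one (hsq i)
  obtain ⟨g, hg, hgM⟩ := hM.exists_sqrt_of_eigenbasis hFuchs hhalf hinj hf
  refine ⟨g, f, fun i => ⟨hg i, ?_⟩, fun i y hy hord => ?_⟩
  · exact (hM.hasExponent hFuchs hlam hinj (f.ne_zero i) (hf i)).hasVanishingOrder
  · obtain ⟨ζ, hζ⟩ := hgM y hy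
    exact hM.eq_smul_of_hasVanishingOrder hFuchs hlam hinj (f.ne_zero i) (hf i) hζ hord
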